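/- Let $\mathcal{H}$ be a separable complex Hilbert space, $\mathfrak{T}(\mathcal{H})$ the Banach space of trace-class operators on $\mathcal{H}$ with the trace norm $\|T\|_1=\mathrm{Tr}|T|$, and $\mathfrak{B}(\mathcal{H})$ the space of bounded operators. A state is a positive operator of unit trace; it is pure if it equals $|\varphi\rangle\langle\varphi|$ for a unit vector $\varphi$. A quantum operation is a completely positive trace-non-increasing linear map $\Phi:\mathfrak{T}(\mathcal{H})\to\mathfrak{T}(\mathcal{H})$. It is entanglement-breaking if for every separable Hilbert space $\mathcal{K}$ and every state $\omega$ on $\mathcal{H}\otimes\mathcal{K}$ the operator $(\Phi\otimes\mathrm{Id}_{\mathcal{K}})(\omega)$ belongs to the closed (in the trace norm) convex hull of the operators $A\otimes B$ with $A\in\mathfrak{T}(\mathcal{H})$, $B\in\mathfrak{T}(\mathcal{K})$ positive. Let $(X,\mathcal{F})$ be a measurable space. An instrument in $\mathcal{H}$ with outcome space $(X,\mathcal{F})$ is a map $\mathfrak{M}$ assigning to every $F\in\mathcal{F}$ a quantum operation $\mathfrak{M}(F)$ such that $\mathfrak{M}(\bigcup_n F_n)[T]=\sum_n\mathfrak{M}(F_n)[T]$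 in the trace norm for every sequence of pairwise disjoint $F_n\in\mathcal{F}$ and every $T\in\mathfrak{T}(\mathcal{H})$, and such that $\mathfrak{M}(X)$ preserves the trace. For a state $\rho$ put $\mu_\rho(F)=\mathrm{Tr}\,\mathfrak{M}(F)[\rho]$. A family $\{\rho_x\}_{x\in X}$ of states is a family of posteriori states for the a priori state $\rho$ if $x\mapsto\mathrm{Tr}A\rho_x$ is $\mathcal{F}$-measurable for every $A\in\mathfrak{B}(\mathcal{H})$ and $\int_F\rho_x\,\mu_\rho(dx)=\mathfrak{M}(F)[\rho]$ (Bochner integral in $\mathfrak{T}(\mathcal{H})$) for all $F\in\mathcal{F}$; such a family exists and is unique up to $\mu_\rho$-null sets. The instrument $\mathfrak{M}$ is irreducible if for every pure a priori state $\rho$ the posteriori states $\rho_x$ are pure for $\mu_\rho$-almost all $x$. It is efficient if there are a Hilbert space $\mathcal{H}_0$, an isometry $V:\mathcal{H}\to\mathcal{H}\otimes\mathcal{H}_0$ and a spectral (projection-valued) measure $P$ on $(X,\mathcal{F})$ in $\mathcal{H}_0$ of multiplicity one (that is, the vectors $P(F)\xi$, $F\in\mathcal{F}$, span a dense subspace of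 $\mathcal{H}_0$ for some $\xi\in\mathcal{H}_0$) such that $\mathfrak{M}^*(F)[A]=V^*(A\otimes P(F))V$ for all $F\in\mathcal{F}$ and $A\in\mathfrak{B}(\mathcal{H})$, where $\mathfrak{M}^*(F)$ is the map dual to $\mathfrak{M}(F)$. Claim. If no value $\mathfrak{M}(F)$, $F\in\mathcal{F}$, is a nonzero entanglement-breaking quantum operation, then $\mathfrak{M}$ is efficient if and only if it is irreducible. -/

import Mathlib

namespace QuantumInstrument

open MeasureTheory Topology
open scoped ENNReal InnerProductSpace ComplexOrder TensorProduct

section TraceClass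

variable {H K : Type*} [NormedAddCommGroup H] [InnerProductSpace ℂ H]
  [NormedAddCommGroup K] [InnerProductSpace ℂ K]

theorem tsum_enorm_inner_sq {ι : Type*} (b : HilbertBasis ι ℂ H) (x : H) :
    ∑' i, ‖inner ℂ (b i) x‖ₑ ^ 2 = ‖x‖ₑ ^ 2 := by
  have h := b.hasSum_inner_mul_inner x x
  have h1 : HasSum (fun i => ‖inner ℂ (b i) x‖ ^ 2) (‖x‖ ^ 2) := by
    have h2 := Complex.hasSum_re h
    rw [inner_self_eq_norm_sq_to_K] at h2
    convert h2 using 1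
    · ext i
      rw [← inner_conj_symm x (b i), mul_comm, Complex.mul_conj, Complex.normSq_eq_norm_sq]
      norm_cast
    · norm_cast
  have h3 := ENNReal.ofReal_tsum_of_nonneg (fun i => by positivity) h1.summable
  rw [h1.tsum_eq] at h3
  simp only [ENNReal.ofReal_pow (norm_nonneg _), ofReal_norm] at h3
  exact h3.symm

variable [CompleteSpace H] [CompleteSpace K]

theorem tsum_enorm_sq_adjoint {ι κ : Type*} (b : HilbertBasis ι ℂ H) (c : HilbertBasis κ ℂ K)
    (S : H →L[ℂ] K) :
    ∑' i, ‖S (b i)‖ₑ ^ 2 = ∑' j, ‖ContinuousLinearMap.adjoint S (c j)‖ₑ ^ 2 := by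
  calc ∑' i, ‖S (b i)‖ₑ ^ 2 = ∑' i, ∑' j, ‖inner ℂ (c j) (S (b i))‖ₑ ^ 2 := by
        simp_rw [tsum_enorm_inner_sq c]
    _ = ∑' j, ∑' i, ‖inner ℂ (b i) (ContinuousLinearMap.adjoint S (c j))‖ₑ ^ 2 := by
        rw [ENNReal.tsum_comm]
        refine tsum_congr fun j => tsum_congr fun i => ?_
        rw [ContinuousLinearMap.adjoint_inner_right, ← inner_conj_symm, RCLike.enorm_conj]
    _ = _ := by simp_rw [tsum_enorm_inner_sq b]

variable (H) in
/-- The index set of a fixed orthonormal basis of the Hilbert space `H`. -/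
noncomputable def basisIndex : Set H := (exists_hilbertBasis ℂ H).choose

variable (H) in
/-- A fixed orthonormal basis of the Hilbert space `H`. -/
noncomputable def basis : HilbertBasis (basisIndex H) ℂ H :=
  (exists_hilbertBasis ℂ H).choose_spec.choose

/-- The trace norm `Tr |T|`, where `|T| = (T* T)^(1/2)`, as an extended nonnegative number. -/
noncomputable def traceNorm (T : H →L[ℂ] H) : ℝ≥0∞ :=
  ∑' i, ENNReal.ofReal (inner ℂ (basis H i) (CFC.abs T (basis H i))).re

/-- The square of the Hilbert-Schmidt norm. -/
noncomputable def hsSq (S : H →L[ℂ] H) : ℝ≥0∞ := ∑' i, ‖S (basis H i)‖ₑ ^ 2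

theorem hsSq_adjoint (S : H →L[ℂ] H) : hsSq (ContinuousLinearMap.adjoint S) = hsSq S :=
  (tsum_enorm_sq_adjoint (basis H) (basis H) S).symm

theorem hsSq_eq {ι : Type*} (b : HilbertBasis ι ℂ H) (S : H →L[ℂ] H) :
    hsSq S = ∑' i, ‖S (b i)‖ₑ ^ 2 := by
  rw [tsum_enorm_sq_adjoint b (basis H), ← hsSq_adjoint S, hsSq]

theorem hsSq_comp_le (W S : H →L[ℂ] H) (hW : ‖W‖ ≤ 1) : hsSq (W ∘L S) ≤ hsSq S := by
  refine ENNReal.tsum_le_tsum fun i => ?_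
  gcongr
  refine enorm_le_iff_norm_le.2 ?_
  exact (W.le_of_opNorm_le hW _).trans (by simp)

theorem tsum_inner_comp_le (X Y : H →L[ℂ] H) :
    2 * ∑' i, ‖inner ℂ (basis H i) (X (Y (basis H i)))‖ₑ ≤ hsSq X + hsSq Y := by
  rw [← hsSq_adjoint X, hsSq, hsSq, ← ENNReal.tsum_add, ← ENNReal.tsum_mul_left]
  refine ENNReal.tsum_le_tsum fun i => ?_
  rw [← ContinuousLinearMap.adjoint_inner_left]
  set x := ContinuousLinearMap.adjoint X (basis H i)
  set y := Y (basis H i)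
  have h1 : 2 * ‖inner ℂ x y‖ ≤ ‖x‖ ^ 2 + ‖y‖ ^ 2 := by
    nlinarith [norm_inner_le_norm (𝕜 := ℂ) x y, sq_nonneg (‖x‖ - ‖y‖)]
  have h2 := ENNReal.ofReal_le_ofReal h1
  rwa [ENNReal.ofReal_mul (by norm_num), ENNReal.ofReal_add (by positivity) (by positivity),
    ENNReal.ofReal_pow (norm_nonneg _), ENNReal.ofReal_pow (norm_nonneg _), ofReal_norm,
    ofReal_norm, ofReal_norm, ENNReal.ofReal_ofNat] at h2

theorem exists_sqrt (T : H →L[ℂ] H) : ∃ S : H →L[ℂ] H,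
    ContinuousLinearMap.adjoint S = S ∧ S ∘L S = CFC.abs T ∧ hsSq S = traceNorm T := by
  have hnn : (0 : H →L[ℂ] H) ≤ CFC.abs T := CFC.abs_nonneg T
  refine ⟨CFC.sqrt (CFC.abs T), ?_, CFC.sqrt_mul_sqrt_self _ hnn, ?_⟩
  · exact (IsSelfAdjoint.of_nonneg (CFC.sqrt_nonneg (CFC.abs T))).star_eq
  · have hs : ContinuousLinearMap.adjoint (CFC.sqrt (CFC.abs T)) = CFC.sqrt (CFC.abs T) :=
      (IsSelfAdjoint.of_nonneg (CFC.sqrt_nonneg (CFC.abs T))).star_eq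
    have hm : CFC.sqrt (CFC.abs T) * CFC.sqrt (CFC.abs T) = CFC.abs T :=
      CFC.sqrt_mul_sqrt_self _ hnn
    refine tsum_congr fun i => ?_
    have h1 : inner ℂ (basis H i) (CFC.abs T (basis H i)) =
        inner ℂ (CFC.sqrt (CFC.abs T) (basis H i)) (CFC.sqrt (CFC.abs T) (basis H i)) := by
      rw [← ContinuousLinearMap.adjoint_inner_right, hs]
      exact congrArg (fun R : H →L[ℂ] H => inner ℂ (basis H i) (R (basis H i))) hm.symm
    have h2 : (inner ℂ (basis H i) (CFC.abs T (basis H i))).re =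
        ‖CFC.sqrt (CFC.abs T) (basis H i)‖ ^ 2 := by
      rw [h1]
      exact inner_self_eq_norm_sq (𝕜 := ℂ) _
    rw [h2, ENNReal.ofReal_pow (norm_nonneg _), ofReal_norm]

theorem norm_abs_apply (T : H →L[ℂ] H) (x : H) : ‖CFC.abs T x‖ = ‖T x‖ := by
  have hs : ContinuousLinearMap.adjoint (CFC.abs T) = CFC.abs T :=
    (IsSelfAdjoint.of_nonneg (CFC.abs_nonneg T)).star_eq
  have hm : CFC.abs T * CFC.abs T = ContinuousLinearMap.adjoint T * T := CFC.abs_mul_abs T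
  have h1 : inner ℂ (CFC.abs T x) (CFC.abs T x) = inner ℂ (T x) (T x) := by
    rw [← ContinuousLinearMap.adjoint_inner_right, hs,
      ← ContinuousLinearMap.adjoint_inner_right (A := T)]
    exact congrArg (fun R : H →L[ℂ] H => inner ℂ x (R x)) hm
  rw [inner_self_eq_norm_sq_to_K, inner_self_eq_norm_sq_to_K] at h1
  have h2 : ‖CFC.abs T x‖ ^ 2 = ‖T x‖ ^ 2 := by exact_mod_cast h1
  exact (sq_eq_sq₀ (norm_nonneg _) (norm_nonneg _)).1 h2

theorem exists_polar (T : H →L[ℂ] H) : ∃ U : H →L[ℂ] H, ‖U‖ ≤ 1 ∧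
    U ∘L CFC.abs T = T ∧ ContinuousLinearMap.adjoint U ∘L T = CFC.abs T := by
  set P := CFC.abs T with hP
  have hPT : ∀ x, ‖P x‖ = ‖T x‖ := norm_abs_apply T
  let N : Submodule ℂ H := (LinearMap.range P.toLinearMap).topologicalClosure
  have : CompleteSpace N :=
    (Submodule.isClosed_topologicalClosure (LinearMap.range P.toLinearMap)).completeSpace_coe
  have hmem : ∀ x, P x ∈ N := fun x =>
    Submodule.le_topologicalClosure _ (LinearMap.mem_range_self P.toLinearMap x)
  let e : H →ₗ[ℂ] N := P.toLinearMap.codRestrict N hmem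
  have hd : DenseRange e := by
    intro y
    rw [mem_closure_iff_seq_limit]
    have hy : (y : H) ∈ closure (LinearMap.range P.toLinearMap : Set H) := y.2
    obtain ⟨u, hu, hlim⟩ := mem_closure_iff_seq_limit.1 hy
    choose v hv using hu
    refine ⟨fun n => e (v n), fun n => ⟨v n, rfl⟩, ?_⟩
    rw [tendsto_subtype_rng]
    refine hlim.congr fun n => (hv n).symm
  have hb : ∀ x, ‖T.toLinearMap x‖ ≤ 1 * ‖e x‖ := fun x => by
    rw [one_mul]
    exact (hPT x).ge
  let u : N →L[ℂ] H := T.toLinearMap.extendOfNorm e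
  have hu : ∀ x, u (e x) = T x := fun x => LinearMap.extendOfNorm_eq hd ⟨1, hb⟩ x
  have hun : ‖u‖ ≤ 1 := LinearMap.opNorm_extendOfNorm_le hd zero_le_one hb
  let U : H →L[ℂ] H := u ∘L N.orthogonalProjectionOnto
  have hU : ‖U‖ ≤ 1 := by
    refine (ContinuousLinearMap.opNorm_comp_le _ _).trans ?_
    exact mul_le_one₀ hun (norm_nonneg _) N.orthogonalProjectionOnto_norm_le
  have hUP : ∀ x, U (P x) = T x := fun x => by
    rw [← hu x]
    exact congrArg u (Submodule.orthogonalProjectionOnto_mem_subspace_eq_self (e x))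
  refine ⟨U, hU, ContinuousLinearMap.ext hUP, ContinuousLinearMap.ext fun x => ?_⟩
  have h1 : ‖ContinuousLinearMap.adjoint U (T x)‖ ≤ ‖T x‖ := by
    refine (ContinuousLinearMap.le_of_opNorm_le _ (c := 1) ?_ _).trans (by simp)
    rwa [LinearIsometryEquiv.norm_map]
  have h2 : inner ℂ (ContinuousLinearMap.adjoint U (T x)) (P x) = inner ℂ (T x) (T x) := by
    rw [ContinuousLinearMap.adjoint_inner_left, hUP]
  have h3 := norm_sub_sq (𝕜 := ℂ) (ContinuousLinearMap.adjoint U (T x)) (P x)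
  rw [h2, inner_self_eq_norm_sq, hPT x] at h3
  have h4 : ‖ContinuousLinearMap.adjoint U (T x) - P x‖ ^ 2 ≤ 0 := by
    nlinarith [norm_nonneg (ContinuousLinearMap.adjoint U (T x)), norm_nonneg (T x)]
  have h5 : ‖ContinuousLinearMap.adjoint U (T x) - P x‖ = 0 :=
    pow_eq_zero_iff (two_ne_zero) |>.1 (le_antisymm h4 (sq_nonneg _))
  exact sub_eq_zero.1 (norm_eq_zero.1 h5)

theorem enorm_inner_le_traceNorm (T W : H →L[ℂ] H) (hW : ‖W‖ ≤ 1) :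
    ∑' i, ‖inner ℂ (basis H i) (W (T (basis H i)))‖ₑ ≤ traceNorm T := by
  obtain ⟨U, hU, hUT, -⟩ := exists_polar T
  obtain ⟨S, hS, hSS, hST⟩ := exists_sqrt T
  have h1 := tsum_inner_comp_le (W ∘L U ∘L S) S
  have h2 : hsSq (W ∘L U ∘L S) ≤ hsSq S :=
    (hsSq_comp_le _ _ hW).trans (hsSq_comp_le _ _ hU)
  have h3 : ∀ x, (W ∘L U ∘L S) (S x) = W (T x) := fun x => by
    conv_rhs => rw [← hUT, ← hSS]
    rfl
  simp only [h3] at h1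
  rw [← hST]
  refine (ENNReal.mul_le_mul_iff_right (a := 2) (by norm_num) (by norm_num)).1 (h1.trans ?_)
  rw [two_mul]
  gcongr

theorem traceNorm_le {T : H →L[ℂ] H} {C : ℝ≥0∞} (h : ∀ W : H →L[ℂ] H, ‖W‖ ≤ 1 →
    ∑' i, ‖inner ℂ (basis H i) (W (T (basis H i)))‖ₑ ≤ C) : traceNorm T ≤ C := by
  obtain ⟨U, hU, -, hUT⟩ := exists_polar T
  refine le_trans ?_ (h (ContinuousLinearMap.adjoint U) (by rwa [LinearIsometryEquiv.norm_map]))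
  refine ENNReal.tsum_le_tsum fun i => ?_
  rw [← ContinuousLinearMap.comp_apply, hUT, ← ofReal_norm]
  exact ENNReal.ofReal_le_ofReal (Complex.re_le_norm _)

theorem traceNorm_zero : traceNorm (0 : H →L[ℂ] H) = 0 := by
  refine le_antisymm (traceNorm_le fun W _ => ?_) zero_le
  simp

theorem traceNorm_add_le (S T : H →L[ℂ] H) : traceNorm (S + T) ≤ traceNorm S + traceNorm T := by
  refine traceNorm_le fun W hW => ?_
  refine le_trans ?_ (add_le_add (enorm_inner_le_traceNorm S W hW)
    (enorm_inner_le_traceNorm T W hW))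
  rw [← ENNReal.tsum_add]
  refine ENNReal.tsum_le_tsum fun i => ?_
  rw [_root_.add_apply, map_add, inner_add_right]
  exact enorm_add_le _ _

theorem traceNorm_comp_le (A T : H →L[ℂ] H) : traceNorm (A ∘L T) ≤ ‖A‖ₑ * traceNorm T := by
  rcases eq_or_ne A 0 with rfl | hA
  · simp [traceNorm_zero]
  have hA' : (‖A‖ : ℂ) ≠ 0 := by simpa using hA
  refine traceNorm_le fun W hW => ?_
  have h1 := enorm_inner_le_traceNorm T (((‖A‖ : ℂ)⁻¹) • (W ∘L A)) (by
    rw [norm_smul, norm_inv, Complex.norm_real, norm_norm]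
    have h2 : ‖W ∘L A‖ ≤ ‖A‖ :=
      (ContinuousLinearMap.opNorm_comp_le _ _).trans
        (mul_le_of_le_one_left (norm_nonneg _) hW)
    rw [inv_mul_le_iff₀ (norm_pos_iff.2 hA)]
    simpa using h2)
  refine le_trans ?_ (mul_le_mul_right h1 ‖A‖ₑ)
  rw [← ENNReal.tsum_mul_left]
  refine ENNReal.tsum_le_tsum fun i => le_of_eq ?_
  have h3 : ‖A‖ₑ = ‖(‖A‖ : ℂ)‖ₑ := by
    rw [← ofReal_norm, ← ofReal_norm, Complex.norm_real, norm_norm]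
  rw [h3, ← enorm_mul, ← inner_smul_right, _root_.smul_apply, smul_smul,
    mul_inv_cancel₀ hA', one_smul]
  rfl

theorem traceNorm_smul (c : ℂ) (T : H →L[ℂ] H) : traceNorm (c • T) = ‖c‖ₑ * traceNorm T := by
  have key : ∀ (c : ℂ) (T : H →L[ℂ] H), traceNorm (c • T) ≤ ‖c‖ₑ * traceNorm T := by
    intro c T
    refine traceNorm_le fun W hW => ?_
    refine le_trans (le_of_eq ?_) (mul_le_mul_right (enorm_inner_le_traceNorm T W hW) ‖c‖ₑ)
    rw [← ENNReal.tsum_mul_left]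
    refine tsum_congr fun i => ?_
    rw [_root_.smul_apply, map_smul, inner_smul_right, enorm_mul]
  refine le_antisymm (key c T) ?_
  rcases eq_or_ne c 0 with rfl | hc
  · simp
  calc ‖c‖ₑ * traceNorm T = ‖c‖ₑ * traceNorm (c⁻¹ • c • T) := by
        rw [inv_smul_smul₀ hc]
    _ ≤ ‖c‖ₑ * (‖c⁻¹‖ₑ * traceNorm (c • T)) := by gcongr; exact key _ _
    _ = traceNorm (c • T) := by
        rw [← mul_assoc, ← enorm_mul, mul_inv_cancel₀ hc]; simp

theorem enorm_le_traceNorm (T : H →L[ℂ] H) : ‖T‖ₑ ≤ traceNorm T := by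
  rcases eq_or_ne (traceNorm T) ⊤ with h | h
  · simp [h]
  obtain ⟨U, hU, hUT, -⟩ := exists_polar T
  obtain ⟨S, hS, hSS, hST⟩ := exists_sqrt T
  have h1 : ∀ x, ‖S x‖ₑ ^ 2 ≤ ‖x‖ₑ ^ 2 * traceNorm T := fun x => by
    rw [← tsum_enorm_inner_sq (basis H) (S x), ← hST, hsSq, ← ENNReal.tsum_mul_left]
    refine ENNReal.tsum_le_tsum fun i => ?_
    nth_rewrite 1 [← hS]
    rw [ContinuousLinearMap.adjoint_inner_right, ← mul_pow, mul_comm]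
    gcongr
    rw [← ofReal_norm, ← ofReal_norm, ← ofReal_norm, ← ENNReal.ofReal_mul (norm_nonneg _)]
    exact ENNReal.ofReal_le_ofReal (norm_inner_le_norm _ _)
  set t := (traceNorm T).toReal with ht
  have htT : traceNorm T = ENNReal.ofReal t := (ENNReal.ofReal_toReal h).symm
  have h2 : ∀ x, ‖S x‖ ^ 2 ≤ ‖x‖ ^ 2 * t := fun x => by
    have := h1 x
    rw [htT, ← ofReal_norm, ← ofReal_norm, ← ENNReal.ofReal_pow (norm_nonneg _),
      ← ENNReal.ofReal_pow (norm_nonneg _), ← ENNReal.ofReal_mul (by positivity)] at this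
    exact (ENNReal.ofReal_le_ofReal_iff (by positivity)).1 this
  rw [htT, ← ofReal_norm]
  refine ENNReal.ofReal_le_ofReal (ContinuousLinearMap.opNorm_le_bound _ (by positivity)
    fun x => ?_)
  have h3 : ‖T x‖ ≤ ‖S (S x)‖ := by
    have h4 : T x = U (S (S x)) := by
      conv_lhs => rw [← hUT, ← hSS]
      rfl
    rw [h4]
    exact (U.le_of_opNorm_le hU _).trans (by simp)
  have h5 : ‖S (S x)‖ ^ 2 ≤ (t * ‖x‖) ^ 2 := by
    have ht0 : 0 ≤ t := ENNReal.toReal_nonneg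
    calc ‖S (S x)‖ ^ 2 ≤ ‖S x‖ ^ 2 * t := h2 _
      _ ≤ (‖x‖ ^ 2 * t) * t := by gcongr; exact h2 x
      _ = _ := by ring
  exact h3.trans ((sq_le_sq₀ (norm_nonneg _) (by positivity)).1 h5)

theorem traceNorm_le_of_tendsto {u : ℕ → H →L[ℂ] H} {T : H →L[ℂ] H} {C : ℝ≥0∞}
    (hu : Filter.Tendsto u Filter.atTop (𝓝 T)) (hC : ∀ᶠ n in Filter.atTop, traceNorm (u n) ≤ C) :
    traceNorm T ≤ C := by
  refine traceNorm_le fun W hW => ?_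
  rw [ENNReal.tsum_eq_iSup_sum]
  refine iSup_le fun s => ?_
  refine le_of_tendsto (f := fun n => ∑ i ∈ s, ‖inner ℂ (basis H i) (W (u n (basis H i)))‖ₑ)
    ?_ (hC.mono fun n hn => ?_)
  · refine tendsto_finsetSum _ fun i _ => ?_
    have hc : Continuous fun R : H →L[ℂ] H => ‖inner ℂ (basis H i) (W (R (basis H i)))‖ₑ := by
      fun_prop
    exact (hc.tendsto T).comp hu
  · exact (ENNReal.sum_le_tsum s).trans ((enorm_inner_le_traceNorm (u n) W hW).trans hn)

theorem traceNorm_comp_le_hsSq (X Y : H →L[ℂ] H) : traceNorm (X ∘L Y) ≤ hsSq X + hsSq Y := by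
  refine traceNorm_le fun W hW => ?_
  have h1 := tsum_inner_comp_le (W ∘L X) Y
  have h2 := hsSq_comp_le W X hW
  refine le_trans ?_ (h1.trans (add_le_add h2 le_rfl))
  exact le_mul_of_one_le_left zero_le (by norm_num)

variable (H) in
/-- The subspace of trace-class operators, that is, of the operators `T` with `Tr |T| < ∞`. -/
def traceClassSubmodule : Submodule ℂ (H →L[ℂ] H) where
  carrier := {T | traceNorm T ≠ ⊤}
  zero_mem' := by simp [traceNorm_zero]
  add_mem' {S T} hS hT :=
    ne_top_of_le_ne_top (ENNReal.add_ne_top.2 ⟨hS, hT⟩) (traceNorm_add_le S T)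
  smul_mem' c T hT := by
    change traceNorm (c • T) ≠ ⊤
    rw [traceNorm_smul]
    exact ENNReal.mul_ne_top enorm_ne_top hT

variable (H) in
/-- The space of trace-class operators on `H`. It is a copy of the subspace of `H →L[ℂ] H`,
so that it can carry the trace norm instead of the operator norm. -/
def TraceClass : Type _ := traceClassSubmodule H

namespace TraceClass

noncomputable instance : AddCommGroup (TraceClass H) :=
  inferInstanceAs (AddCommGroup (traceClassSubmodule H))

noncomputable instance : Module ℂ (TraceClass H) :=
  inferInstanceAs (Module ℂ (traceClassSubmodule H))

/-- The operator underlying an element of the trace class. -/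
def op (T : TraceClass H) : H →L[ℂ] H := T.1

theorem traceNorm_op_ne_top (T : TraceClass H) : traceNorm T.op ≠ ⊤ := T.2

/-- The element of the trace class given by an operator of finite trace norm. -/
def mk (T : H →L[ℂ] H) (hT : traceNorm T ≠ ⊤) : TraceClass H := ⟨T, hT⟩

@[simp] theorem op_mk (T : H →L[ℂ] H) (hT : traceNorm T ≠ ⊤) : (mk T hT).op = T := rfl

@[ext] theorem ext {S T : TraceClass H} (h : S.op = T.op) : S = T := Subtype.ext h

@[simp] theorem op_zero : (0 : TraceClass H).op = 0 := rfl
@[simp] theorem op_add (S T : TraceClass H) : (S + T).op = S.op + T.op := rfl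
@[simp] theorem op_neg (T : TraceClass H) : (-T).op = -T.op := rfl
@[simp] theorem op_sub (S T : TraceClass H) : (S - T).op = S.op - T.op := rfl
@[simp] theorem op_smul (c : ℂ) (T : TraceClass H) : (c • T).op = c • T.op := rfl

/-- The trace norm on the trace class. -/
noncomputable instance : NormedAddCommGroup (TraceClass H) :=
  AddGroupNorm.toNormedAddCommGroup
    { toFun := fun T => (traceNorm T.op).toReal
      map_zero' := by simp [traceNorm_zero]
      add_le' := fun S T => by
        rw [← ENNReal.toReal_add S.traceNorm_op_ne_top T.traceNorm_op_ne_top]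
        exact ENNReal.toReal_mono
          (ENNReal.add_ne_top.2 ⟨S.traceNorm_op_ne_top, T.traceNorm_op_ne_top⟩)
          (traceNorm_add_le _ _)
      neg' := fun T => by
        rw [op_neg, ← neg_one_smul ℂ T.op, traceNorm_smul]
        simp
      eq_zero_of_map_eq_zero' := fun T hT => by
        have h1 : traceNorm T.op = 0 :=
          ((ENNReal.toReal_eq_zero_iff _).1 hT).resolve_right T.traceNorm_op_ne_top
        have h2 := enorm_le_traceNorm T.op
        rw [h1] at h2
        exact TraceClass.ext (enorm_eq_zero.1 (le_antisymm h2 zero_le)) }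

theorem norm_def (T : TraceClass H) : ‖T‖ = (traceNorm T.op).toReal := rfl

theorem ofReal_norm_eq (T : TraceClass H) : ENNReal.ofReal ‖T‖ = traceNorm T.op :=
  ENNReal.ofReal_toReal T.traceNorm_op_ne_top

noncomputable instance : NormedSpace ℂ (TraceClass H) where
  norm_smul_le c T := by
    rw [norm_def, norm_def, op_smul, traceNorm_smul, ENNReal.toReal_mul]
    simp

theorem norm_op_le (T : TraceClass H) : ‖T.op‖ ≤ ‖T‖ := by
  have h := enorm_le_traceNorm T.op
  rw [← ofReal_norm_eq, ← ofReal_norm] at h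
  exact (ENNReal.ofReal_le_ofReal_iff (norm_nonneg _)).1 h

instance : CompleteSpace (TraceClass H) := by
  refine Metric.complete_of_cauchySeq_tendsto fun u hu => ?_
  have hop : CauchySeq fun n => (u n).op := by
    rw [Metric.cauchySeq_iff] at hu ⊢
    intro ε hε
    obtain ⟨N, hN⟩ := hu ε hε
    refine ⟨N, fun m hm n hn => lt_of_le_of_lt ?_ (hN m hm n hn)⟩
    rw [dist_eq_norm, dist_eq_norm, ← op_sub]
    exact norm_op_le _
  obtain ⟨T, hT⟩ := cauchySeq_tendsto_of_complete hop
  have key : ∀ ε > 0, ∃ N, ∀ m ≥ N, traceNorm ((u m).op - T) ≤ ENNReal.ofReal ε := by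
    intro ε hε
    obtain ⟨N, hN⟩ := Metric.cauchySeq_iff.1 hu ε hε
    refine ⟨N, fun m hm => ?_⟩
    refine traceNorm_le_of_tendsto (u := fun n => (u m).op - (u n).op)
      (tendsto_const_nhds.sub hT) ?_
    filter_upwards [Filter.eventually_ge_atTop N] with n hn
    rw [← op_sub, ← ofReal_norm_eq, ← dist_eq_norm]
    exact ENNReal.ofReal_le_ofReal (hN m hm n hn).le
  have hTm : traceNorm T ≠ ⊤ := by
    obtain ⟨N, hN⟩ := key 1 one_pos
    have h1 : (u N).op - T ∈ traceClassSubmodule H :=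
      ne_top_of_le_ne_top ENNReal.ofReal_ne_top (hN N le_rfl)
    have h2 : (u N).op ∈ traceClassSubmodule H := (u N).traceNorm_op_ne_top
    have h3 := Submodule.sub_mem _ h2 h1
    rwa [sub_sub_cancel] at h3
  refine ⟨mk T hTm, Metric.tendsto_atTop.2 fun ε hε => ?_⟩
  obtain ⟨N, hN⟩ := key (ε / 2) (half_pos hε)
  refine ⟨N, fun n hn => ?_⟩
  have h1 := hN n hn
  have h2 : (u n).op - T = (u n - mk T hTm).op := rfl
  rw [h2, ← ofReal_norm_eq, ← dist_eq_norm] at h1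
  exact ((ENNReal.ofReal_le_ofReal_iff (half_pos hε).le).1 h1).trans_lt (half_lt_self hε)

theorem tsum_enorm_inner_le (T : TraceClass H) :
    ∑' i, ‖inner ℂ (basis H i) (T.op (basis H i))‖ₑ ≤ traceNorm T.op :=
  enorm_inner_le_traceNorm T.op (.id ℂ H) ContinuousLinearMap.norm_id_le

theorem summable_norm_inner (T : TraceClass H) :
    Summable fun i => ‖inner ℂ (basis H i) (T.op (basis H i))‖ := by
  have h := ne_top_of_le_ne_top T.traceNorm_op_ne_top T.tsum_enorm_inner_le
  have h2 := ENNReal.summable_toReal h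
  simpa using h2

theorem summable_inner (T : TraceClass H) :
    Summable fun i => inner ℂ (basis H i) (T.op (basis H i)) :=
  T.summable_norm_inner.of_norm

theorem norm_tsum_inner_le (T : TraceClass H) :
    ‖∑' i, inner ℂ (basis H i) (T.op (basis H i))‖ ≤ ‖T‖ := by
  refine (norm_tsum_le_tsum_norm T.summable_norm_inner).trans ?_
  have h := T.tsum_enorm_inner_le
  rw [← ofReal_norm_eq] at h
  simp only [← ofReal_norm] at h
  rw [← ENNReal.ofReal_tsum_of_nonneg (fun _ => norm_nonneg _) T.summable_norm_inner] at h
  exact (ENNReal.ofReal_le_ofReal_iff (norm_nonneg _)).1 h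

/-- The trace, `Tr T = ∑ i, ⟨e i, T (e i)⟩`, as a bounded linear functional on the trace class. -/
noncomputable def trace : TraceClass H →L[ℂ] ℂ :=
  LinearMap.mkContinuous
    { toFun := fun T => ∑' i, inner ℂ (basis H i) (T.op (basis H i))
      map_add' := fun S T => by
        rw [← S.summable_inner.tsum_add T.summable_inner]
        exact tsum_congr fun i => by simp
      map_smul' := fun c T => by
        rw [RingHom.id_apply, smul_eq_mul, ← tsum_mul_left]
        exact tsum_congr fun i => by simp }
    1 (fun T => by rw [one_mul]; exact T.norm_tsum_inner_le)

theorem trace_apply (T : TraceClass H) :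
    trace T = ∑' i, inner ℂ (basis H i) (T.op (basis H i)) := rfl

theorem trace_re_nonneg (T : TraceClass H) (hT : T.op.IsPositive) : 0 ≤ (trace T).re := by
  rw [trace_apply, Complex.re_tsum T.summable_inner]
  exact tsum_nonneg fun i => hT.re_inner_nonneg_right _

/-- The product `A T` of a bounded operator `A` and a trace-class operator `T`. -/
noncomputable def mulLeft (A : H →L[ℂ] H) (T : TraceClass H) : TraceClass H :=
  mk (A ∘L T.op) (ne_top_of_le_ne_top (ENNReal.mul_ne_top enorm_ne_top T.traceNorm_op_ne_top)
    (traceNorm_comp_le A T.op))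

@[simp] theorem op_mulLeft (A : H →L[ℂ] H) (T : TraceClass H) : (mulLeft A T).op = A ∘L T.op := rfl

end TraceClass
end TraceClass

section Tensor

variable {H K : Type*} [NormedAddCommGroup H] [InnerProductSpace ℂ H]
  [NormedAddCommGroup K] [InnerProductSpace ℂ K]

variable (H K) in
/-- The Hilbert space tensor product of `H` and `K`. -/
abbrev HTensor : Type _ := UniformSpace.Completion (H ⊗[ℂ] K)

/-- The product vector `x ⊗ y` in the Hilbert space tensor product. -/
noncomputable def vtmul (x : H) (y : K) : HTensor H K := ((x ⊗ₜ[ℂ] y : H ⊗[ℂ] K) : HTensor H K)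

/-- The tensor product `A ⊗ B` of bounded operators, acting on the Hilbert space tensor product. -/
noncomputable def opTensor (A : H →L[ℂ] H) (B : K →L[ℂ] K) : HTensor H K →L[ℂ] HTensor H K :=
  (TensorProduct.mapL A B).completion

@[simp] theorem opTensor_vtmul (A : H →L[ℂ] H) (B : K →L[ℂ] K) (x : H) (y : K) :
    opTensor A B (vtmul x y) = vtmul (A x) (B y) := by
  rw [opTensor, vtmul, ContinuousLinearMap.completion_apply_coe]
  rfl

theorem inner_vtmul (x x' : H) (y y' : K) :
    inner ℂ (vtmul x y) (vtmul x' y') = inner ℂ x x' * inner ℂ y y' := by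
  rw [vtmul, vtmul, UniformSpace.Completion.inner_coe, TensorProduct.inner_tmul]

theorem enorm_vtmul (x : H) (y : K) : ‖vtmul x y‖ₑ = ‖x‖ₑ * ‖y‖ₑ := by
  rw [vtmul, UniformSpace.Completion.enorm_coe, TensorProduct.enorm_tmul]

theorem opTensor_comp (A A' : H →L[ℂ] H) (B B' : K →L[ℂ] K) :
    opTensor (A ∘L A') (B ∘L B') = opTensor A B ∘L opTensor A' B' := by
  ext z
  induction z using UniformSpace.Completion.induction_on with
  | hp => exact isClosed_eq (by fun_prop) (by fun_prop)
  | ih z =>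
    simp only [opTensor, ContinuousLinearMap.completion_apply_coe,
      ContinuousLinearMap.comp_apply]
    congr 1
    induction z using TensorProduct.induction_on with
    | zero => simp
    | tmul x y => rfl
    | add x y hx hy => simp only [map_add, hx, hy]

theorem top_le_closure_span_vtmul {ι κ : Type*} {v : ι → H} {w : κ → K}
    (hv : Dense (Submodule.span ℂ (Set.range v) : Set H))
    (hw : Dense (Submodule.span ℂ (Set.range w) : Set K)) :
    ⊤ ≤ (Submodule.span ℂ (Set.range fun p : ι × κ => vtmul (v p.1) (w p.2))).topologicalClosure := by
  set N := (Submodule.span ℂ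
    (Set.range fun p : ι × κ => vtmul (v p.1) (w p.2))).topologicalClosure with hN
  have hNc : IsClosed (N : Set (HTensor H K)) := Submodule.isClosed_topologicalClosure _
  let f : H →ₗ[ℂ] K →ₗ[ℂ] HTensor H K :=
    (TensorProduct.mk ℂ H K).compr₂ (UniformSpace.Completion.toComplL (𝕜 := ℂ)).toLinearMap
  have hf : ∀ x y, f x y = vtmul x y := fun _ _ => rfl
  have hc2 : ∀ x : H, Continuous fun y : K => vtmul x y := fun x =>
    (UniformSpace.Completion.continuous_coe _).comp (TensorProduct.mkL ℂ H K x).continuous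
  have hc1 : ∀ y : K, Continuous fun x : H => vtmul x y := fun y =>
    (UniformSpace.Completion.continuous_coe _).comp
      ((TensorProduct.mkL ℂ H K).flip y).continuous
  have h1 : ∀ i (y : K), vtmul (v i) y ∈ N := by
    intro i y
    have hcl : IsClosed {y : K | vtmul (v i) y ∈ N} := hNc.preimage (hc2 (v i))
    have hle : Submodule.span ℂ (Set.range w) ≤ N.comap (f (v i)) := by
      rw [Submodule.span_le]
      rintro _ ⟨j, rfl⟩
      exact Submodule.le_topologicalClosure _ (Submodule.subset_span ⟨(i, j), rfl⟩)
    exact hcl.closure_subset_iff.2 (fun z hz => hle hz) (hw y)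
  have h2 : ∀ (x : H) (y : K), vtmul x y ∈ N := by
    intro x y
    have hcl : IsClosed {x : H | vtmul x y ∈ N} := hNc.preimage (hc1 y)
    have hle : Submodule.span ℂ (Set.range v) ≤ N.comap (f.flip y) := by
      rw [Submodule.span_le]
      rintro _ ⟨i, rfl⟩
      exact h1 i y
    exact hcl.closure_subset_iff.2 (fun z hz => hle hz) (hv x)
  rintro z -
  induction z using UniformSpace.Completion.induction_on with
  | hp => exact hNc
  | ih z =>
    induction z using TensorProduct.induction_on with
    | zero => rw [UniformSpace.Completion.coe_zero]; exact N.zero_mem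
    | tmul x y => exact h2 x y
    | add x y hx hy => rw [UniformSpace.Completion.coe_add]; exact N.add_mem hx hy

theorem orthonormal_vtmul {ι κ : Type*} (b : HilbertBasis ι ℂ H) (c : HilbertBasis κ ℂ K) :
    Orthonormal ℂ fun p : ι × κ => vtmul (b p.1) (c p.2) := by
  classical
  rw [orthonormal_iff_ite]
  rintro ⟨i, j⟩ ⟨i', j'⟩
  rw [inner_vtmul, orthonormal_iff_ite.1 b.orthonormal, orthonormal_iff_ite.1 c.orthonormal]
  by_cases h : i = i' <;> by_cases h' : j = j' <;> simp [h, h']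

variable [CompleteSpace H] [CompleteSpace K]

/-- The product basis of the Hilbert space tensor product. -/
noncomputable def tensorBasis {ι κ : Type*} (b : HilbertBasis ι ℂ H) (c : HilbertBasis κ ℂ K) :
    HilbertBasis (ι × κ) ℂ (HTensor H K) :=
  HilbertBasis.mk (orthonormal_vtmul b c) (top_le_closure_span_vtmul
    (Submodule.dense_iff_topologicalClosure_eq_top.2 b.dense_span)
    (Submodule.dense_iff_topologicalClosure_eq_top.2 c.dense_span))

theorem hsSq_opTensor (A : H →L[ℂ] H) (B : K →L[ℂ] K) :
    hsSq (opTensor A B) = hsSq A * hsSq B := by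
  rw [hsSq_eq (tensorBasis (basis H) (basis K)), ENNReal.tsum_prod', hsSq, hsSq,
    ← ENNReal.tsum_mul_right]
  refine tsum_congr fun i => ?_
  rw [← ENNReal.tsum_mul_left]
  refine tsum_congr fun j => ?_
  rw [tensorBasis, HilbertBasis.coe_mk, opTensor_vtmul, enorm_vtmul, mul_pow]

theorem traceNorm_opTensor_ne_top (A : TraceClass H) (B : TraceClass K) :
    traceNorm (opTensor A.op B.op) ≠ ⊤ := by
  obtain ⟨U, hU, hUA, -⟩ := exists_polar A.op
  obtain ⟨S, -, hSS, hSA⟩ := exists_sqrt A.op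
  obtain ⟨W, hW, hWB, -⟩ := exists_polar B.op
  obtain ⟨R, -, hRR, hRB⟩ := exists_sqrt B.op
  have hA : A.op = (U ∘L S) ∘L S := by rw [ContinuousLinearMap.comp_assoc, hSS, hUA]
  have hB : B.op = (W ∘L R) ∘L R := by rw [ContinuousLinearMap.comp_assoc, hRR, hWB]
  rw [hA, hB, opTensor_comp]
  refine ne_top_of_le_ne_top ?_ (traceNorm_comp_le_hsSq _ _)
  rw [hsSq_opTensor, hsSq_opTensor]
  have h1 : hsSq S ≠ ⊤ := hSA ▸ A.traceNorm_op_ne_top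
  have h2 : hsSq R ≠ ⊤ := hRB ▸ B.traceNorm_op_ne_top
  exact ENNReal.add_ne_top.2 ⟨ENNReal.mul_ne_top (ne_top_of_le_ne_top h1 (hsSq_comp_le U S hU))
    (ne_top_of_le_ne_top h2 (hsSq_comp_le W R hW)), ENNReal.mul_ne_top h1 h2⟩

/-- The tensor product `A ⊗ B` of trace-class operators. -/
noncomputable def TraceClass.tmul (A : TraceClass H) (B : TraceClass K) :
    TraceClass (HTensor H K) :=
  TraceClass.mk (opTensor A.op B.op) (traceNorm_opTensor_ne_top A B)

@[simp] theorem TraceClass.op_tmul (A : TraceClass H) (B : TraceClass K) :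
    (A.tmul B).op = opTensor A.op B.op := rfl

end Tensor

universe u v

section Operations

variable {H : Type u} [NormedAddCommGroup H] [InnerProductSpace ℂ H] [CompleteSpace H]

variable (H) in
/-- A quantum state (density operator): a positive trace-class operator of unit trace. -/
structure State where
  toTraceClass : TraceClass H
  isPositive : toTraceClass.op.IsPositive
  trace_eq_one : toTraceClass.trace = 1

/-- A state is pure if it is the projector `|φ⟩⟨φ|` on a unit vector `φ`. -/
def State.IsPure (ρ : State H) : Prop :=
  ∃ φ : H, ‖φ‖ = 1 ∧ ρ.toTraceClass.op = InnerProductSpace.rankOne ℂ φ φ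

/-- Positivity of the operator on the direct sum `H ⊕ ... ⊕ H` (`n` summands) with the given
matrix of blocks. -/
def IsPositiveBlock {n : ℕ} (T : Fin n → Fin n → TraceClass H) : Prop :=
  ∀ v : Fin n → H, 0 ≤ ∑ i, ∑ j, inner ℂ (v i) ((T i j).op (v j))

/-- Complete positivity of a linear map on the trace class. -/
def IsCompletelyPositive (Φ : TraceClass H →L[ℂ] TraceClass H) : Prop :=
  ∀ (n : ℕ) (T : Fin n → Fin n → TraceClass H),
    IsPositiveBlock T → IsPositiveBlock fun i j => Φ (T i j)

/-- A quantum operation: a completely positive trace-non-increasing linear map on the trace class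
(such a map is automatically bounded). -/
structure IsQuantumOperation (Φ : TraceClass H →L[ℂ] TraceClass H) : Prop where
  completelyPositive : IsCompletelyPositive Φ
  trace_le : ∀ T : TraceClass H, T.op.IsPositive → (Φ T).trace.re ≤ T.trace.re

/-- `Ψ` is the map `Φ ⊗ Id_K`: the bounded linear map on the trace class of `H ⊗ K` that sends
`A ⊗ B` to `Φ(A) ⊗ B`. It is unique, since the products `A ⊗ B` span a dense subspace. -/
def IsTensorId {K : Type*} [NormedAddCommGroup K] [InnerProductSpace ℂ K] [CompleteSpace K]
    (Φ : TraceClass H →L[ℂ] TraceClass H)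
    (Ψ : TraceClass (HTensor H K) →L[ℂ] TraceClass (HTensor H K)) : Prop :=
  ∀ (A : TraceClass H) (B : TraceClass K), Ψ (A.tmul B) = (Φ A).tmul B

variable (H) in
/-- The separable (unentangled) operators: the closed convex hull, in the trace norm, of the
products `A ⊗ B` of positive trace-class operators. -/
def separableOperators (K : Type*) [NormedAddCommGroup K] [InnerProductSpace ℂ K]
    [CompleteSpace K] : Set (TraceClass (HTensor H K)) :=
  closure (convexHull ℝ {τ | ∃ (A : TraceClass H) (B : TraceClass K),
    A.op.IsPositive ∧ B.op.IsPositive ∧ τ = A.tmul B})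

/-- A quantum operation `Φ` is entanglement-breaking if `Φ ⊗ Id_K` maps every state on `H ⊗ K`
to a separable operator, for every separable Hilbert space `K`. (Every separable Hilbert space is
unitarily equivalent to one in `Type`.) -/
def IsEntanglementBreaking (Φ : TraceClass H →L[ℂ] TraceClass H) : Prop :=
  IsQuantumOperation Φ ∧
  ∀ (K : Type) [NormedAddCommGroup K] [InnerProductSpace ℂ K] [CompleteSpace K]
    [TopologicalSpace.SeparableSpace K],
    ∃ Ψ : TraceClass (HTensor H K) →L[ℂ] TraceClass (HTensor H K), IsTensorId Φ Ψ ∧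
      ∀ ω : State (HTensor H K), Ψ ω.toTraceClass ∈ separableOperators H K

/-- `Ψ : B(H) → B(H)` is the dual map `Φ*` of a map `Φ` on the trace class:
`Tr Ψ(A) T = Tr A Φ(T)`. -/
def IsDualMap (Φ : TraceClass H →L[ℂ] TraceClass H) (Ψ : (H →L[ℂ] H) → (H →L[ℂ] H)) : Prop :=
  ∀ (A : H →L[ℂ] H) (T : TraceClass H),
    (TraceClass.mulLeft (Ψ A) T).trace = (TraceClass.mulLeft A (Φ T)).trace

end Operations

section SpectralMeasure

/-- A spectral (projection-valued) measure on the measurable space `X` in the Hilbert space `K`.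
Only its values at measurable sets are meaningful. -/
structure SpectralMeasure (X : Type*) [MeasurableSpace X] (K : Type*) [NormedAddCommGroup K]
    [InnerProductSpace ℂ K] [CompleteSpace K] where
  toFun : Set X → K →L[ℂ] K
  isStarProjection : ∀ F, MeasurableSet F → IsStarProjection (toFun F)
  hasSum_iUnion : ∀ F : ℕ → Set X, (∀ n, MeasurableSet (F n)) → Pairwise (Function.onFun Disjoint F) →
    ∀ x, HasSum (fun n => toFun (F n) x) (toFun (⋃ n, F n) x)
  univ_eq_one : toFun Set.univ = 1

/-- A spectral measure has multiplicity one if it has a cyclic vector `ξ`: the vectors `P(F) ξ`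
span a dense subspace. -/
def SpectralMeasure.HasMultiplicityOne {X : Type*} [MeasurableSpace X] {K : Type*}
    [NormedAddCommGroup K] [InnerProductSpace ℂ K] [CompleteSpace K]
    (P : SpectralMeasure X K) : Prop :=
  ∃ ξ : K, Dense (Submodule.span ℂ {y | ∃ F, MeasurableSet F ∧ y = P.toFun F ξ} : Set K)

end SpectralMeasure

section Instrument

variable {X : Type v} [MeasurableSpace X]
variable {H : Type u} [NormedAddCommGroup H] [InnerProductSpace ℂ H] [CompleteSpace H]

variable (X H) in
/-- An instrument in the Hilbert space `H` with the outcome space `X`: a `σ`-additive (in the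
strong sense) measure on `X` whose values are quantum operations, such that the value at `X` is a
channel, that is, preserves the trace. Only the values at measurable sets are meaningful. -/
structure Instrument where
  toFun : Set X → TraceClass H →L[ℂ] TraceClass H
  isQuantumOperation : ∀ F, MeasurableSet F → IsQuantumOperation (toFun F)
  hasSum_iUnion : ∀ F : ℕ → Set X, (∀ n, MeasurableSet (F n)) → Pairwise (Function.onFun Disjoint F) →
    ∀ T, HasSum (fun n => toFun (F n) T) (toFun (⋃ n, F n) T)
  trace_univ : ∀ T, (toFun Set.univ T).trace = T.trace

namespace Instrument

theorem apply_empty (M : Instrument X H) (T : TraceClass H) : M.toFun ∅ T = 0 := by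
  have h := M.hasSum_iUnion (fun _ => ∅) (fun _ => MeasurableSet.empty)
    (fun _ _ _ => Set.disjoint_empty _) T
  exact tendsto_nhds_unique tendsto_const_nhds h.summable.tendsto_atTop_zero

theorem isPositive_apply (M : Instrument X H) {F : Set X} (hF : MeasurableSet F)
    {T : TraceClass H} (hT : T.op.IsPositive) : (M.toFun F T).op.IsPositive := by
  have h := (M.isQuantumOperation F hF).completelyPositive 1 (fun _ _ => T) (fun v => by
    simpa using hT.inner_nonneg_right (v 0))
  rw [ContinuousLinearMap.isPositive_iff_complex]
  intro x
  have h1 : 0 ≤ inner ℂ x ((M.toFun F T).op x) := by simpa using h fun _ => x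
  have h2 : inner ℂ ((M.toFun F T).op x) x = inner ℂ x ((M.toFun F T).op x) := by
    rw [← inner_conj_symm, Complex.conj_eq_iff_im]
    exact (Complex.nonneg_iff.1 h1).2.symm
  rw [h2]
  refine ⟨Complex.ext (by simp) ?_, (Complex.nonneg_iff.1 h1).1⟩
  simpa using (Complex.nonneg_iff.1 h1).2

/-- The probability distribution `μ_ρ(F) = Tr M(F)[ρ]` of the outcome in the state `ρ`. -/
noncomputable def outcomeMeasure (M : Instrument X H) (ρ : State H) : Measure X :=
  Measure.ofMeasurable (fun F _ => ENNReal.ofReal (M.toFun F ρ.toTraceClass).trace.re)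
    (by simp [apply_empty])
    (fun F hF hd => by
      have h1 := (M.hasSum_iUnion F hF hd ρ.toTraceClass).mapL TraceClass.trace
      have h2 := Complex.hasSum_re h1
      rw [← h2.tsum_eq, ENNReal.ofReal_tsum_of_nonneg (fun n =>
        TraceClass.trace_re_nonneg _ (M.isPositive_apply (hF n) ρ.isPositive)) h2.summable])

theorem outcomeMeasure_apply (M : Instrument X H) (ρ : State H) {F : Set X}
    (hF : MeasurableSet F) :
    M.outcomeMeasure ρ F = ENNReal.ofReal (M.toFun F ρ.toTraceClass).trace.re :=
  Measure.ofMeasurable_apply F hF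

/-- `σ` is a family of posteriori states of the instrument `M` for the a priori state `ρ`: the
functions `x ↦ Tr A σ(x)` are measurable, and `∫_F σ(x) μ_ρ(dx) = M(F)[ρ]` as a Bochner integral
in the trace class. Such a family exists and is unique up to `μ_ρ`-null sets when `H` is
separable. -/
structure IsPosteriorFamily (M : Instrument X H) (ρ : State H) (σ : X → State H) : Prop where
  measurable_trace : ∀ A : H →L[ℂ] H,
    Measurable fun x => (TraceClass.mulLeft A (σ x).toTraceClass).trace
  integrable : Integrable (fun x => (σ x).toTraceClass) (M.outcomeMeasure ρ)
  setIntegral_eq : ∀ F, MeasurableSet F →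
    ∫ x in F, (σ x).toTraceClass ∂(M.outcomeMeasure ρ) = M.toFun F ρ.toTraceClass

/-- An instrument is irreducible if for every pure a priori state `ρ` the posteriori states are
pure for `μ_ρ`-almost all outcomes. -/
def IsIrreducible (M : Instrument X H) : Prop :=
  ∀ ρ : State H, ρ.IsPure → ∃ σ : X → State H, M.IsPosteriorFamily ρ σ ∧
    ∀ᵐ x ∂(M.outcomeMeasure ρ), (σ x).IsPure

/-- An instrument is efficient if `M(F)*[A] = V* (A ⊗ P(F)) V` for an isometry `V : H → H ⊗ K` and
a spectral measure `P` of multiplicity one in `K`. (A Hilbert space with a spectral measure of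
multiplicity one is unitarily equivalent to some `L²(X, μ)`, so that `K` can be taken in the
universe of `X`.) -/
def IsEfficient (M : Instrument X H) : Prop :=
  ∃ (K : Type v) (_ : NormedAddCommGroup K) (_ : InnerProductSpace ℂ K) (_ : CompleteSpace K)
    (V : H →ₗᵢ[ℂ] HTensor H K) (P : SpectralMeasure X K), P.HasMultiplicityOne ∧
    ∀ F, MeasurableSet F → IsDualMap (M.toFun F) fun A =>
      ContinuousLinearMap.adjoint V.toContinuousLinearMap ∘L opTensor A (P.toFun F) ∘L
        V.toContinuousLinearMap

end Instrument
end Instrument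
end QuantumInstrument

namespace QuantumInstrument

open MeasureTheory Topology
open scoped ENNReal InnerProductSpace ComplexOrder TensorProduct

universe u v

/-! Efficient implies irreducible. A spectral measure with cyclic vector `ξ` is multiplication by
indicators on `L²(ν)`, `ν(F) = ‖P(F)ξ‖²`, so `H ⊗ K` embeds isometrically in `L²(ν; H)`. There `Vφ`
becomes a function `f` with `M(F)[|φ⟩⟨φ|] = ∫_F |f(x)⟩⟨f(x)| dν`. The posteriori states are
therefore the normalized values of `f`, which are pure (`exists_isometry_of_dense`,
`exists_pure_posteriorFamily`).

Irreducible implies efficient. Fix an orthonormal basis `b`, countable by separability.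
Irreducibility and polarization give densities `T i j` of `M(F)[|b i⟩⟨b j|]` with respect to a
finite measure `ν` that vanishes wherever `M` does (`exists_matrix_densities`). For almost every `x`
the kernel `T i j x` is positive, by complete positivity, and the densities belonging to the vectors
`b i` and `b i + b j` have rank at most one. Linear algebra at a fixed `x`
(`IsPositiveKernel.dichotomy`) leaves two cases: `T i j = |v i⟩⟨v j|`, a single Kraus operator, or
`T i j = s i j |ψ⟩⟨ψ|`, a map whose output is always proportional to one pure state.

On the set where the first case fails the second one holds, so there the ampliated output is an
integral of products `|ψ⟩⟨ψ| ⊗ B` with `B` positive. Thus the value of `M` at that set is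
entanglement-breaking (`IsQuantumOperation.isEntanglementBreaking`), hence zero by hypothesis, and
the set is `ν`-null. Measurability of the set comes from choosing `v` measurably
(`exists_measurable_gram`).

What remains is `T i j = |v i⟩⟨v j|` almost everywhere with `v i ∈ L²(ν; H) ≅ H ⊗ L²(ν)`. The map `b
i ↦ v i` extends to an isometry `V` because `M(X)` preserves the trace, and multiplication by
indicators on `L²(ν)` is the required spectral measure. -/

theorem continuous_sesquilinear {E F G : Type*} [NormedAddCommGroup E] [NormedSpace ℂ E]
    [NormedAddCommGroup F] [NormedSpace ℂ F] [NormedAddCommGroup G] [NormedSpace ℂ G]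
    (β : E →L[ℂ] F →L⋆[ℂ] G) : Continuous fun p : E × F => β p.1 p.2 := by
  have h : IsBoundedBilinearMap ℝ fun p : E × F => β p.1 p.2 :=
    { add_left := by simp
      smul_left := fun c x y => by
        change β ((c : ℂ) • x) y = (c : ℂ) • β x y
        simp
      add_right := by simp
      smul_right := fun c x y => by
        change β x ((c : ℂ) • y) = (c : ℂ) • β x y
        rw [map_smulₛₗ, Complex.conj_ofReal]
      bound := by
        refine ⟨‖β‖ + 1, by positivity, fun x y => (β.le_opNorm₂ x y).trans ?_⟩
        gcongr
        linarith }
  exact h.continuous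

/-! ### Rank-one operators and bounded maps on the trace class -/

section RankOne

variable {H : Type*} [NormedAddCommGroup H] [InnerProductSpace ℂ H] [CompleteSpace H]

theorem hsSq_rankOne (x y : H) :
    hsSq (InnerProductSpace.rankOne ℂ x y) = ‖x‖ₑ ^ 2 * ‖y‖ₑ ^ 2 := by
  rw [hsSq, ← tsum_enorm_inner_sq (basis H) y, ← ENNReal.tsum_mul_left]
  refine tsum_congr fun i => ?_
  rw [InnerProductSpace.rankOne_apply, enorm_smul, mul_pow, mul_comm, ← inner_conj_symm,
    RCLike.enorm_conj]

/-- Factor `|x⟩⟨y| = |x⟩⟨y| |y⟩⟨y|`. The arithmetic-geometric bound for a product of two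
Hilbert-Schmidt operators loses nothing when both have norm one, so the normalized case comes first
and the general one follows by homogeneity. -/
theorem traceNorm_rankOne_le_one {x y : H} (hx : ‖x‖ = 1) (hy : ‖y‖ = 1) :
    traceNorm (InnerProductSpace.rankOne ℂ x y) ≤ 1 := by
  have hx' : ‖x‖ₑ = 1 := by rw [← ofReal_norm, hx]; simp
  have hy' : ‖y‖ₑ = 1 := by rw [← ofReal_norm, hy]; simp
  refine traceNorm_le fun W hW => ?_
  have h1 := tsum_inner_comp_le (W ∘L InnerProductSpace.rankOne ℂ x y)
    (InnerProductSpace.rankOne ℂ y y)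
  have h2 := hsSq_comp_le W (InnerProductSpace.rankOne ℂ x y) hW
  rw [hsSq_rankOne, hx', hy'] at h2
  rw [hsSq_rankOne, hy'] at h1
  have h3 : ∀ z, (W ∘L InnerProductSpace.rankOne ℂ x y) (InnerProductSpace.rankOne ℂ y y z) =
      W (InnerProductSpace.rankOne ℂ x y z) := fun z => by
    simp [inner_self_eq_norm_sq_to_K, hy]
  simp only [h3] at h1
  refine (ENNReal.mul_le_mul_iff_right (a := 2) (by norm_num) (by norm_num)).1 (h1.trans ?_)
  calc _ ≤ (1 : ℝ≥0∞) ^ 2 * 1 ^ 2 + 1 ^ 2 * 1 ^ 2 := by gcongr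
    _ = 2 * 1 := by norm_num

theorem traceNorm_rankOne_le (x y : H) :
    traceNorm (InnerProductSpace.rankOne ℂ x y) ≤ ‖x‖ₑ * ‖y‖ₑ := by
  rcases eq_or_ne x 0 with rfl | hx
  · simp [traceNorm_zero]
  rcases eq_or_ne y 0 with rfl | hy
  · simp [traceNorm_zero]
  have hx' : (‖x‖ : ℂ) ≠ 0 := by simpa using hx
  have hy' : (‖y‖ : ℂ) ≠ 0 := by simpa using hy
  have h1 : InnerProductSpace.rankOne ℂ x y = ((‖x‖ : ℂ) * (‖y‖ : ℂ)) •
      InnerProductSpace.rankOne ℂ ((‖x‖ : ℂ)⁻¹ • x) ((‖y‖ : ℂ)⁻¹ • y) := by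
    ext z
    simp only [InnerProductSpace.rankOne_apply, inner_smul_left, map_inv₀, Complex.conj_ofReal,
      _root_.smul_apply, smul_smul]
    congr 1
    field_simp
  rw [h1, traceNorm_smul]
  have h2 : ‖(‖x‖ : ℂ) * (‖y‖ : ℂ)‖ₑ = ‖x‖ₑ * ‖y‖ₑ := by
    rw [enorm_mul, ← ofReal_norm, ← ofReal_norm (y : H), ← ofReal_norm (x : H), ← ofReal_norm,
      Complex.norm_real, Complex.norm_real, norm_norm, norm_norm]
  rw [h2]
  refine mul_le_of_le_one_right' (traceNorm_rankOne_le_one ?_ ?_)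
  · exact norm_smul_inv_norm hx
  · exact norm_smul_inv_norm hy

namespace TraceClass

/-- The operator `|x⟩⟨y|` as a trace-class operator. -/
noncomputable def rankOne (x y : H) : TraceClass H :=
  mk (InnerProductSpace.rankOne ℂ x y)
    (ne_top_of_le_ne_top (ENNReal.mul_ne_top enorm_ne_top enorm_ne_top) (traceNorm_rankOne_le x y))

@[simp] theorem op_rankOne (x y : H) : (rankOne x y).op = InnerProductSpace.rankOne ℂ x y := rfl

theorem norm_rankOne_le (x y : H) : ‖rankOne x y‖ ≤ ‖x‖ * ‖y‖ := by
  have h := traceNorm_rankOne_le x y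
  rw [← op_rankOne, ← ofReal_norm_eq, ← ofReal_norm, ← ofReal_norm,
    ← ENNReal.ofReal_mul (norm_nonneg _)] at h
  exact (ENNReal.ofReal_le_ofReal_iff (by positivity)).1 h

variable (H) in
/-- The bounded sesquilinear map `(x, y) ↦ |x⟩⟨y|`. -/
noncomputable def rankOneL : H →L[ℂ] H →L⋆[ℂ] TraceClass H :=
  (LinearMap.mk₂'ₛₗ (RingHom.id ℂ) (starRingEnd ℂ) (fun x y : H => rankOne x y)
    (fun x x' y => TraceClass.ext (by simp)) (fun c x y => TraceClass.ext (by simp))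
    (fun x y y' => TraceClass.ext (by simp))
    (fun c x y => TraceClass.ext (by simp))).mkContinuous₂ 1
    (fun x y => by rw [one_mul]; exact norm_rankOne_le x y)

@[simp] theorem rankOneL_apply (x y : H) : rankOneL H x y = rankOne x y := rfl

theorem continuous_rankOne : Continuous fun p : H × H => rankOne p.1 p.2 :=
  continuous_sesquilinear (rankOneL H)

variable (H) in
/-- The inclusion of the trace class into the bounded operators. -/
noncomputable def opL : TraceClass H →L[ℂ] (H →L[ℂ] H) :=
  LinearMap.mkContinuous
    { toFun := op
      map_add' := op_add
      map_smul' := op_smul } 1 (fun T => by rw [one_mul]; exact norm_op_le T)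

@[simp] theorem opL_apply (T : TraceClass H) : opL H T = T.op := rfl

/-- The matrix element `⟨x, T y⟩` as a functional of `T`. -/
noncomputable def matrixElt (x y : H) : TraceClass H →L[ℂ] ℂ :=
  innerSL ℂ x ∘L ContinuousLinearMap.apply ℂ H y ∘L opL H

@[simp] theorem matrixElt_apply (x y : H) (T : TraceClass H) :
    matrixElt x y T = inner ℂ x (T.op y) := rfl

theorem norm_mulLeft_le (A : H →L[ℂ] H) (T : TraceClass H) : ‖mulLeft A T‖ ≤ ‖A‖ * ‖T‖ := by
  have h := traceNorm_comp_le A T.op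
  rw [← op_mulLeft, ← ofReal_norm_eq, ← ofReal_norm_eq, ← ofReal_norm,
    ← ENNReal.ofReal_mul (norm_nonneg _)] at h
  exact (ENNReal.ofReal_le_ofReal_iff (by positivity)).1 h

/-- Left multiplication by a bounded operator as a bounded map of the trace class. -/
noncomputable def mulLeftL (A : H →L[ℂ] H) : TraceClass H →L[ℂ] TraceClass H :=
  LinearMap.mkContinuous
    { toFun := mulLeft A
      map_add' := fun S T => TraceClass.ext (by simp)
      map_smul' := fun c T => TraceClass.ext (by simp) } ‖A‖ (norm_mulLeft_le A)

@[simp] theorem mulLeftL_apply (A : H →L[ℂ] H) (T : TraceClass H) :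
    mulLeftL A T = mulLeft A T := rfl

theorem mulLeft_rankOne (A : H →L[ℂ] H) (x y : H) :
    mulLeft A (rankOne x y) = rankOne (A x) y :=
  TraceClass.ext (by simp [InnerProductSpace.comp_rankOne])

theorem trace_rankOne (x y : H) : (rankOne x y).trace = inner ℂ y x := by
  rw [trace_apply, ← ((basis H).hasSum_inner_mul_inner y x).tsum_eq]
  refine tsum_congr fun i => ?_
  rw [op_rankOne, InnerProductSpace.rankOne_apply, inner_smul_right]

theorem trace_mulLeft_rankOne (A : H →L[ℂ] H) (x y : H) :
    (mulLeft A (rankOne x y)).trace = inner ℂ y (A x) := by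
  rw [mulLeft_rankOne, trace_rankOne]

theorem rankOne_mulLeft (x y : H) (T : TraceClass H) :
    mulLeft (InnerProductSpace.rankOne ℂ x y) T =
      rankOne x (ContinuousLinearMap.adjoint T.op y) :=
  TraceClass.ext (by simp [InnerProductSpace.rankOne_comp])

/-- Testing against `A = |x⟩⟨y|` recovers the matrix element `⟨y, S x⟩`. -/
theorem ext_trace_mulLeft {S T : TraceClass H}
    (h : ∀ A : H →L[ℂ] H, (mulLeft A S).trace = (mulLeft A T).trace) : S = T := by
  refine TraceClass.ext (ContinuousLinearMap.ext fun x => ext_inner_left ℂ fun y => ?_)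
  have h1 := h (InnerProductSpace.rankOne ℂ x y)
  rwa [rankOne_mulLeft, rankOne_mulLeft, trace_rankOne, trace_rankOne,
    ContinuousLinearMap.adjoint_inner_left, ContinuousLinearMap.adjoint_inner_left] at h1

/-- Insert `∑ |e i⟩⟨e i| = 1` between `X` and `Y*`. Summability gives convergence in trace norm; the
limit is identified pointwise on vectors. -/
theorem hasSum_rankOne {X Y : H →L[ℂ] H} {T : TraceClass H}
    (hT : T.op = X ∘L ContinuousLinearMap.adjoint Y)
    (hs : Summable fun i => ‖X (basis H i)‖ * ‖Y (basis H i)‖) :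
    HasSum (fun i => rankOne (X (basis H i)) (Y (basis H i))) T := by
  have h1 : Summable fun i => rankOne (X (basis H i)) (Y (basis H i)) :=
    Summable.of_norm_bounded hs fun i => norm_rankOne_le _ _
  obtain ⟨S, hS⟩ := h1
  convert hS
  refine TraceClass.ext (ContinuousLinearMap.ext fun z => ?_)
  have h2 := (hS.mapL (opL H)).mapL (ContinuousLinearMap.apply ℂ H z)
  have h3 := ((basis H).hasSum_repr (ContinuousLinearMap.adjoint Y z)).mapL X
  refine HasSum.unique ?_ h2
  rw [hT]
  convert h3 using 1
  · ext i
    simp [HilbertBasis.repr_apply_apply, ContinuousLinearMap.adjoint_inner_right]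
  · rfl

theorem summable_of_hsSq {X Y : H →L[ℂ] H} {C : ℝ≥0∞} (hC : C ≠ ⊤) (hX : hsSq X ≤ C)
    (hY : hsSq Y ≤ C) : (Summable fun i => ‖X (basis H i)‖ * ‖Y (basis H i)‖) ∧
      ∑' i, ‖X (basis H i)‖ * ‖Y (basis H i)‖ ≤ C.toReal := by
  have key : ∑' i, ENNReal.ofReal (‖X (basis H i)‖ * ‖Y (basis H i)‖) ≤ C := by
    refine (ENNReal.mul_le_mul_iff_right (a := 2) (by norm_num) (by norm_num)).1 ?_
    rw [← ENNReal.tsum_mul_left, two_mul C]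
    refine le_trans ?_ (add_le_add hX hY)
    rw [hsSq, hsSq, ← ENNReal.tsum_add]
    refine ENNReal.tsum_le_tsum fun i => ?_
    have h1 : 2 * (‖X (basis H i)‖ * ‖Y (basis H i)‖) ≤
        ‖X (basis H i)‖ ^ 2 + ‖Y (basis H i)‖ ^ 2 := by
      nlinarith [sq_nonneg (‖X (basis H i)‖ - ‖Y (basis H i)‖)]
    have h2 := ENNReal.ofReal_le_ofReal h1
    rwa [ENNReal.ofReal_mul (by norm_num), ENNReal.ofReal_add (by positivity) (by positivity),
      ENNReal.ofReal_pow (norm_nonneg _), ENNReal.ofReal_pow (norm_nonneg _), ofReal_norm,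
      ofReal_norm, ENNReal.ofReal_ofNat] at h2
  have h3 := ENNReal.summable_toReal (ne_top_of_le_ne_top hC key)
  have h4 : ∀ i, (ENNReal.ofReal (‖X (basis H i)‖ * ‖Y (basis H i)‖)).toReal =
      ‖X (basis H i)‖ * ‖Y (basis H i)‖ := fun i => ENNReal.toReal_ofReal (by positivity)
  simp only [h4] at h3
  refine ⟨h3, ?_⟩
  rw [← ENNReal.ofReal_tsum_of_nonneg (fun i => by positivity) h3] at key
  rwa [← ENNReal.ofReal_le_iff_le_toReal hC]

/-- Every trace-class operator is an absolutely convergent series of operators of rank one. -/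
theorem exists_hasSum_rankOne (T : TraceClass H) : ∃ x y : basisIndex H → H,
    (Summable fun i => ‖x i‖ * ‖y i‖) ∧ ∑' i, ‖x i‖ * ‖y i‖ ≤ ‖T‖ ∧
      HasSum (fun i => rankOne (x i) (y i)) T := by
  obtain ⟨U, hU, hUT, -⟩ := exists_polar T.op
  obtain ⟨S, hS, hSS, hST⟩ := exists_sqrt T.op
  -- Write `T = (U S) S` with `U` the polar part and `S = |T|^(1/2)`; both factors have squared
  -- Hilbert-Schmidt norm at most `‖T‖`.
  have h1 := summable_of_hsSq (X := U ∘L S) (Y := S) T.traceNorm_op_ne_top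
    ((hsSq_comp_le U S hU).trans hST.le) hST.le
  refine ⟨_, _, h1.1, h1.2, hasSum_rankOne ?_ h1.1⟩
  rw [hS, ContinuousLinearMap.comp_assoc, hSS, hUT]

theorem abs_op_of_isPositive {T : H →L[ℂ] H} (hT : T.IsPositive) : CFC.abs T = T :=
  CFC.abs_of_nonneg T ((ContinuousLinearMap.nonneg_iff_isPositive T).2 hT)

/-- A positive trace-class operator is a convergent series of positive operators of rank one. -/
theorem exists_hasSum_rankOne_self {T : TraceClass H} (hT : T.op.IsPositive) :
    ∃ x : basisIndex H → H, HasSum (fun i => rankOne (x i) (x i)) T := by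
  obtain ⟨S, hS, hSS, hST⟩ := exists_sqrt T.op
  have h1 := summable_of_hsSq (X := S) (Y := S) T.traceNorm_op_ne_top hST.le hST.le
  refine ⟨_, hasSum_rankOne ?_ h1.1⟩
  rw [hS, hSS, abs_op_of_isPositive hT]

theorem norm_eq_trace {T : TraceClass H} (hT : T.op.IsPositive) : ‖T‖ = T.trace.re := by
  rw [trace_apply, Complex.re_tsum T.summable_inner, norm_def, traceNorm,
    abs_op_of_isPositive hT, ← ENNReal.ofReal_tsum_of_nonneg, ENNReal.toReal_ofReal]
  · exact tsum_nonneg fun i => hT.re_inner_nonneg_right _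
  · exact fun i => hT.re_inner_nonneg_right _
  · exact (Complex.hasSum_re T.summable_inner.hasSum).summable

theorem ext_of_rankOne {E : Type*} [NormedAddCommGroup E] [NormedSpace ℂ E]
    {f g : TraceClass H →L[ℂ] E} (h : ∀ x y, f (rankOne x y) = g (rankOne x y)) : f = g := by
  ext T
  obtain ⟨x, y, -, -, hT⟩ := exists_hasSum_rankOne T
  refine HasSum.unique (hT.mapL f) ?_
  simpa only [h] using hT.mapL g

theorem ext_of_basis {E ι : Type*} [NormedAddCommGroup E] [NormedSpace ℂ E]
    (b : HilbertBasis ι ℂ H) {f g : TraceClass H →L[ℂ] E}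
    (h : ∀ i j, f (rankOne (b i) (b j)) = g (rankOne (b i) (b j))) : f = g := by
  refine ext_of_rankOne fun x y => ?_
  have hx : ∀ x j, f (rankOne x (b j)) = g (rankOne x (b j)) := by
    intro x j
    have h1 := ((b.hasSum_repr x).mapL ((rankOneL H).flip (b j))).mapL f
    have h2 := ((b.hasSum_repr x).mapL ((rankOneL H).flip (b j))).mapL g
    simp only [map_smul, ContinuousLinearMap.flip_apply, rankOneL_apply, h] at h1 h2
    exact h1.unique h2
  have h1 := ((b.hasSum_repr y).mapL (rankOneL H x)).mapL f
  have h2 := ((b.hasSum_repr y).mapL (rankOneL H x)).mapL g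
  simp only [map_smulₛₗ, rankOneL_apply, hx] at h1 h2
  exact h1.unique h2

/-- Riesz representation of the bounded form `ℓ ∘ β`. It turns `ℓ(β x y)` into `Tr A |x⟩⟨y|`, a
functional already defined on the whole trace class. -/
theorem exists_operator_of_sesquilinear {E : Type*} [NormedAddCommGroup E] [NormedSpace ℂ E]
    (ℓ : E →L[ℂ] ℂ) (β : H →L[ℂ] H →L⋆[ℂ] E) :
    ∃ A : H →L[ℂ] H, ∀ x y, ℓ (β x y) = inner ℂ y (A x) := by
  let B : H →L⋆[ℂ] H →L[ℂ] ℂ := LinearMap.mkContinuous₂ (LinearMap.mk₂'ₛₗ (starRingEnd ℂ)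
    (RingHom.id ℂ) (fun y x : H => ℓ (β x y)) (by simp) (by simp) (by simp) (by simp))
    (‖ℓ‖ * ‖β‖) (fun y x => by
      refine (ℓ.le_opNorm _).trans ?_
      rw [mul_assoc, mul_assoc]
      refine mul_le_mul_of_nonneg_left ?_ (norm_nonneg _)
      rw [mul_comm ‖y‖, ← mul_assoc]
      exact β.le_opNorm₂ _ _)
  refine ⟨ContinuousLinearMap.adjoint (InnerProductSpace.continuousLinearMapOfBilin B),
    fun x y => ?_⟩
  rw [ContinuousLinearMap.adjoint_inner_right,
    InnerProductSpace.continuousLinearMapOfBilin_apply]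
  rfl

/-- A bounded sesquilinear map extends to a bounded linear map of the trace class. -/
theorem exists_lift {E : Type*} [NormedAddCommGroup E] [NormedSpace ℂ E] [CompleteSpace E]
    (β : H →L[ℂ] H →L⋆[ℂ] E) : ∃ Ψ : TraceClass H →L[ℂ] E, ∀ x y, Ψ (rankOne x y) = β x y := by
  choose x y hs hb hT using exists_hasSum_rankOne (H := H)
  have hβ : ∀ T, Summable fun i => ‖β (x T i) (y T i)‖ := fun T => by
    refine Summable.of_nonneg_of_le (fun _ => norm_nonneg _) (fun i => ?_) ((hs T).mul_left ‖β‖)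
    rw [← mul_assoc]
    exact β.le_opNorm₂ _ _
  have hform : ∀ ℓ : E →L[ℂ] ℂ, ∃ A : H →L[ℂ] H, ∀ x y, ℓ (β x y) = inner ℂ y (A x) :=
    fun ℓ => exists_operator_of_sesquilinear ℓ β
  choose A hA using hform
  -- The rank-one expansion of `T` is an arbitrary choice, yet every functional of the resulting sum
  -- equals `Tr A T`. This yields both independence of the choice and linearity in `T`.
  have hℓ : ∀ (ℓ : E →L[ℂ] ℂ) T, ℓ (∑' i, β (x T i) (y T i)) = (mulLeftL (A ℓ) T).trace := by
    intro ℓ T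
    have h1 := (hβ T).of_norm.hasSum.mapL ℓ
    have h2 := ((hT T).mapL (mulLeftL (A ℓ))).mapL trace
    simp only [mulLeftL_apply, trace_mulLeft_rankOne, ← hA] at h2
    exact h1.unique h2
  have hext : ∀ u v : E, (∀ ℓ : E →L[ℂ] ℂ, ℓ u = ℓ v) → u = v := fun u v h =>
    (SeparatingDual.eq_iff_forall_dual_eq (R := ℂ)).2 h
  let Ψ : TraceClass H →L[ℂ] E := LinearMap.mkContinuous
    { toFun := fun T => ∑' i, β (x T i) (y T i)
      map_add' := fun S T => hext _ _ fun ℓ => by rw [map_add, hℓ, hℓ, hℓ, map_add, map_add]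
      map_smul' := fun c T => hext _ _ fun ℓ => by
        rw [RingHom.id_apply, map_smul, hℓ, hℓ, map_smul, map_smul] } ‖β‖ (fun T => by
      refine (norm_tsum_le_tsum_norm (hβ T)).trans ?_
      refine le_trans ?_ (mul_le_mul_of_nonneg_left (hb T) (norm_nonneg β))
      rw [← tsum_mul_left]
      refine (hβ T).tsum_le_tsum (fun i => ?_) ((hs T).mul_left ‖β‖)
      rw [← mul_assoc]
      exact β.le_opNorm₂ _ _)
  refine ⟨Ψ, fun u v => hext _ _ fun ℓ => ?_⟩
  rw [hA, ← trace_mulLeft_rankOne]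
  exact hℓ ℓ _

end TraceClass

end RankOne

/-- Equal Gram matrices force equal norms of corresponding linear combinations, so `u a ↦ w a` is
well defined even when the `u a` are dependent, and density extends it. -/
theorem exists_isometry_of_inner_eq {α E G : Type*} [NormedAddCommGroup E] [InnerProductSpace ℂ E]
    [NormedAddCommGroup G] [InnerProductSpace ℂ G] [CompleteSpace G] {u : α → E} {w : α → G}
    (hu : Dense (Submodule.span ℂ (Set.range u) : Set E))
    (h : ∀ a b, inner ℂ (w a) (w b) = inner ℂ (u a) (u b)) :
    ∃ S : E →ₗᵢ[ℂ] G, ∀ a, S (u a) = w a := by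
  let f := Finsupp.linearCombination ℂ w
  let e := Finsupp.linearCombination ℂ u
  have hinner : ∀ z z', inner ℂ (f z) (f z') = inner ℂ (e z) (e z') := by
    intro z z'
    induction z using Finsupp.induction_linear with
    | zero => simp
    | add x y hx hy => rw [map_add, map_add, inner_add_left, inner_add_left, hx, hy]
    | single a c =>
      induction z' using Finsupp.induction_linear with
      | zero => simp
      | add x y hx hy => rw [map_add, map_add, inner_add_right, inner_add_right, hx, hy]
      | single a' c' => simp [f, e, h]
  have he : DenseRange e := by
    rwa [← Finsupp.range_linearCombination] at hu
  have hn : ∀ z, ‖f z‖ = ‖e z‖ := fun z => by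
    rw [@norm_eq_sqrt_re_inner ℂ, @norm_eq_sqrt_re_inner ℂ _ _ _ _ (e z), hinner]
  have hext : ∀ z, f.extendOfNorm e (e z) = f z :=
    LinearMap.extendOfNorm_eq he ⟨1, fun z => by rw [one_mul, hn]⟩
  refine ⟨⟨(f.extendOfNorm e).toLinearMap, fun z => ?_⟩, fun a => ?_⟩
  · refine he.induction_on (p := fun z => ‖f.extendOfNorm e z‖ = ‖z‖) z ?_ fun z => ?_
    · exact isClosed_eq (by fun_prop) (by fun_prop)
    · rw [hext, hn]
  · have h1 := hext (Finsupp.single a 1)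
    simpa [f, e] using h1

/-! ### Product vectors and tensor products of trace-class operators -/

section TensorLemmas

variable {H K : Type*} [NormedAddCommGroup H] [InnerProductSpace ℂ H]
  [NormedAddCommGroup K] [InnerProductSpace ℂ K]

variable (H K) in
/-- The product vectors as a bounded bilinear map. -/
noncomputable def vtmulL : H →L[ℂ] K →L[ℂ] HTensor H K :=
  (ContinuousLinearMap.compL ℂ K (H ⊗[ℂ] K) (HTensor H K) UniformSpace.Completion.toComplL) ∘L
    TensorProduct.mkL ℂ H K

@[simp] theorem vtmulL_apply (x : H) (y : K) : vtmulL H K x y = vtmul x y := rfl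

theorem vtmul_add_left (x x' : H) (y : K) : vtmul (x + x') y = vtmul x y + vtmul x' y := by
  simp only [← vtmulL_apply, map_add, _root_.add_apply]

theorem vtmul_add_right (x : H) (y y' : K) : vtmul x (y + y') = vtmul x y + vtmul x y' := by
  simp only [← vtmulL_apply, map_add]

theorem vtmul_smul_left (c : ℂ) (x : H) (y : K) : vtmul (c • x) y = c • vtmul x y := by
  simp only [← vtmulL_apply, map_smul, _root_.smul_apply]

theorem vtmul_smul_right (c : ℂ) (x : H) (y : K) : vtmul x (c • y) = c • vtmul x y := by
  simp only [← vtmulL_apply, map_smul]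

theorem htensor_induction {p : HTensor H K → Prop} (hc : IsClosed {z | p z}) (h0 : p 0)
    (hadd : ∀ z w, p z → p w → p (z + w)) (ht : ∀ x y, p (vtmul x y)) (z : HTensor H K) : p z := by
  induction z using UniformSpace.Completion.induction_on with
  | hp => exact hc
  | ih z =>
    induction z using TensorProduct.induction_on with
    | zero => rw [UniformSpace.Completion.coe_zero]; exact h0
    | tmul x y => exact ht x y
    | add x y hx hy => rw [UniformSpace.Completion.coe_add]; exact hadd _ _ hx hy

theorem htensor_ext {E : Type*} [NormedAddCommGroup E] [NormedSpace ℂ E]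
    {f g : HTensor H K →L[ℂ] E} (h : ∀ x y, f (vtmul x y) = g (vtmul x y)) : f = g := by
  ext z
  induction z using htensor_induction with
  | hc => exact isClosed_eq f.continuous g.continuous
  | h0 => simp
  | hadd z w hz hw => simp [hz, hw]
  | ht x y => exact h x y

theorem opTensor_add_left (A A' : H →L[ℂ] H) (B : K →L[ℂ] K) :
    opTensor (A + A') B = opTensor A B + opTensor A' B :=
  htensor_ext fun x y => by simp [vtmul_add_left]

theorem opTensor_add_right (A : H →L[ℂ] H) (B B' : K →L[ℂ] K) :
    opTensor A (B + B') = opTensor A B + opTensor A B' :=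
  htensor_ext fun x y => by simp [vtmul_add_right]

theorem opTensor_smul_left (c : ℂ) (A : H →L[ℂ] H) (B : K →L[ℂ] K) :
    opTensor (c • A) B = c • opTensor A B :=
  htensor_ext fun x y => by simp [vtmul_smul_left]

theorem opTensor_smul_right (c : ℂ) (A : H →L[ℂ] H) (B : K →L[ℂ] K) :
    opTensor A (c • B) = c • opTensor A B :=
  htensor_ext fun x y => by simp [vtmul_smul_right]

theorem opTensor_rankOne (x x' : H) (y y' : K) :
    opTensor (InnerProductSpace.rankOne ℂ x x') (InnerProductSpace.rankOne ℂ y y') =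
      InnerProductSpace.rankOne ℂ (vtmul x y) (vtmul x' y') :=
  htensor_ext fun u v => by
    simp [inner_vtmul, vtmul_smul_left, vtmul_smul_right, smul_smul, mul_comm]

variable [CompleteSpace H] [CompleteSpace K]

namespace TraceClass

/-- Both operators are split into Hilbert-Schmidt halves, whose norms multiply under the tensor
product. The factor `2` comes from the crude bound `traceNorm_comp_le_hsSq`; only continuity of
`tmul` is needed. -/
theorem norm_tmul_le (A : TraceClass H) (B : TraceClass K) : ‖A.tmul B‖ ≤ 2 * ‖A‖ * ‖B‖ := by
  obtain ⟨U, hU, hUA, -⟩ := exists_polar A.op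
  obtain ⟨S, -, hSS, hSA⟩ := exists_sqrt A.op
  obtain ⟨W, hW, hWB, -⟩ := exists_polar B.op
  obtain ⟨R, -, hRR, hRB⟩ := exists_sqrt B.op
  have hA : A.op = (U ∘L S) ∘L S := by rw [ContinuousLinearMap.comp_assoc, hSS, hUA]
  have hB : B.op = (W ∘L R) ∘L R := by rw [ContinuousLinearMap.comp_assoc, hRR, hWB]
  have h1 : traceNorm (A.tmul B).op ≤ 2 * traceNorm A.op * traceNorm B.op := by
    calc traceNorm (A.tmul B).op
        = traceNorm (opTensor (U ∘L S) (W ∘L R) ∘L opTensor S R) := by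
          rw [op_tmul, ← opTensor_comp, ← hA, ← hB]
      _ ≤ hsSq (U ∘L S) * hsSq (W ∘L R) + hsSq S * hsSq R := by
          rw [← hsSq_opTensor, ← hsSq_opTensor]
          exact traceNorm_comp_le_hsSq _ _
      _ ≤ hsSq S * hsSq R + hsSq S * hsSq R := by
          gcongr
          · exact hsSq_comp_le U S hU
          · exact hsSq_comp_le W R hW
      _ = _ := by rw [hSA, hRB, two_mul, add_mul]
  rw [← ofReal_norm_eq, ← ofReal_norm_eq, ← ofReal_norm_eq, ← ENNReal.ofReal_ofNat,
    ← ENNReal.ofReal_mul (by positivity), ← ENNReal.ofReal_mul (by positivity)] at h1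
  exact (ENNReal.ofReal_le_ofReal_iff (by positivity)).1 h1

variable (H K) in
/-- The tensor product of trace-class operators as a bounded bilinear map. -/
noncomputable def tmulL : TraceClass H →L[ℂ] TraceClass K →L[ℂ] TraceClass (HTensor H K) :=
  (LinearMap.mk₂ ℂ tmul (fun _ _ _ => TraceClass.ext (opTensor_add_left _ _ _))
    (fun _ _ _ => TraceClass.ext (opTensor_smul_left _ _ _))
    (fun _ _ _ => TraceClass.ext (opTensor_add_right _ _ _))
    (fun _ _ _ => TraceClass.ext (opTensor_smul_right _ _ _))).mkContinuous₂ 2 norm_tmul_le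

@[simp] theorem tmulL_apply (A : TraceClass H) (B : TraceClass K) :
    tmulL H K A B = A.tmul B := rfl

theorem rankOne_tmul_rankOne (x x' : H) (y y' : K) :
    (rankOne x x').tmul (rankOne y y') = rankOne (vtmul x y) (vtmul x' y') :=
  TraceClass.ext (opTensor_rankOne x x' y y')

theorem trace_tmul_rankOne (A : TraceClass H) (y y' : K) :
    (A.tmul (rankOne y y')).trace = A.trace * inner ℂ y' y := by
  have h : trace ∘L (tmulL H K).flip (rankOne y y') = (inner ℂ y' y : ℂ) • trace (H := H) :=
    ext_of_rankOne fun x x' => by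
      simp [rankOne_tmul_rankOne, trace_rankOne, inner_vtmul, mul_comm]
  have h1 := congrArg (fun f => f A) h
  simpa [mul_comm] using h1

end TraceClass

end TensorLemmas

/-! ### The Hilbert space `H ⊗ L²(ν)` as `L²(ν; H)` -/

section VectorL2

variable {H K : Type*} [NormedAddCommGroup H] [InnerProductSpace ℂ H]
  [NormedAddCommGroup K] [InnerProductSpace ℂ K]
  {X : Type*} [MeasurableSpace X] {ν : Measure X}

/-- The product of a vector and a scalar square integrable function. -/
noncomputable def vecMulL (H : Type*) [NormedAddCommGroup H] [InnerProductSpace ℂ H]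
    (ν : Measure X) : H →L[ℂ] Lp ℂ 2 ν →L[ℂ] Lp H 2 ν :=
  ContinuousLinearMap.compLpL₂ 2 ν (ContinuousLinearMap.lsmul ℂ ℂ).flip

theorem vecMulL_coeFn (x : H) (f : Lp ℂ 2 ν) : vecMulL H ν x f =ᵐ[ν] fun a => f a • x :=
  ContinuousLinearMap.coeFn_compLp _ f

theorem inner_vecMulL (x x' : H) (f f' : Lp ℂ 2 ν) :
    inner ℂ (vecMulL H ν x f) (vecMulL H ν x' f') = inner ℂ x x' * inner ℂ f f' := by
  rw [L2.inner_def, L2.inner_def, ← integral_const_mul]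
  refine integral_congr_ae ?_
  filter_upwards [vecMulL_coeFn x f, vecMulL_coeFn x' f'] with a h h'
  rw [h, h', inner_smul_left, inner_smul_right]
  simp
  ring

/-- The isometry `H ⊗ K → L²(ν; H)` induced by an isometry `K → L²(ν)`. -/
theorem exists_isometry_vectorL2 [CompleteSpace H] (S : K →ₗᵢ[ℂ] Lp ℂ 2 ν) :
    ∃ J : HTensor H K →ₗᵢ[ℂ] Lp H 2 ν, ∀ x k, J (vtmul x k) = vecMulL H ν x (S k) := by
  have hd : Dense (Submodule.span ℂ (Set.range fun p : H × K => vtmul p.1 p.2) :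
      Set (HTensor H K)) := by
    rw [Submodule.dense_iff_topologicalClosure_eq_top]
    exact top_le_iff.1 (top_le_closure_span_vtmul (v := id) (w := id) (by simp) (by simp))
  obtain ⟨J, hJ⟩ := exists_isometry_of_inner_eq hd
    (w := fun p : H × K => vecMulL H ν p.1 (S p.2)) fun p q => by
      rw [inner_vecMulL, S.inner_map_map, inner_vtmul]
  exact ⟨J, fun x k => hJ (x, k)⟩

/-- Through `J`, the quadratic form of `A ⊗ P(F)` is that of `A` acting pointwise on functions
restricted to `F`; by continuity product vectors suffice. -/
theorem inner_opTensor_eq_setIntegral [CompleteSpace H] {S : K →ₗᵢ[ℂ] Lp ℂ 2 ν}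
    {J : HTensor H K →ₗᵢ[ℂ] Lp H 2 ν} (hJ : ∀ x k, J (vtmul x k) = vecMulL H ν x (S k))
    {F : Set X} {P : K →L[ℂ] K}
    (hP : ∀ k k', inner ℂ k (P k') = ∫ x in F, inner ℂ (S k x) (S k' x) ∂ν)
    (A : H →L[ℂ] H) (z w : HTensor H K) :
    inner ℂ z (opTensor A P w) = ∫ x in F, inner ℂ (J z x) (A (J w x)) ∂ν := by
  -- Restriction to `F` as a bounded operator makes the right-hand side visibly continuous in `z`
  -- and `w`.
  let R := LpToLpRestrictCLM X H ℂ ν 2 F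
  let L : Lp H 2 (ν.restrict F) →L[ℂ] Lp H 2 (ν.restrict F) := A.compLpL 2 (ν.restrict F)
  have h1 : ∀ z w, ∫ x in F, inner ℂ (J z x) (A (J w x)) ∂ν =
      inner ℂ (R (J z)) (L (R (J w))) := by
    intro z w
    rw [L2.inner_def]
    refine integral_congr_ae ?_
    filter_upwards [LpToLpRestrictCLM_coeFn ℂ F (J z), LpToLpRestrictCLM_coeFn ℂ F (J w),
      ContinuousLinearMap.coeFn_compLpL (p := 2) A (R (J w))] with x h1 h2 h3
    rw [h1, h3, h2]
  rw [h1]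
  induction z using htensor_induction with
  | hc => exact isClosed_eq (by fun_prop) (by fun_prop)
  | h0 => simp
  | hadd z z' hz hz' => rw [map_add, map_add, inner_add_left, inner_add_left, hz, hz']
  | ht x k =>
    induction w using htensor_induction with
    | hc => exact isClosed_eq (by fun_prop) (by fun_prop)
    | h0 => simp
    | hadd z z' hz hz' => rw [map_add, map_add, map_add, map_add, inner_add_right,
        inner_add_right, hz, hz']
    | ht x' k' =>
      rw [opTensor_vtmul, inner_vtmul, ← h1, hP, ← integral_const_mul]
      refine integral_congr_ae (ae_restrict_of_ae ?_)
      rw [hJ, hJ]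
      filter_upwards [vecMulL_coeFn x (S k), vecMulL_coeFn x' (S k')] with a h h'
      rw [h, h', map_smul, inner_smul_left, inner_smul_right]
      simp
      ring

/-- The range of an isometry of a complete space is closed, and it contains the functions `1_s c =
J(c ⊗ 1_s)`, which generate `L²(ν; H)`. -/
theorem surjective_of_vecMulL [CompleteSpace H] [IsFiniteMeasure ν]
    {J : HTensor H (Lp ℂ 2 ν) →ₗᵢ[ℂ] Lp H 2 ν} (hJ : ∀ x k, J (vtmul x k) = vecMulL H ν x k) :
    Function.Surjective J := by
  have hclosed : IsClosed (Set.range J) := J.isometry.isClosedEmbedding.isClosed_range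
  intro f
  change f ∈ Set.range J
  induction f using Lp.induction with
  | hp_ne_top => simp
  | isClosed => exact hclosed
  | add hf hg _ h1 h2 =>
    obtain ⟨z, hz⟩ := h1
    obtain ⟨w, hw⟩ := h2
    exact ⟨z + w, by rw [map_add, hz, hw]⟩
  | @indicatorConst c s hs hμs =>
    refine ⟨vtmul c (indicatorConstLp 2 hs hμs.ne 1), ?_⟩
    rw [hJ, Lp.simpleFunc.coe_indicatorConst]
    refine Lp.ext ?_
    filter_upwards [vecMulL_coeFn c (indicatorConstLp 2 hs hμs.ne (1 : ℂ)),
      indicatorConstLp_coeFn (p := 2) (hs := hs) (hμs := hμs.ne) (c := (1 : ℂ)),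
      indicatorConstLp_coeFn (p := 2) (hs := hs) (hμs := hμs.ne) (c := c)] with a h1 h2 h3
    rw [h1, h2, h3]
    by_cases ha : a ∈ s <;> simp [ha]

end VectorL2

/-! ### Spectral measures and their cyclic representation -/

section SpectralMeasureLemmas

variable {X : Type*} [MeasurableSpace X]

theorem additive_of_hasSum {E : Type*} [NormedAddCommGroup E] {m : Set X → E}
    (h : ∀ F : ℕ → Set X, (∀ n, MeasurableSet (F n)) → Pairwise (Function.onFun Disjoint F) →
      HasSum (fun n => m (F n)) (m (⋃ n, F n))) :
    m ∅ = 0 ∧ ∀ F G, MeasurableSet F → MeasurableSet G → Disjoint F G → m (F ∪ G) = m F + m G := by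
  classical
  have h0 : m ∅ = 0 := by
    have h1 := h (fun _ => ∅) (fun _ => MeasurableSet.empty) (fun _ _ _ => Set.disjoint_empty _)
    exact tendsto_nhds_unique tendsto_const_nhds h1.summable.tendsto_atTop_zero
  -- A vector measure must vanish off the measurable sets, where `m` is arbitrary; hence the
  -- truncation.
  let v : VectorMeasure X E :=
    { measureOf' := fun F => if MeasurableSet F then m F else 0
      empty' := by simp [h0]
      not_measurable' := fun F hF => if_neg hF
      m_iUnion' := fun F hF hd => by
        simp only [hF, MeasurableSet.iUnion hF, if_true]
        exact h F hF hd }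
  have hv : ∀ F, MeasurableSet F → v F = m F := fun F hF => if_pos hF
  refine ⟨h0, fun F G hF hG hd => ?_⟩
  rw [← hv F hF, ← hv G hG, ← hv _ (hF.union hG), VectorMeasure.of_union hd hF hG]

namespace SpectralMeasure

variable {K : Type*} [NormedAddCommGroup K] [InnerProductSpace ℂ K] [CompleteSpace K]
  (P : SpectralMeasure X K)

theorem empty : P.toFun ∅ = 0 :=
  ContinuousLinearMap.ext fun x => (additive_of_hasSum (m := fun F => P.toFun F x)
    fun F hF hd => P.hasSum_iUnion F hF hd x).1

theorem union {F G : Set X} (hF : MeasurableSet F) (hG : MeasurableSet G) (hd : Disjoint F G) :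
    P.toFun (F ∪ G) = P.toFun F + P.toFun G :=
  ContinuousLinearMap.ext fun x =>
    (additive_of_hasSum (m := fun F => P.toFun F x)
      fun F hF hd => P.hasSum_iUnion F hF hd x).2 F G hF hG hd

/-- Since `P(G) ≤ P(F ∪ G)` are projections, `(P(F) + P(G)) P(G) = P(G)`, and idempotence of `P(G)`
leaves `P(F) P(G) = 0`. -/
theorem mul_of_disjoint {F G : Set X} (hF : MeasurableSet F) (hG : MeasurableSet G)
    (hd : Disjoint F G) : P.toFun F * P.toFun G = 0 := by
  have h1 : P.toFun G ≤ P.toFun (F ∪ G) := by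
    rw [P.union hF hG hd]
    exact le_add_of_nonneg_left (P.isStarProjection F hF).nonneg
  have h2 := ((P.isStarProjection G hG).le_iff_mul_eq_right
    (P.isStarProjection _ (hF.union hG))).1 h1
  rw [P.union hF hG hd, add_mul, (P.isStarProjection G hG).isIdempotentElem.eq] at h2
  simpa using h2

theorem mul {F G : Set X} (hF : MeasurableSet F) (hG : MeasurableSet G) :
    P.toFun F * P.toFun G = P.toFun (F ∩ G) := by
  have hi := hF.inter hG
  have h1 : P.toFun F = P.toFun (F ∩ G) + P.toFun (F \ G) := by
    rw [← P.union hi (hF.diff hG) Set.disjoint_sdiff_inter.symm, Set.inter_union_sdiff]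
  have h2 : P.toFun G = P.toFun (F ∩ G) + P.toFun (G \ F) := by
    rw [← P.union hi (hG.diff hF) (by rw [Set.inter_comm]; exact Set.disjoint_sdiff_inter.symm),
      Set.inter_comm, Set.inter_union_sdiff]
  rw [h1, h2, add_mul, mul_add, mul_add, (P.isStarProjection _ hi).isIdempotentElem.eq,
    P.mul_of_disjoint hi (hG.diff hF), P.mul_of_disjoint (hF.diff hG) hi,
    P.mul_of_disjoint (hF.diff hG) (hG.diff hF)]
  · simp
  · exact Set.disjoint_of_subset_left Set.sdiff_subset Set.disjoint_sdiff_right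
  · exact Set.disjoint_of_subset_right Set.inter_subset_right Set.disjoint_sdiff_left
  · exact Set.disjoint_of_subset_left Set.inter_subset_left Set.disjoint_sdiff_right

theorem inner_apply_left {F : Set X} (hF : MeasurableSet F) (x y : K) :
    inner ℂ (P.toFun F x) y = inner ℂ x (P.toFun F y) := by
  have h : ContinuousLinearMap.adjoint (P.toFun F) = P.toFun F :=
    (P.isStarProjection F hF).isSelfAdjoint
  rw [← ContinuousLinearMap.adjoint_inner_right, h]

theorem inner_apply_apply {F G : Set X} (hF : MeasurableSet F) (hG : MeasurableSet G) (x y : K) :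
    inner ℂ (P.toFun F x) (P.toFun G y) = inner ℂ x (P.toFun (F ∩ G) y) := by
  rw [P.inner_apply_left hF, ← P.mul hF hG]
  rfl

theorem inner_self_apply {F : Set X} (hF : MeasurableSet F) (x : K) :
    inner ℂ x (P.toFun F x) = (‖P.toFun F x‖ ^ 2 : ℝ) := by
  have h := P.inner_apply_apply hF hF x x
  rw [Set.inter_self, inner_self_eq_norm_sq_to_K] at h
  rw [← h]
  simp

/-- The scalar measure `F ↦ ‖P(F) ξ‖²`. -/
noncomputable def scalarMeasure (ξ : K) : Measure X :=
  Measure.ofMeasurable (fun F _ => ENNReal.ofReal (‖P.toFun F ξ‖ ^ 2))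
    (by simp [P.empty])
    (fun F hF hd => by
      have h1 := (P.hasSum_iUnion F hF hd ξ).mapL (innerSL ℂ ξ)
      simp only [innerSL_apply_apply, P.inner_self_apply (hF _),
        P.inner_self_apply (MeasurableSet.iUnion hF)] at h1
      have h2 := Complex.hasSum_ofReal.1 h1
      rw [← h2.tsum_eq, ENNReal.ofReal_tsum_of_nonneg (fun n => by positivity) h2.summable])

theorem scalarMeasure_apply (ξ : K) {F : Set X} (hF : MeasurableSet F) :
    P.scalarMeasure ξ F = ENNReal.ofReal (‖P.toFun F ξ‖ ^ 2) :=
  Measure.ofMeasurable_apply F hF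

instance (ξ : K) : IsFiniteMeasure (P.scalarMeasure ξ) :=
  ⟨by rw [P.scalarMeasure_apply ξ MeasurableSet.univ]; exact ENNReal.ofReal_lt_top⟩

/-- A spectral measure of multiplicity one is equivalent to the multiplication by indicators. -/
theorem exists_isometry_of_dense {ξ : K}
    (hξ : Dense (Submodule.span ℂ {y | ∃ F, MeasurableSet F ∧ y = P.toFun F ξ} : Set K)) :
    ∃ S : K →ₗᵢ[ℂ] Lp ℂ 2 (P.scalarMeasure ξ), ∀ F, MeasurableSet F → ∀ k k',
      inner ℂ k (P.toFun F k') = ∫ x in F, inner ℂ (S k x) (S k' x) ∂(P.scalarMeasure ξ) := by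
  set ν := P.scalarMeasure ξ
  let u : {F : Set X // MeasurableSet F} → K := fun F => P.toFun F ξ
  let w : {F : Set X // MeasurableSet F} → Lp ℂ 2 ν := fun F =>
    indicatorConstLp 2 F.2 (measure_ne_top ν F) 1
  have hreal : ∀ F, MeasurableSet F → (ν.real F : ℂ) = inner ℂ ξ (P.toFun F ξ) := by
    intro F hF
    rw [P.inner_self_apply hF, Measure.real, P.scalarMeasure_apply ξ hF,
      ENNReal.toReal_ofReal (by positivity)]
  have hu : Dense (Submodule.span ℂ (Set.range u) : Set K) := by
    convert hξ
    ext y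
    simp [u, eq_comm]
  obtain ⟨S, hS⟩ := exists_isometry_of_inner_eq hu (w := w) fun F G => by
    rw [P.inner_apply_apply F.2 G.2, ← hreal _ (F.2.inter G.2)]
    exact L2.inner_indicatorConstLp_one_indicatorConstLp_one F.2 G.2 _ _
  refine ⟨S, fun F hF k k' => ?_⟩
  let R := LpToLpRestrictCLM X ℂ ℂ ν 2 F ∘L S.toContinuousLinearMap
  have hR : ∀ k k', ∫ x in F, inner ℂ (S k x) (S k' x) ∂ν = inner ℂ (R k) (R k') := by
    intro k k'
    rw [L2.inner_def]
    refine integral_congr_ae ?_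
    filter_upwards [LpToLpRestrictCLM_coeFn ℂ F (S k), LpToLpRestrictCLM_coeFn ℂ F (S k')]
      with x h1 h2
    exact (congrArg₂ _ h1 h2).symm
  -- With `u G = P(G)ξ` and `S (u G) = 1_G`, both sides equal `ν(F ∩ G ∩ G')`.
  have hRu : ∀ G G', inner ℂ (u G) (P.toFun F (u G')) = inner ℂ (R (u G)) (R (u G')) := by
    intro G G'
    have h1 : P.toFun F (u G') = P.toFun (F ∩ G') ξ :=
      congrArg (fun f : K →L[ℂ] K => f ξ) (P.mul hF G'.2)
    rw [← hR, hS, hS, h1, P.inner_apply_apply G.2 (hF.inter G'.2),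
      ← hreal _ (G.2.inter (hF.inter G'.2))]
    have h2 : (G : Set X) ∩ (F ∩ G') = F ∩ (G ∩ G') := by
      rw [Set.inter_left_comm]
    have h3 : ∫ x in F, ((G : Set X) ∩ G').indicator (fun _ => (1 : ℂ)) x ∂ν =
        ν.real (F ∩ (G ∩ G')) := by
      rw [setIntegral_indicator (G.2.inter G'.2)]
      simp
    rw [h2, ← h3]
    refine integral_congr_ae (ae_restrict_of_ae ?_)
    filter_upwards [indicatorConstLp_coeFn (p := 2) (hs := G.2) (hμs := measure_ne_top ν G)
      (c := (1 : ℂ)), indicatorConstLp_coeFn (p := 2) (hs := G'.2) (hμs := measure_ne_top ν G')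
      (c := (1 : ℂ))] with x h4 h5
    rw [h4, h5]
    by_cases h6 : x ∈ (G : Set X) <;> by_cases h7 : x ∈ (G' : Set X) <;> simp [h6, h7]
  rw [hR]
  -- Agreement of the two forms on the total family `P(G)ξ` gives equality of operators.
  have h1 : P.toFun F = ContinuousLinearMap.adjoint R ∘L R := by
    refine ContinuousLinearMap.ext_on hu ?_
    rintro _ ⟨G', rfl⟩
    refine hu.eq_of_inner_right ℂ fun v hv => ?_
    induction hv using Submodule.span_induction with
    | mem v hv =>
      obtain ⟨G, rfl⟩ := hv
      rw [hRu, ContinuousLinearMap.comp_apply (ContinuousLinearMap.adjoint R),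
        ContinuousLinearMap.adjoint_inner_right]
    | zero => simp
    | add v v' _ _ hv hv' => rw [inner_add_left, inner_add_left, hv, hv']
    | smul c v _ hv => rw [inner_smul_left, inner_smul_left, hv]
  rw [h1, ContinuousLinearMap.comp_apply (ContinuousLinearMap.adjoint R), ContinuousLinearMap.adjoint_inner_right]

end SpectralMeasure

end SpectralMeasureLemmas

/-! ### Pure states -/

section PureState

variable {H : Type u} [NormedAddCommGroup H] [InnerProductSpace ℂ H] [CompleteSpace H]

/-- The pure state given by a unit vector. -/
noncomputable def pureState (φ : H) (hφ : ‖φ‖ = 1) : State H where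
  toTraceClass := TraceClass.rankOne φ φ
  isPositive := InnerProductSpace.isPositive_rankOne_self φ
  trace_eq_one := by simp [TraceClass.trace_rankOne, inner_self_eq_norm_sq_to_K, hφ]

theorem isPure_pureState (φ : H) (hφ : ‖φ‖ = 1) : (pureState φ hφ).IsPure := ⟨φ, hφ, rfl⟩

@[simp] theorem toTraceClass_pureState (φ : H) (hφ : ‖φ‖ = 1) :
    (pureState φ hφ).toTraceClass = TraceClass.rankOne φ φ := rfl

theorem TraceClass.rankOne_smul_self (c : ℂ) (φ : H) :
    rankOne (c • φ) (c • φ) = ((‖c‖ ^ 2 : ℝ) : ℂ) • rankOne φ φ := by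
  refine TraceClass.ext (ContinuousLinearMap.ext fun x => ?_)
  simp only [op_rankOne, InnerProductSpace.rankOne_apply, op_smul, _root_.smul_apply,
    inner_smul_left, smul_smul]
  congr 1
  rw [mul_right_comm, ← Complex.normSq_eq_norm_sq, ← Complex.mul_conj]
  ring

theorem State.IsPure.exists_eq {ρ : State H} (hρ : ρ.IsPure) :
    ∃ φ : H, ‖φ‖ = 1 ∧ ρ.toTraceClass = TraceClass.rankOne φ φ := by
  obtain ⟨φ, hφ, h⟩ := hρ
  exact ⟨φ, hφ, TraceClass.ext h⟩

end PureState

/-! ### Efficient instruments are irreducible -/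

section EfficientIrreducible

variable {X : Type v} [MeasurableSpace X]
variable {H : Type u} [NormedAddCommGroup H] [InnerProductSpace ℂ H] [CompleteSpace H]

namespace Instrument

instance (M : Instrument X H) (ρ : State H) : IsFiniteMeasure (M.outcomeMeasure ρ) :=
  ⟨by rw [M.outcomeMeasure_apply ρ MeasurableSet.univ]; exact ENNReal.ofReal_lt_top⟩

open Classical in
/-- If the outcome of an instrument in the state `ρ` is described by a vector-valued square
integrable function `f`, then the normalized values of `f` give posteriori states. -/
theorem exists_pure_posteriorFamily (M : Instrument X H) {ρ : State H} (hρ : ρ.IsPure)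
    {ν : Measure X} [IsFiniteMeasure ν] (f : Lp H 2 ν)
    (hf : ∀ F, MeasurableSet F → ∀ A : H →L[ℂ] H,
      (TraceClass.mulLeft A (M.toFun F ρ.toTraceClass)).trace =
        ∫ x in F, inner ℂ (f x) (A (f x)) ∂ν) :
    ∃ σ : X → State H, M.IsPosteriorFamily ρ σ ∧ ∀ᵐ x ∂(M.outcomeMeasure ρ), (σ x).IsPure := by
  have hfm : StronglyMeasurable f := Lp.stronglyMeasurable f
  have hf2 : MemLp f 2 ν := Lp.memLp f
  have hsq : Integrable (fun x => ‖f x‖ ^ 2) ν :=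
    (memLp_two_iff_integrable_sq_norm hfm.aestronglyMeasurable).1 hf2
  let g : X → TraceClass H := fun x => TraceClass.rankOne (f x) (f x)
  have hgm : StronglyMeasurable g :=
    TraceClass.continuous_rankOne.comp_stronglyMeasurable (hfm.prodMk hfm)
  have hgi : Integrable g ν := hsq.mono' hgm.aestronglyMeasurable (Filter.Eventually.of_forall
    fun x => (TraceClass.norm_rankOne_le _ _).trans (by rw [sq]))
  have hgF : ∀ F, MeasurableSet F → ∫ x in F, g x ∂ν = M.toFun F ρ.toTraceClass := by
    intro F hF
    refine TraceClass.ext_trace_mulLeft fun A => ?_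
    rw [hf F hF A]
    have h1 := (TraceClass.trace ∘L TraceClass.mulLeftL A).integral_comp_comm hgi.integrableOn
      (μ := ν.restrict F)
    refine h1.symm.trans (integral_congr_ae (Filter.Eventually.of_forall fun x => ?_))
    exact TraceClass.trace_mulLeft_rankOne A (f x) (f x)
  let d : X → NNReal := fun x => ‖f x‖₊ ^ 2
  have hd : Measurable d := (hfm.nnnorm.measurable).pow_const 2
  -- Taking traces in `M(F)[ρ] = ∫_F |f⟩⟨f| dν` shows that the outcome distribution has density
  -- `‖f‖²`.
  have hμ : M.outcomeMeasure ρ = ν.withDensity fun x => d x := by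
    ext F hF
    rw [M.outcomeMeasure_apply ρ hF, withDensity_apply _ hF, ← hgF F hF,
      ← TraceClass.trace.integral_comp_comm hgi.integrableOn]
    have h1 : ∀ x, (g x).trace = ((‖f x‖ ^ 2 : ℝ) : ℂ) := fun x => by
      rw [TraceClass.trace_rankOne, inner_self_eq_norm_sq_to_K]
      simp
    simp only [h1]
    rw [integral_complex_ofReal, Complex.ofReal_re, ofReal_integral_eq_lintegral_ofReal
      hsq.integrableOn (Filter.Eventually.of_forall fun x => by positivity)]
    refine lintegral_congr fun x => ?_
    rw [ENNReal.ofReal_pow (norm_nonneg _), ofReal_norm]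
    rfl
  have hn : ∀ x, f x ≠ 0 → ‖(‖f x‖ : ℂ)⁻¹ • f x‖ = 1 := fun x hx => norm_smul_inv_norm hx
  -- Zeros of `f` form a null set for the outcome distribution, so any state may be put there; the
  -- pure state `ρ` keeps the family pure everywhere.
  let σ : X → State H := fun x => if h : f x = 0 then ρ else pureState _ (hn x h)
  have hσ : ∀ x, (σ x).toTraceClass =
      if f x = 0 then ρ.toTraceClass else (((‖f x‖ ^ 2)⁻¹ : ℝ) : ℂ) • g x := by
    intro x
    by_cases h : f x = 0
    · simp [σ, h]
    · simp only [σ, h, dif_neg, not_false_eq_true, toTraceClass_pureState, if_false,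
        TraceClass.rankOne_smul_self]
      simp [g]
  have hset : MeasurableSet {x | f x = 0} := hfm.measurableSet_eq_fun stronglyMeasurable_const
  have hσm : StronglyMeasurable fun x => (σ x).toTraceClass := by
    simp only [hσ]
    refine StronglyMeasurable.ite hset stronglyMeasurable_const (StronglyMeasurable.fun_smul ?_ hgm)
    refine Complex.continuous_ofReal.comp_stronglyMeasurable ?_
    exact ((hfm.norm.measurable.pow_const 2).inv).stronglyMeasurable
  have hdσ : ∀ x, d x • (σ x).toTraceClass = g x := by
    intro x
    rw [hσ]
    by_cases h : f x = 0
    · have h1 : TraceClass.rankOne (0 : H) 0 = 0 := TraceClass.ext (by simp)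
      simp [d, g, h, h1]
    · rw [if_neg h]
      rw [NNReal.smul_def, ← Complex.coe_smul, smul_smul, ← Complex.ofReal_mul]
      have h1 : (d x : ℝ) * (‖f x‖ ^ 2)⁻¹ = 1 := by
        simp [d, h]
      rw [h1]
      simp
  have hpure : ∀ x, (σ x).IsPure := fun x => by
    by_cases h : f x = 0
    · simpa [σ, h] using hρ
    · simpa [σ, h] using isPure_pureState _ (hn x h)
  refine ⟨σ, ⟨fun A => ?_, ?_, fun F hF => ?_⟩, Filter.Eventually.of_forall hpure⟩
  · exact ((TraceClass.trace ∘L TraceClass.mulLeftL A).continuous.comp_stronglyMeasurable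
      hσm).measurable
  · refine Integrable.of_bound hσm.aestronglyMeasurable 1 (Filter.Eventually.of_forall fun x => ?_)
    rw [TraceClass.norm_eq_trace (σ x).isPositive, (σ x).trace_eq_one, Complex.one_re]
  · rw [hμ, setIntegral_withDensity_eq_setIntegral_smul hd _ hF, ← hgF F hF]
    simp only [hdσ]

/-- The square integrable function belonging to the a priori vector `φ` is `J (V φ)`. -/
theorem IsEfficient.isIrreducible {M : Instrument X H} (hM : M.IsEfficient) :
    M.IsIrreducible := by
  obtain ⟨K, _, _, _, V, P, ⟨ξ, hξ⟩, hV⟩ := hM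
  intro ρ hρ
  obtain ⟨φ, hφ, hρφ⟩ := hρ.exists_eq
  obtain ⟨S, hS⟩ := P.exists_isometry_of_dense hξ
  obtain ⟨J, hJ⟩ := exists_isometry_vectorL2 (H := H) S
  refine M.exists_pure_posteriorFamily hρ (J (V φ)) fun F hF A => ?_
  rw [← inner_opTensor_eq_setIntegral hJ (hS F hF) A, ← hV F hF A, hρφ,
    TraceClass.trace_mulLeft_rankOne]
  simp [ContinuousLinearMap.adjoint_inner_right]

end Instrument

end EfficientIrreducible

/-! ### Positive operator kernels with rank-one compressions -/

section BlockPositive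

variable {ι : Type u} {H : Type v} [NormedAddCommGroup H] [InnerProductSpace ℂ H]

/-- Positivity of an operator-valued kernel. -/
def IsPositiveKernel (T : ι → ι → H →L[ℂ] H) : Prop :=
  ∀ (n : ℕ) (f : Fin n → ι) (v : Fin n → H), 0 ≤ ∑ a, ∑ b, inner ℂ (v a) (T (f a) (f b) (v b))

theorem IsPositiveKernel.sum_nonneg {T : ι → ι → H →L[ℂ] H} (hT : IsPositiveKernel T)
    {κ : Type*} [Fintype κ] (f : κ → ι) (v : κ → H) :
    0 ≤ ∑ a, ∑ b, inner ℂ (v a) (T (f a) (f b) (v b)) := by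
  let e := (Fintype.equivFin κ).symm
  have h := hT _ (f ∘ e) (v ∘ e)
  simp only [Function.comp_apply] at h
  rw [e.sum_comp fun a => ∑ b, inner ℂ (v a) (T (f a) (f (e b)) (v (e b)))] at h
  convert h using 2 with a
  exact (e.sum_comp fun b => inner ℂ (v a) (T (f a) (f b) (v b))).symm

/-- Positivity over `ℂ` makes the two-point sums real. Imaginary parts for `y` and for `I • y` give
the two components of the Hermitian symmetry. -/
theorem IsPositiveKernel.inner_conj {T : ι → ι → H →L[ℂ] H} (hT : IsPositiveKernel T)
    (i j : ι) (x y : H) : inner ℂ x (T i j y) = inner ℂ (T j i x) y := by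
  have h1 : ∀ i x, (inner ℂ x (T i i x) : ℂ).im = 0 := fun i x => by
    have h := hT 1 (fun _ => i) (fun _ => x)
    simpa using ((Complex.nonneg_iff.1 h).2).symm
  have h2 : ∀ x y, (inner ℂ x (T i j y) + inner ℂ y (T j i x) : ℂ).im = 0 := fun x y => by
    have h := hT 2 ![i, j] ![x, y]
    simp only [Fin.sum_univ_two, Matrix.cons_val_zero, Matrix.cons_val_one] at h
    have h3 := (Complex.nonneg_iff.1 h).2
    simp only [Complex.add_im, h1] at h3 ⊢
    linarith
  have h3 := h2 x y
  have h4 := h2 x (Complex.I • y)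
  rw [← inner_conj_symm (T j i x) y]
  simp only [map_smul, inner_smul_left, inner_smul_right, Complex.add_im, Complex.mul_im,
    Complex.I_re, Complex.I_im, Complex.conj_I, Complex.neg_re, Complex.neg_im] at h3 h4
  refine Complex.ext ?_ ?_
  · rw [Complex.conj_re]
    linarith
  · rw [Complex.conj_im]
    linarith

/-- The span of `u` and `v` is two-dimensional, so it meets the orthogonal complement of `w` in a
nonzero vector, and a nonzero vector of the span cannot be orthogonal to both generators. -/
theorem exists_mem_span_pair_inner_eq_zero (u v w : H)
    (h : ¬ ∃ c : ℂ, v = c • u) (hu : u ≠ 0) :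
    ∃ x : H, inner ℂ w x = 0 ∧ ((inner ℂ u x : ℂ) ≠ 0 ∨ (inner ℂ v x : ℂ) ≠ 0) := by
  obtain ⟨x, hw, hx, hx0⟩ : ∃ x : H, inner ℂ w x = 0 ∧ (∃ a b : ℂ, x = a • u + b • v) ∧ x ≠ 0 := by
    by_cases hwv : (inner ℂ w v : ℂ) = 0
    · by_cases hwu : (inner ℂ w u : ℂ) = 0
      · exact ⟨u, hwu, ⟨1, 0, by simp⟩, hu⟩
      · refine ⟨v, hwv, ⟨0, 1, by simp⟩, fun hv => h ⟨0, by simp [hv]⟩⟩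
    · refine ⟨(inner ℂ w v : ℂ) • u + (-inner ℂ w u : ℂ) • v, ?_, ⟨_, _, rfl⟩, fun h0 => ?_⟩
      · rw [inner_add_right, inner_smul_right, inner_smul_right]
        ring
      · by_cases hwu : (inner ℂ w u : ℂ) = 0
        · rw [hwu] at h0
          simp [hwv, hu] at h0
        · refine h ⟨(inner ℂ w u : ℂ)⁻¹ * inner ℂ w v, ?_⟩
          rw [neg_smul, ← sub_eq_add_neg, sub_eq_zero] at h0
          rw [mul_smul, h0, inv_smul_smul₀ hwu]
  refine ⟨x, hw, ?_⟩
  by_contra! h0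
  obtain ⟨a, b, hab⟩ := hx
  refine hx0 (inner_self_eq_zero (𝕜 := ℂ).1 ?_)
  nth_rewrite 1 [hab]
  rw [inner_add_left, inner_smul_left, inner_smul_left, h0.1, h0.2]
  simp

variable [CompleteSpace H]

/-- Kolmogorov factorization: the feature space is the reproducing kernel Hilbert space of `T`, and
`G i` is the kernel function at `i`. -/
theorem IsPositiveKernel.exists_gram {T : ι → ι → H →L[ℂ] H} (hT : IsPositiveKernel T) :
    ∃ (E : Type (max u v)) (_ : NormedAddCommGroup E) (_ : InnerProductSpace ℂ E) (G : ι → H →L[ℂ] E),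
      ∀ i j x y, inner ℂ (G i x) (G j y) = inner ℂ x (T i j y) := by
  let K : Matrix ι ι (H →L[ℂ] H) := Matrix.of T
  have hK : K.PosSemidef := by
    have htfae := (RKHS.posSemidef_tfae (K := K)).out 0 2
    refine htfae.2 ⟨Matrix.IsHermitian.ext fun i j => ?_, fun f => ?_⟩
    · refine ContinuousLinearMap.ext fun x => ext_inner_right ℂ fun y => ?_
      change inner ℂ (ContinuousLinearMap.adjoint (T j i) x) y = inner ℂ (T i j x) y
      rw [ContinuousLinearMap.adjoint_inner_left, hT.inner_conj]
    · have h := hT.sum_nonneg (κ := f.support) (fun i => i) (fun i => f i)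
      rw [Finset.sum_coe_sort f.support fun i => ∑ j : f.support, inner ℂ (f i) (T i j (f j))] at h
      have h2 : ∀ i, ∑ j : f.support, inner ℂ (T j i (f i)) (f j) =
          ∑ j ∈ f.support, inner ℂ (T j i (f i)) (f j) := fun i =>
        Finset.sum_coe_sort f.support fun j => inner ℂ (T j i (f i)) (f j)
      simp only [hT.inner_conj] at h
      simp only [h2] at h
      exact (Complex.nonneg_iff.1 h).1
  have : Fact K.PosSemidef := ⟨hK⟩
  refine ⟨RKHS.OfKernel K, inferInstance, inferInstance, RKHS.kerFun (RKHS.OfKernel K),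
    fun i j x y => ?_⟩
  rw [← ContinuousLinearMap.adjoint_inner_right, ← ContinuousLinearMap.comp_apply,
    ← RKHS.kernel_apply, RKHS.OfKernel.kernel_ofKernel]
  rfl

/-- A positive kernel whose diagonal blocks and whose compressions `T i i + T i j + T j i + T j j`
have rank at most one either is of the form `|v i⟩⟨v j|` or is a multiple of a fixed projector. -/
theorem IsPositiveKernel.dichotomy {T : ι → ι → H →L[ℂ] H} (hT : IsPositiveKernel T)
    (h1 : ∀ i, ∃ u, T i i = InnerProductSpace.rankOne ℂ u u)
    (h2 : ∀ i j, ∃ u, T i i + T i j + T j i + T j j = InnerProductSpace.rankOne ℂ u u) :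
    (∃ v : ι → H, ∀ i j, T i j = InnerProductSpace.rankOne ℂ (v i) (v j)) ∨
      ∃ (ψ : H) (s : ι → ι → ℂ), ∀ i j, T i j = s i j • InnerProductSpace.rankOne ℂ ψ ψ := by
  obtain ⟨E, _, _, G, hG⟩ := hT.exists_gram
  choose u hu using h1
  have hdiag : ∀ i x, ‖G i x‖ ^ 2 = ‖(inner ℂ (u i) x : ℂ)‖ ^ 2 := by
    intro i x
    have h := hG i i x x
    rw [hu, InnerProductSpace.rankOne_apply, inner_smul_right, ← inner_conj_symm x,
      Complex.mul_conj, Complex.normSq_eq_norm_sq, inner_self_eq_norm_sq_to_K] at h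
    have h' := congrArg Complex.re h
    simpa [← Complex.ofReal_pow] using h'
  -- As `‖G i x‖ = |⟨u i, x⟩|`, the operator `G i` kills the complement of `u i`, so it has the form
  -- `g ⟨u i, ·⟩`. Consequently `T i j = ⟨g i, g j⟩ |u i⟩⟨u j|`.
  have hg : ∀ i, ∃ g : E, (u i ≠ 0 → g ≠ 0) ∧ ∀ x, G i x = (inner ℂ (u i) x : ℂ) • g := by
    intro i
    rcases eq_or_ne (u i) 0 with h | h
    · refine ⟨0, by simp [h], fun x => ?_⟩
      have h3 := hdiag i x
      simpa [h] using h3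
    · have h0 : (inner ℂ (u i) (u i) : ℂ) ≠ 0 := inner_self_ne_zero.2 h
      refine ⟨(inner ℂ (u i) (u i) : ℂ)⁻¹ • G i (u i), fun _ h3 => ?_, fun x => ?_⟩
      · have h4 := hdiag i (u i)
        rw [(smul_eq_zero_iff_right (inv_ne_zero h0)).1 h3] at h4
        simp only [norm_zero, ne_eq, OfNat.ofNat_ne_zero, not_false_eq_true, zero_pow] at h4
        exact pow_ne_zero 2 (norm_ne_zero_iff.2 h0) h4.symm
      · have h3 := hdiag i (x - ((inner ℂ (u i) x : ℂ) * (inner ℂ (u i) (u i) : ℂ)⁻¹) • u i)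
        rw [inner_sub_right, inner_smul_right, mul_assoc, inv_mul_cancel₀ h0] at h3
        simp only [mul_one, sub_self, norm_zero, ne_eq, OfNat.ofNat_ne_zero, not_false_eq_true,
          zero_pow, pow_eq_zero_iff, norm_eq_zero, map_sub, map_smul] at h3
        rw [smul_smul, sub_eq_zero.1 h3]
  choose g hg0 hg using hg
  have hTg : ∀ i j x y, inner ℂ x (T i j y) =
      inner ℂ x (u i) * inner ℂ (u j) y * inner ℂ (g i) (g j) := by
    intro i j x y
    rw [← hG, hg, hg, inner_smul_left, inner_smul_right, inner_conj_symm, mul_assoc]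
  -- The sum in `h2` is `(G i + G j)* (G i + G j)`, so `G i + G j` vanishes on the complement of
  -- `w`. A vector `x` there not orthogonal to both `u i` and `u j` gives the relation `⟨u i, x⟩ g i
  -- + ⟨u j, x⟩ g j = 0`.
  have hind : ∀ i j, u i ≠ 0 → (¬ ∃ c : ℂ, u j = c • u i) → ∃ c : ℂ, g j = c • g i := by
    intro i j hi hij
    obtain ⟨w, hw⟩ := h2 i j
    obtain ⟨x, hx, hne⟩ := exists_mem_span_pair_inner_eq_zero (u i) (u j) w hij hi
    have h3 : G i x + G j x = 0 := by
      rw [← inner_self_eq_zero (𝕜 := ℂ)]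
      have h4 := congrArg (fun R : H →L[ℂ] H => inner ℂ x (R x)) hw
      simp only [_root_.add_apply, inner_add_right, InnerProductSpace.rankOne_apply, hx,
        zero_smul, inner_zero_right, ← hG] at h4
      rw [inner_add_left, inner_add_right, inner_add_right, ← add_assoc]
      exact h4
    rw [hg, hg] at h3
    have hj : (inner ℂ (u j) x : ℂ) ≠ 0 := by
      intro h0
      rw [h0, zero_smul, add_zero, smul_eq_zero] at h3
      rcases hne with h | h
      · exact h (h3.resolve_right (hg0 i hi))
      · exact h h0
    refine ⟨-((inner ℂ (u j) x : ℂ)⁻¹ * inner ℂ (u i) x), ?_⟩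
    rw [neg_smul, mul_smul, eq_neg_of_add_eq_zero_left h3, smul_neg, neg_neg, inv_smul_smul₀ hj]
  by_cases hex : ∃ p q, u p ≠ 0 ∧ ¬ ∃ c : ℂ, u q = c • u p
  · left
    obtain ⟨p, q, hp, hpq⟩ := hex
    obtain ⟨d, hd⟩ := hind p q hp hpq
    have hq : u q ≠ 0 := fun h => hpq ⟨0, by simp [h]⟩
    -- A nonzero `u j` cannot be parallel to both of the independent vectors `u p` and `u q`.
    -- Comparison with one of them makes `g j` a multiple of `g p`, directly or through `g q`.
    have hall : ∀ j, ∃ c : ℂ, G j = (c : ℂ) • (innerSL ℂ (u j)).smulRight (g p) := by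
      intro j
      have hGj : G j = (innerSL ℂ (u j)).smulRight (g j) := by
        ext x
        simp [hg]
      by_cases h3 : ∃ c : ℂ, u j = c • u p
      · obtain ⟨c, hc⟩ := h3
        by_cases h4 : ∃ c' : ℂ, u j = c' • u q
        · obtain ⟨c', hc'⟩ := h4
          have hj : u j = 0 := by
            by_contra hj
            have h5 : c' ≠ 0 := by
              rintro rfl
              simp [hj] at hc'
            refine hpq ⟨c'⁻¹ * c, ?_⟩
            rw [mul_smul, ← hc, hc', inv_smul_smul₀ h5]
          exact ⟨0, by rw [hGj, hj]; ext x; simp⟩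
        · obtain ⟨c', hc'⟩ := hind q j hq h4
          refine ⟨c' * d, ?_⟩
          rw [hGj, hc', hd]
          ext x
          simp [smul_smul, mul_comm]
      · obtain ⟨c, hc⟩ := hind p j hp h3
        refine ⟨c, ?_⟩
        rw [hGj, hc]
        ext x
        simp [smul_smul, mul_comm]
    choose c hc using hall
    -- From `G j = c j ⟨u j, ·⟩ g p`, the common factor `‖g p‖²` is shared between the two sides;
    -- the conjugate appears because `v j` enters the bra conjugate-linearly.
    refine ⟨fun j => ((starRingEnd ℂ (c j)) * (‖g p‖ : ℂ)) • u j, fun i j => ?_⟩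
    refine ContinuousLinearMap.ext fun y => ext_inner_left ℂ fun x => ?_
    rw [← hG, hc, hc]
    simp only [_root_.smul_apply, ContinuousLinearMap.smulRight_apply, innerSL_apply_apply,
      inner_smul_left, inner_smul_right, inner_self_eq_norm_sq_to_K,
      InnerProductSpace.rankOne_apply, inner_conj_symm, map_mul, Complex.conj_conj,
      Complex.conj_ofReal]
    ring_nf
    simp
  · right
    push Not at hex
    by_cases hz : ∀ i, u i = 0
    · refine ⟨0, fun _ _ => 0, fun i j => ?_⟩
      refine ContinuousLinearMap.ext fun y => ext_inner_left ℂ fun x => ?_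
      rw [hTg, hz i]
      simp
    · push Not at hz
      obtain ⟨p, hp⟩ := hz
      choose c hc using fun q => hex p q hp
      refine ⟨u p, fun i j => c i * starRingEnd ℂ (c j) * inner ℂ (g i) (g j), fun i j => ?_⟩
      refine ContinuousLinearMap.ext fun y => ext_inner_left ℂ fun x => ?_
      rw [hTg, hc i, hc j]
      simp only [_root_.smul_apply, inner_smul_left, inner_smul_right,
        InnerProductSpace.rankOne_apply]
      ring

end BlockPositive

theorem polarization_identity {E F : Type*} [AddCommGroup E] [Module ℂ E] [AddCommGroup F]
    [Module ℂ F] (β : E →ₗ[ℂ] E →ₗ⋆[ℂ] F) (x y : E) :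
    β x y = (1 / 4 : ℂ) • ∑ k : Fin 4, Complex.I ^ (k : ℕ) •
      β (x + Complex.I ^ (k : ℕ) • y) (x + Complex.I ^ (k : ℕ) • y) := by
  have h1 : Complex.I ^ 3 = -Complex.I := by rw [pow_succ, Complex.I_sq]; ring
  have h2 : ((3 : Fin 4) : ℕ) = 3 := rfl
  simp only [Fin.sum_univ_four, Fin.val_zero, Fin.val_one, Fin.val_two, h2, pow_zero, pow_one,
    one_smul, Complex.I_sq, h1, map_add, LinearMap.add_apply, map_smul, map_smulₛₗ,
    LinearMap.smul_apply, smul_add, smul_smul, Complex.conj_I, map_neg, map_one]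
  match_scalars <;> ring_nf <;> simp
  norm_num

/-! ### Operator densities of an irreducible instrument -/

section Densities

variable {X : Type v} [MeasurableSpace X]
variable {H : Type u} [NormedAddCommGroup H] [InnerProductSpace ℂ H] [CompleteSpace H]

theorem TraceClass.exists_rankOne_real_smul {r : ℝ} (hr : 0 ≤ r) (u : H) :
    ∃ w : H, r • rankOne u u = rankOne w w := by
  refine ⟨((√r : ℝ) : ℂ) • u, ?_⟩
  rw [rankOne_smul_self, ← Complex.coe_smul, Complex.norm_real, Real.norm_eq_abs, sq_abs,
    Real.sq_sqrt hr]

theorem TraceClass.rankOne_eq_smul_normalize (φ : H) :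
    rankOne φ φ = (‖φ‖ ^ 2 : ℝ) • rankOne ((‖φ‖ : ℂ)⁻¹ • φ) ((‖φ‖ : ℂ)⁻¹ • φ) := by
  rcases eq_or_ne φ 0 with rfl | h
  · exact TraceClass.ext (by simp)
  · rw [rankOne_smul_self, ← Complex.coe_smul, smul_smul, ← Complex.ofReal_mul]
    have h1 : ‖φ‖ ^ 2 * ‖(‖φ‖ : ℂ)⁻¹‖ ^ 2 = 1 := by
      rw [norm_inv, Complex.norm_real, norm_norm, ← mul_pow, mul_inv_cancel₀ (norm_ne_zero_iff.2 h),
        one_pow]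
    rw [h1]
    simp

/-- The blocks `|e i⟩⟨e j|` form the operator `|e⟩⟨e|` on a direct sum: its quadratic form is the
squared modulus of `∑ ⟨e i, w i⟩`. -/
theorem IsCompletelyPositive.isPositiveKernel {Φ : TraceClass H →L[ℂ] TraceClass H}
    (hΦ : IsCompletelyPositive Φ) {ι : Type*} (e : ι → H) :
    IsPositiveKernel fun i j => (Φ (TraceClass.rankOne (e i) (e j))).op := by
  intro n f v
  refine hΦ n (fun a b => TraceClass.rankOne (e (f a)) (e (f b))) (fun w => ?_) v
  have h2 : ∀ a b, inner ℂ (w a) ((TraceClass.rankOne (e (f a)) (e (f b))).op (w b)) =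
      (starRingEnd ℂ (inner ℂ (e (f a)) (w a))) * inner ℂ (e (f b)) (w b) := fun a b => by
    rw [TraceClass.op_rankOne, InnerProductSpace.rankOne_apply, inner_smul_right,
      inner_conj_symm, mul_comm]
  simp only [h2]
  rw [← Finset.sum_mul_sum, ← map_sum, mul_comm, Complex.mul_conj]
  exact_mod_cast Complex.normSq_nonneg _

namespace Instrument

theorem outcomeMeasure_eq_zero_iff (M : Instrument X H) (ρ : State H) {F : Set X}
    (hF : MeasurableSet F) : M.outcomeMeasure ρ F = 0 ↔ M.toFun F ρ.toTraceClass = 0 := by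
  rw [M.outcomeMeasure_apply ρ hF, ← TraceClass.norm_eq_trace (M.isPositive_apply hF ρ.isPositive),
    ENNReal.ofReal_eq_zero]
  exact norm_le_zero_iff

theorem map_real_smul (M : Instrument X H) (F : Set X) (r : ℝ) (T : TraceClass H) :
    M.toFun F (r • T) = r • M.toFun F T := by
  rw [← Complex.coe_smul, map_smul, Complex.coe_smul]

/-- For `φ ≠ 0` with normalization `ρ`, the density is `‖φ‖² (dμ_ρ/dν) ρ_x`, a nonnegative multiple
of a pure posteriori state. Where the derivative vanishes purity may fail, but there the density is
zero. -/
theorem exists_density {M : Instrument X H} (hM : M.IsIrreducible) {ν : Measure X}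
    [IsFiniteMeasure ν] (φ : H)
    (hν : ∀ F, MeasurableSet F → ν F = 0 → M.toFun F (TraceClass.rankOne φ φ) = 0) :
    ∃ T : X → TraceClass H, Integrable T ν ∧ (∀ᵐ x ∂ν, ∃ u, T x = TraceClass.rankOne u u) ∧
      ∀ F, MeasurableSet F → ∫ x in F, T x ∂ν = M.toFun F (TraceClass.rankOne φ φ) := by
  rcases eq_or_ne φ 0 with rfl | h
  · have h0 : TraceClass.rankOne (0 : H) 0 = 0 := TraceClass.ext (by simp)
    exact ⟨0, integrable_zero _ _ _, Filter.Eventually.of_forall fun x => ⟨0, by simp [h0]⟩,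
      fun F _ => by simp [h0]⟩
  let ρ := pureState ((‖φ‖ : ℂ)⁻¹ • φ) (norm_smul_inv_norm h)
  have hφ : TraceClass.rankOne φ φ = (‖φ‖ ^ 2 : ℝ) • ρ.toTraceClass :=
    TraceClass.rankOne_eq_smul_normalize φ
  obtain ⟨σ, hσ, hp⟩ := hM ρ (isPure_pureState _ _)
  set μ := M.outcomeMeasure ρ
  have hμν : μ ≪ ν := Measure.AbsolutelyContinuous.mk fun F hF h0 => by
    refine (M.outcomeMeasure_eq_zero_iff ρ hF).2 ?_
    have h1 := hν F hF h0
    rw [hφ, map_real_smul] at h1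
    exact (smul_eq_zero_iff_right (by positivity)).1 h1
  refine ⟨fun x => (‖φ‖ ^ 2 : ℝ) • ((μ.rnDeriv ν x).toReal • (σ x).toTraceClass), ?_, ?_,
    fun F hF => ?_⟩
  · exact ((integrable_rnDeriv_smul_iff hμν).2 hσ.integrable).smul _
  · rw [← Measure.withDensity_rnDeriv_eq μ ν hμν,
      ae_withDensity_iff (Measure.measurable_rnDeriv μ ν)] at hp
    filter_upwards [hp] with x hx
    by_cases h0 : μ.rnDeriv ν x = 0
    · exact ⟨0, TraceClass.ext (by simp [h0])⟩
    · obtain ⟨u, -, hu⟩ := (hx h0).exists_eq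
      rw [hu, smul_smul]
      exact TraceClass.exists_rankOne_real_smul (by positivity) u
  · rw [integral_smul, setIntegral_rnDeriv_smul hμν hF, hσ.setIntegral_eq F hF, hφ, map_real_smul]

/-- A finite measure with the null sets of the sum of the countably many outcome measures. The last
clause, `M(F) = 0` implies `ν(F) = 0`, later converts a vanishing value of the instrument into a
null set. -/
theorem exists_dominating_measure (M : Instrument X H) {κ : Type*} [Countable κ] (φ : κ → H) :
    ∃ ν : Measure X, IsFiniteMeasure ν ∧
      (∀ q F, MeasurableSet F → ν F = 0 → M.toFun F (TraceClass.rankOne (φ q) (φ q)) = 0) ∧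
      ∀ F, MeasurableSet F → M.toFun F = 0 → ν F = 0 := by
  classical
  let μ : κ → Measure X := fun q => if h : φ q = 0 then 0 else
    M.outcomeMeasure (pureState ((‖φ q‖ : ℂ)⁻¹ • φ q) (norm_smul_inv_norm h))
  have hμ : ∀ q, IsFiniteMeasure (μ q) := fun q => by
    by_cases h : φ q = 0
    · simp only [μ, h, dif_pos]
      infer_instance
    · simp only [μ, h, dif_neg, not_false_eq_true]
      infer_instance
  have hν : ∀ F, MeasurableSet F → ((Measure.sum μ).toFinite F = 0 ↔ ∀ q, μ q F = 0) := by
    intro F hF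
    rw [toFinite_apply_eq_zero_iff, Measure.sum_apply_eq_zero]
  refine ⟨(Measure.sum μ).toFinite, inferInstance, fun q F hF h0 => ?_, fun F hF h0 => ?_⟩
  · by_cases h : φ q = 0
    · rw [h, TraceClass.rankOne_eq_smul_normalize]
      simp
    · have h1 := (hν F hF).1 h0 q
      simp only [μ, h, dif_neg, not_false_eq_true] at h1
      rw [M.outcomeMeasure_eq_zero_iff _ hF, toTraceClass_pureState] at h1
      rw [TraceClass.rankOne_eq_smul_normalize, map_real_smul, h1, smul_zero]
  · refine (hν F hF).2 fun q => ?_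
    by_cases h : φ q = 0
    · simp [μ, h]
    · simp only [μ, h, dif_neg, not_false_eq_true]
      rw [M.outcomeMeasure_eq_zero_iff _ hF, h0]
      rfl

theorem exists_matrix_densities {M : Instrument X H} (hM : M.IsIrreducible) {ι : Type*}
    [Countable ι] (e : ι → H) :
    ∃ (ν : Measure X) (T : ι → ι → X → TraceClass H), IsFiniteMeasure ν ∧
      (∀ F, MeasurableSet F → M.toFun F = 0 → ν F = 0) ∧
      (∀ i j, StronglyMeasurable (T i j)) ∧ (∀ i j, Integrable (T i j) ν) ∧
      (∀ i j F, MeasurableSet F →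
        ∫ x in F, T i j x ∂ν = M.toFun F (TraceClass.rankOne (e i) (e j))) ∧
      (∀ i, ∀ᵐ x ∂ν, ∃ u, T i i x = TraceClass.rankOne u u) ∧
      ∀ i j, ∀ᵐ x ∂ν, ∃ u, T i i x + T i j x + T j i x + T j j x = TraceClass.rankOne u u := by
  -- The vectors needed for polarization; the ones with `k = 0` are `e i + e j`, whose densities
  -- give the last rank condition.
  let φ : ι ⊕ (ι × ι × Fin 4) → H :=
    Sum.elim e fun p => e p.1 + Complex.I ^ (p.2.2 : ℕ) • e p.2.1
  obtain ⟨ν, hfin, hν, hνM⟩ := M.exists_dominating_measure φ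
  choose D hDi hDr hDF using fun q => exists_density hM (φ q) (hν q)
  let T₀ : ι → ι → X → TraceClass H := fun i j x =>
    (1 / 4 : ℂ) • ∑ k : Fin 4, Complex.I ^ (k : ℕ) • D (Sum.inr (i, j, k)) x
  have hT₀i : ∀ i j, Integrable (T₀ i j) ν := fun i j =>
    (integrable_finsetSum _ fun k _ => (hDi (Sum.inr (i, j, k))).smul (Complex.I ^ (k : ℕ))).smul
      (1 / 4 : ℂ)
  have hT₀F : ∀ i j F, MeasurableSet F →
      ∫ x in F, T₀ i j x ∂ν = M.toFun F (TraceClass.rankOne (e i) (e j)) := by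
    intro i j F hF
    have h1 := polarization_identity (ContinuousLinearMap.coeLMₛₗ (starRingEnd ℂ) ∘ₗ
      (TraceClass.rankOneL H).toLinearMap) (e i) (e j)
    change TraceClass.rankOne (e i) (e j) = (1 / 4 : ℂ) • ∑ k : Fin 4, Complex.I ^ (k : ℕ) •
      TraceClass.rankOne (φ (Sum.inr (i, j, k))) (φ (Sum.inr (i, j, k))) at h1
    have h2 : ∀ k : Fin 4, Integrable (fun x => Complex.I ^ (k : ℕ) • D (Sum.inr (i, j, k)) x)
        (ν.restrict F) := fun k =>
      ((hDi (Sum.inr (i, j, k))).smul (Complex.I ^ (k : ℕ))).integrableOn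
    rw [h1, map_smul, map_sum, integral_smul, integral_finsetSum _ fun k _ => h2 k]
    congr 1
    refine Finset.sum_congr rfl fun k _ => ?_
    rw [integral_smul, map_smul, hDF _ F hF]
  have hae : ∀ {f g : X → TraceClass H}, Integrable f ν → Integrable g ν →
      (∀ F, MeasurableSet F → ∫ x in F, f x ∂ν = ∫ x in F, g x ∂ν) → f =ᵐ[ν] g :=
    fun hf hg h => Integrable.ae_eq_of_forall_setIntegral_eq _ _ hf hg fun F hF _ => h F hF
  -- Strongly measurable versions, so that sets defined by the values of `T` are measurable.
  let T : ι → ι → X → TraceClass H := fun i j => (hT₀i i j).1.mk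
  have hT : ∀ i j, T₀ i j =ᵐ[ν] T i j := fun i j => (hT₀i i j).1.ae_eq_mk
  have hTi : ∀ i j, Integrable (T i j) ν := fun i j => (hT₀i i j).congr (hT i j)
  have hTF : ∀ i j F, MeasurableSet F →
      ∫ x in F, T i j x ∂ν = M.toFun F (TraceClass.rankOne (e i) (e j)) := fun i j F hF => by
    rw [← hT₀F i j F hF]
    exact integral_congr_ae (ae_restrict_of_ae (hT i j).symm)
  refine ⟨ν, T, hfin, hνM, fun i j => (hT₀i i j).1.stronglyMeasurable_mk, hTi, hTF, fun i => ?_,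
    fun i j => ?_⟩
  · filter_upwards [hDr (Sum.inl i), hae (hTi i i) (hDi (Sum.inl i)) fun F hF => by
      rw [hTF i i F hF, hDF _ F hF]; rfl] with x hx h
    rwa [h]
  · filter_upwards [hDr (Sum.inr (i, j, 0)), hae ((((hTi i i).add (hTi i j)).add (hTi j i)).add
      (hTi j j)) (hDi (Sum.inr (i, j, 0))) fun F hF => by
        rw [integral_add' (((hTi i i).add (hTi i j)).add (hTi j i)).integrableOn
          (hTi j j).integrableOn, integral_add' ((hTi i i).add (hTi i j)).integrableOn
          (hTi j i).integrableOn, integral_add' (hTi i i).integrableOn (hTi i j).integrableOn,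
          hTF i i F hF, hTF i j F hF, hTF j i F hF, hTF j j F hF, hDF _ F hF, ← map_add, ← map_add,
          ← map_add]
        congr 1
        refine TraceClass.ext ?_
        simp [φ]
        abel] with x hx h
    rw [← h] at hx
    exact hx

/-- For fixed vectors the quadratic expression has nonnegative integral over every `F`, so it is
nonnegative almost everywhere. Countability of `ι` and a countable dense set of vector tuples give
one null set; continuity handles the remaining vectors. -/
theorem ae_isPositiveKernel [TopologicalSpace.SeparableSpace H] (M : Instrument X H) {ι : Type*}
    [Countable ι] (e : ι → H) {ν : Measure X} {T : ι → ι → X → TraceClass H}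
    (hTi : ∀ i j, Integrable (T i j) ν)
    (hTF : ∀ i j F, MeasurableSet F →
        ∫ x in F, T i j x ∂ν = M.toFun F (TraceClass.rankOne (e i) (e j))) :
    ∀ᵐ x ∂ν, IsPositiveKernel fun i j => (T i j x).op := by
  refine ae_all_iff.2 fun n => ae_all_iff.2 fun f => ?_
  let h : (Fin n → H) → X → ℂ := fun v x =>
    ∑ a, ∑ b, TraceClass.matrixElt (v a) (v b) (T (f a) (f b) x)
  have hi : ∀ v, Integrable (h v) ν := fun v => integrable_finsetSum _ fun a _ =>
    integrable_finsetSum _ fun b _ => (TraceClass.matrixElt (v a) (v b)).integrable_comp (hTi _ _)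
  have hint : ∀ v F, MeasurableSet F → 0 ≤ ∫ x in F, h v x ∂ν := by
    intro v F hF
    have h1 := (M.isQuantumOperation F hF).completelyPositive.isPositiveKernel e n f v
    convert h1 using 1
    rw [integral_finsetSum _ fun a _ => integrable_finsetSum _ fun b _ =>
      ((TraceClass.matrixElt (v a) (v b)).integrable_comp (hTi (f a) (f b))).integrableOn]
    refine Finset.sum_congr rfl fun a _ => ?_
    rw [integral_finsetSum _ fun b _ =>
      ((TraceClass.matrixElt (v a) (v b)).integrable_comp (hTi (f a) (f b))).integrableOn]
    refine Finset.sum_congr rfl fun b _ => ?_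
    rw [ContinuousLinearMap.integral_comp_comm _ (hTi (f a) (f b)).integrableOn,
      hTF _ _ F hF, TraceClass.matrixElt_apply]
  have hpos : ∀ v, ∀ᵐ x ∂ν, 0 ≤ h v x := by
    intro v
    have hre : 0 ≤ᵐ[ν] fun x => RCLike.re (h v x) :=
      ae_nonneg_of_forall_setIntegral_nonneg (hi v).re fun F hF _ => by
        rw [integral_re (hi v).integrableOn]
        exact (Complex.nonneg_iff.1 (hint v F hF)).1
    have him : (fun x => RCLike.im (h v x)) =ᵐ[ν] fun _ => (0 : ℝ) :=
      Integrable.ae_eq_of_forall_setIntegral_eq _ _ (hi v).im (integrable_zero _ _ _)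
        fun F hF _ => by
          rw [integral_im (hi v).integrableOn, integral_zero]
          exact (Complex.nonneg_iff.1 (hint v F hF)).2.symm
    filter_upwards [hre, him] with x h1 h2
    exact Complex.nonneg_iff.2 ⟨h1, h2.symm⟩
  obtain ⟨D, hDc, hDd⟩ := TopologicalSpace.exists_countable_dense (Fin n → H)
  have hD : ∀ᵐ x ∂ν, ∀ v ∈ D, 0 ≤ h v x := (ae_ball_iff hDc).2 fun v _ => hpos v
  filter_upwards [hD] with x hx v
  have hcl : IsClosed {v : Fin n → H | 0 ≤ h v x} := by
    refine isClosed_le continuous_const ?_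
    simp only [h, TraceClass.matrixElt_apply]
    fun_prop
  exact hcl.closure_subset_iff.2 hx (hDd v)

end Instrument

end Densities

/-- For `‖e x‖ = ‖e y‖ = 1` each of the four polarization terms is at most `2² C`, and the average
of four such terms gives `4 C`. Injectivity of `e` covers the case where normalization is
impossible. -/
theorem norm_sesquilinear_le_of_quadratic {V F E : Type*} [AddCommGroup V] [Module ℂ V]
    [NormedAddCommGroup F] [NormedSpace ℂ F] [NormedAddCommGroup E] [NormedSpace ℂ E]
    {e : V →ₗ[ℂ] F} (he : ∀ y, e y = 0 → y = 0) {β : V →ₗ[ℂ] V →ₗ⋆[ℂ] E} {C : ℝ} (hC : 0 ≤ C)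
    (hβ : ∀ y, ‖β y y‖ ≤ C * ‖e y‖ ^ 2) (x y : V) : ‖β x y‖ ≤ 4 * C * ‖e x‖ * ‖e y‖ := by
  have hunit : ∀ x y, ‖e x‖ = 1 → ‖e y‖ = 1 → ‖β x y‖ ≤ 4 * C := by
    intro x y hx hy
    rw [polarization_identity, norm_smul]
    have h1 : ∀ k : Fin 4, ‖Complex.I ^ (k : ℕ) •
        β (x + Complex.I ^ (k : ℕ) • y) (x + Complex.I ^ (k : ℕ) • y)‖ ≤ 4 * C := by
      intro k
      rw [norm_smul, norm_pow, Complex.norm_I, one_pow, one_mul]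
      refine (hβ _).trans ?_
      have h2 : ‖e (x + Complex.I ^ (k : ℕ) • y)‖ ≤ 2 := by
        rw [map_add, map_smul]
        refine (norm_add_le _ _).trans ?_
        rw [norm_smul, norm_pow, Complex.norm_I, one_pow, one_mul, hx, hy]
        norm_num
      have h3 := norm_nonneg (e (x + Complex.I ^ (k : ℕ) • y))
      have h4 := mul_le_mul_of_nonneg_left (pow_le_pow_left₀ h3 h2 2) hC
      linarith
    have h2 := (norm_sum_le Finset.univ _).trans (Finset.sum_le_sum fun k _ => h1 k)
    rw [Finset.sum_const, Finset.card_univ, Fintype.card_fin] at h2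
    norm_num at h2 ⊢
    linarith
  rcases eq_or_ne (e x) 0 with hx | hx
  · rw [he x hx]
    simp
  rcases eq_or_ne (e y) 0 with hy | hy
  · rw [he y hy]
    simp
  have h := hunit ((‖e x‖ : ℂ)⁻¹ • x) ((‖e y‖ : ℂ)⁻¹ • y)
    (by rw [map_smul]; exact norm_smul_inv_norm hx) (by rw [map_smul]; exact norm_smul_inv_norm hy)
  rw [map_smulₛₗ, map_smulₛₗ, LinearMap.smul_apply, norm_smul, norm_smul, RCLike.norm_conj,
    RingHom.id_apply, norm_inv, norm_inv, Complex.norm_real, Complex.norm_real, norm_norm,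
    norm_norm] at h
  have hx' := norm_pos_iff.2 hx
  have hy' := norm_pos_iff.2 hy
  rw [← mul_assoc, ← mul_inv, inv_mul_le_iff₀ (by positivity)] at h
  linarith

/-- Extend in the second variable for each fixed first one, then extend the resulting
operator-valued linear map in the first variable. -/
theorem exists_sesquilinear_extension {V F E : Type*} [AddCommGroup V] [Module ℂ V]
    [NormedAddCommGroup F] [NormedSpace ℂ F] [NormedAddCommGroup E] [NormedSpace ℂ E]
    [CompleteSpace E] {e : V →ₗ[ℂ] F} (he : DenseRange e) {β : V →ₗ[ℂ] V →ₗ⋆[ℂ] E} {C : ℝ}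
    (hC : 0 ≤ C) (hβ : ∀ x y, ‖β x y‖ ≤ C * ‖e x‖ * ‖e y‖) :
    ∃ γ : F →L[ℂ] F →L⋆[ℂ] E, ∀ x y, γ (e x) (e y) = β x y := by
  let f : V → F →L⋆[ℂ] E := fun x => (β x).extendOfNorm e
  have hf : ∀ x y, f x (e y) = β x y := fun x y =>
    LinearMap.extendOfNorm_eq he ⟨C * ‖e x‖, hβ x⟩ y
  have hext : ∀ g g' : F →L⋆[ℂ] E, (∀ y, g (e y) = g' (e y)) → g = g' := fun g g' h =>
    ContinuousLinearMap.ext fun z => he.induction_on (p := fun z => g z = g' z) z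
      (isClosed_eq g.continuous g'.continuous) h
  let f' : V →ₗ[ℂ] F →L⋆[ℂ] E :=
    { toFun := f
      map_add' := fun x x' => hext _ _ fun y => by simp [hf]
      map_smul' := fun c x => hext _ _ fun y => by simp [hf] }
  have hn : ∀ x, ‖f' x‖ ≤ C * ‖e x‖ := fun x =>
    LinearMap.opNorm_extendOfNorm_le he (by positivity) (hβ x)
  refine ⟨f'.extendOfNorm e, fun x y => ?_⟩
  rw [LinearMap.extendOfNorm_eq he ⟨C, hn⟩]
  exact hf x y

theorem isPositive_of_inner_nonneg {H : Type*} [NormedAddCommGroup H] [InnerProductSpace ℂ H]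
    [CompleteSpace H] {T : H →L[ℂ] H} (h : ∀ x, (0 : ℂ) ≤ inner ℂ x (T x)) : T.IsPositive := by
  rw [ContinuousLinearMap.isPositive_iff_complex]
  intro x
  have h2 : (inner ℂ (T x) x : ℂ) = inner ℂ x (T x) := by
    rw [← inner_conj_symm, Complex.conj_eq_iff_im]
    exact (Complex.nonneg_iff.1 (h x)).2.symm
  rw [h2]
  refine ⟨Complex.ext (by simp) ?_, (Complex.nonneg_iff.1 (h x)).1⟩
  simpa using (Complex.nonneg_iff.1 (h x)).2

/-! ### The ampliation `Φ ⊗ Id` of a completely positive map -/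

section TensorExtension

variable {H : Type u} [NormedAddCommGroup H] [InnerProductSpace ℂ H] [CompleteSpace H]
  {K : Type v} [NormedAddCommGroup K] [InnerProductSpace ℂ K] [CompleteSpace K]

/-- With `L_y x = x ⊗ y` this is `L_y A L_{y'}*`, which reduces positivity on `H ⊗ K` to that of
kernels on `H`. -/
theorem opTensor_rankOne_right (A : H →L[ℂ] H) (y y' : K) :
    opTensor A (InnerProductSpace.rankOne ℂ y y') =
      (vtmulL H K).flip y ∘L A ∘L ContinuousLinearMap.adjoint ((vtmulL H K).flip y') := by
  refine htensor_ext fun x k => ?_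
  have h : ContinuousLinearMap.adjoint ((vtmulL H K).flip y') (vtmul x k) =
      (inner ℂ y' k : ℂ) • x := by
    refine ext_inner_left ℂ fun z => ?_
    rw [ContinuousLinearMap.adjoint_inner_right, ContinuousLinearMap.flip_apply, vtmulL_apply,
      inner_vtmul, inner_smul_right, mul_comm]
  rw [ContinuousLinearMap.comp_apply, ContinuousLinearMap.comp_apply, h]
  simp [vtmul_smul_right]

variable {ι : Type*} (b : HilbertBasis ι ℂ H)

variable (K) in
/-- The map `(y i) ↦ ∑ b i ⊗ y i`. -/
noncomputable def finsuppTensor : (ι →₀ K) →ₗ[ℂ] HTensor H K :=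
  Finsupp.lsum ℂ fun i => (vtmulL H K (b i)).toLinearMap

@[simp] theorem finsuppTensor_single (i : ι) (k : K) :
    finsuppTensor K b (Finsupp.single i k) = vtmul (b i) k := by
  rw [finsuppTensor, Finsupp.lsum_single]
  rfl

theorem finsuppTensor_apply (y : ι →₀ K) :
    finsuppTensor K b y = ∑ i ∈ y.support, vtmul (b i) (y i) := rfl

theorem denseRange_finsuppTensor : DenseRange (finsuppTensor K b) := by
  have h : Dense (Submodule.span ℂ (Set.range fun p : ι × K => vtmul (b p.1) p.2) :
      Set (HTensor H K)) := by
    rw [Submodule.dense_iff_topologicalClosure_eq_top]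
    exact top_le_iff.1 (top_le_closure_span_vtmul (v := b) (w := id)
      (Submodule.dense_iff_topologicalClosure_eq_top.2 b.dense_span) (by simp))
  refine h.mono ?_
  change Submodule.span ℂ _ ≤ LinearMap.range (finsuppTensor K b)
  rw [Submodule.span_le]
  rintro _ ⟨⟨i, k⟩, rfl⟩
  exact ⟨Finsupp.single i k, finsuppTensor_single b i k⟩

/-- The adjoint of `k ↦ b i ⊗ k` reads off the `i`-th component. -/
theorem eq_zero_of_finsuppTensor_eq_zero {y : ι →₀ K} (hy : finsuppTensor K b y = 0) : y = 0 := by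
  classical
  ext i
  have h : (ContinuousLinearMap.adjoint (vtmulL H K (b i))).toLinearMap ∘ₗ finsuppTensor K b =
      Finsupp.lapply i := by
    refine Finsupp.lhom_ext fun j k => ext_inner_left ℂ fun z => ?_
    change inner ℂ z (ContinuousLinearMap.adjoint (vtmulL H K (b i)) _) = _
    rw [ContinuousLinearMap.adjoint_inner_right, finsuppTensor_single, vtmulL_apply, inner_vtmul,
      orthonormal_iff_ite.1 b.orthonormal, Finsupp.lapply_apply, Finsupp.single_apply]
    by_cases hij : i = j
    · simp [hij]
    · simp [hij, Ne.symm hij]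
  have h1 := congrArg (fun f => f y) h
  simp only [LinearMap.comp_apply, hy, map_zero] at h1
  exact h1.symm

/-- The sesquilinear map `(y, y') ↦ ∑ Φ(|b i⟩⟨b j|) ⊗ |y i⟩⟨y' j|`. -/
noncomputable def finsuppForm (Φ : TraceClass H →L[ℂ] TraceClass H) :
    (ι →₀ K) →ₗ[ℂ] (ι →₀ K) →ₗ⋆[ℂ] TraceClass (HTensor H K) :=
  LinearMap.mk₂'ₛₗ (RingHom.id ℂ) (starRingEnd ℂ)
    (fun y y' => y.sum fun i k => y'.sum fun j k' =>
      TraceClass.tmulL H K (Φ (TraceClass.rankOne (b i) (b j))) (TraceClass.rankOneL K k k'))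
    (fun y₁ y₂ y' => by
      refine Finsupp.sum_add_index' (fun i => ?_) fun i k k' => ?_
      · simp only [map_zero, zero_apply, Finsupp.sum, Finset.sum_const_zero]
      · simp only [map_add, add_apply, Finsupp.sum_add])
    (fun c y y' => by
      rw [Finsupp.sum_smul_index', Finsupp.smul_sum]
      · simp only [map_smul, smul_apply, Finsupp.smul_sum, RingHom.id_apply]
      · intro i
        simp only [map_zero, zero_apply, Finsupp.sum, Finset.sum_const_zero])
    (fun y y₁ y₂ => by
      rw [← Finsupp.sum_add]
      refine Finsupp.sum_congr fun i _ => Finsupp.sum_add_index' (fun j => ?_) fun j k k' => ?_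
      · rw [map_zero, map_zero]
      · rw [map_add, map_add])
    (fun c y y' => by
      rw [Finsupp.smul_sum]
      refine Finsupp.sum_congr fun i _ => ?_
      rw [Finsupp.sum_smul_index', Finsupp.smul_sum]
      · simp only [map_smulₛₗ, RingHom.id_apply]
      · intro j
        rw [map_zero, map_zero])

theorem finsuppForm_apply (Φ : TraceClass H →L[ℂ] TraceClass H) (y y' : ι →₀ K) :
    finsuppForm b Φ y y' = ∑ i ∈ y.support, ∑ j ∈ y'.support,
      (Φ (TraceClass.rankOne (b i) (b j))).tmul (TraceClass.rankOne (y i) (y' j)) := rfl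

theorem finsuppForm_single (Φ : TraceClass H →L[ℂ] TraceClass H) (i j : ι) (k k' : K) :
    finsuppForm b Φ (Finsupp.single i k) (Finsupp.single j k') =
      (Φ (TraceClass.rankOne (b i) (b j))).tmul (TraceClass.rankOne k k') := by
  rw [finsuppForm, LinearMap.mk₂'ₛₗ_apply, Finsupp.sum_single_index, Finsupp.sum_single_index]
  · rfl
  · rw [map_zero, map_zero]
  · simp only [map_zero, zero_apply, Finsupp.sum, Finset.sum_const_zero]

theorem isPositive_finsuppForm {Φ : TraceClass H →L[ℂ] TraceClass H}
    (hΦ : IsCompletelyPositive Φ) (y : ι →₀ K) : (finsuppForm b Φ y y).op.IsPositive := by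
  refine isPositive_of_inner_nonneg fun w => ?_
  have h := (hΦ.isPositiveKernel b).sum_nonneg (κ := y.support) (fun i => i)
    (fun i => ContinuousLinearMap.adjoint ((vtmulL H K).flip (y i)) w)
  have h1 : ∀ i j, inner ℂ w (((Φ (TraceClass.rankOne (b i) (b j))).tmul
      (TraceClass.rankOne (y i) (y j))).op w) =
      inner ℂ (ContinuousLinearMap.adjoint ((vtmulL H K).flip (y i)) w)
        ((Φ (TraceClass.rankOne (b i) (b j))).op
          (ContinuousLinearMap.adjoint ((vtmulL H K).flip (y j)) w)) := by
    intro i j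
    rw [TraceClass.op_tmul, TraceClass.op_rankOne, opTensor_rankOne_right,
      ContinuousLinearMap.adjoint_inner_left]
    rfl
  simp only [← h1] at h
  rw [finsuppForm_apply]
  convert h using 1
  rw [← TraceClass.matrixElt_apply, map_sum]
  simp only [map_sum, TraceClass.matrixElt_apply]
  rw [← Finset.sum_coe_sort]
  refine Finset.sum_congr rfl fun i _ => ?_
  rw [← Finset.sum_coe_sort]

/-- On a positive operator the trace norm is the trace, and the trace of the form is `⟨z, (m ⊗ 1)
z⟩` with `z = ∑ b i ⊗ y i` and `m = Φ*(1)`. Hence `C = ‖m ⊗ 1‖`. -/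
theorem exists_norm_finsuppForm_le {Φ : TraceClass H →L[ℂ] TraceClass H}
    (hΦ : IsCompletelyPositive Φ) : ∃ C, 0 ≤ C ∧ ∀ y : ι →₀ K,
      ‖finsuppForm b Φ y y‖ ≤ C * ‖finsuppTensor K b y‖ ^ 2 := by
  obtain ⟨m, hm⟩ := TraceClass.exists_operator_of_sesquilinear (TraceClass.trace ∘L Φ)
    (TraceClass.rankOneL H)
  refine ⟨‖opTensor m (1 : K →L[ℂ] K)‖, by positivity, fun y => ?_⟩
  have h1 : (finsuppForm b Φ y y).trace =
      inner ℂ (finsuppTensor K b y) (opTensor m (1 : K →L[ℂ] K) (finsuppTensor K b y)) := by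
    simp only [finsuppForm_apply, finsuppTensor_apply, map_sum, sum_inner, inner_sum,
      opTensor_vtmul, inner_vtmul, TraceClass.trace_tmul_rankOne, ← hm]
    rfl
  rw [TraceClass.norm_eq_trace (isPositive_finsuppForm b hΦ y), h1]
  refine (Complex.re_le_norm _).trans ((norm_inner_le_norm _ _).trans ?_)
  have h2 := (opTensor m (1 : K →L[ℂ] K)).le_opNorm (finsuppTensor K b y)
  have h3 := norm_nonneg (finsuppTensor K b y)
  nlinarith

/-- A completely positive map `Φ` on the trace class has the ampliation `Φ ⊗ Id`. -/
theorem IsCompletelyPositive.exists_isTensorId {Φ : TraceClass H →L[ℂ] TraceClass H}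
    (hΦ : IsCompletelyPositive Φ) {S : Set (TraceClass (HTensor H K))} (hS : IsClosed S)
    (h0 : (0 : TraceClass (HTensor H K)) ∈ S) (hadd : ∀ s ∈ S, ∀ t ∈ S, s + t ∈ S)
    (hform : ∀ y : ι →₀ K, finsuppForm b Φ y y ∈ S) :
    ∃ Ψ : TraceClass (HTensor H K) →L[ℂ] TraceClass (HTensor H K), IsTensorId Φ Ψ ∧
      ∀ ω : TraceClass (HTensor H K), ω.op.IsPositive → Ψ ω ∈ S := by
  obtain ⟨C, hC0, hC⟩ := exists_norm_finsuppForm_le (K := K) b hΦ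
  obtain ⟨β, hβ⟩ := exists_sesquilinear_extension (denseRange_finsuppTensor (K := K) b)
    (by positivity) (norm_sesquilinear_le_of_quadratic
      (fun _ => eq_zero_of_finsuppTensor_eq_zero b) hC0 hC)
  obtain ⟨Ψ, hΨ⟩ := TraceClass.exists_lift β
  refine ⟨Ψ, fun A B => ?_, fun ω hω => ?_⟩
  -- The form at `y, y'` is the intended value of `Φ ⊗ Id` at `|z⟩⟨z'|`. So the product formula
  -- holds on rank-one products of basis elements and extends by linearity and continuity.
  · have h1 : ∀ i j, Ψ ∘L TraceClass.tmulL H K (TraceClass.rankOne (b i) (b j)) =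
        TraceClass.tmulL H K (Φ (TraceClass.rankOne (b i) (b j))) := fun i j =>
      TraceClass.ext_of_rankOne fun k k' => by
        rw [ContinuousLinearMap.comp_apply, TraceClass.tmulL_apply, TraceClass.tmulL_apply,
          TraceClass.rankOne_tmul_rankOne, hΨ, ← finsuppForm_single, ← hβ, finsuppTensor_single,
          finsuppTensor_single]
    have h2 : Ψ ∘L (TraceClass.tmulL H K).flip B = (TraceClass.tmulL H K).flip B ∘L Φ :=
      TraceClass.ext_of_basis b fun i j => congrArg (fun f => f B) (h1 i j)
    exact congrArg (fun f => f A) h2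
  · have hββ : ∀ z, β z z ∈ S := fun z => by
      refine (denseRange_finsuppTensor (K := K) b).induction_on (p := fun z => β z z ∈ S) z ?_
        fun y => by rw [hβ]; exact hform y
      exact hS.preimage ((continuous_sesquilinear β).comp (continuous_id.prodMk continuous_id))
    -- A positive `ω` is a sum of operators `|z⟩⟨z|`, whose images lie in `S`; `S` is closed under
    -- addition and limits.
    obtain ⟨x, hx⟩ := TraceClass.exists_hasSum_rankOne_self hω
    have h1 := hx.mapL Ψ
    simp only [hΨ] at h1
    refine hS.mem_of_tendsto h1 (Filter.Eventually.of_forall fun s => ?_)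
    exact Finset.sum_induction _ (· ∈ S) (fun a b ha hb => hadd a ha b hb) h0 fun i _ => hββ (x i)

end TensorExtension

/-- The integral is the total mass times the average, and the average stays in a closed convex set.
The average is meaningless for `μ = 0`, whence the separate hypothesis on `0`. -/
theorem integral_mem_of_convex_cone {X E : Type*} [MeasurableSpace X] [NormedAddCommGroup E]
    [NormedSpace ℝ E] [CompleteSpace E] {μ : Measure X} [IsFiniteMeasure μ] {S : Set E}
    (hS : IsClosed S) (hconv : Convex ℝ S) (h0 : (0 : E) ∈ S)
    (hsmul : ∀ r : ℝ, 0 ≤ r → ∀ s ∈ S, r • s ∈ S) {f : X → E} (hf : Integrable f μ)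
    (hfS : ∀ᵐ x ∂μ, f x ∈ S) : ∫ x, f x ∂μ ∈ S := by
  rcases eq_or_ne μ 0 with rfl | h
  · simpa using h0
  · have : NeZero μ := ⟨h⟩
    rw [← measure_smul_average]
    exact hsmul _ measureReal_nonneg _ (hconv.average_mem hS hfS hf)

/-! ### The cone of separable operators -/

section Separable

variable {H : Type u} [NormedAddCommGroup H] [InnerProductSpace ℂ H] [CompleteSpace H]
  {K : Type v} [NormedAddCommGroup K] [InnerProductSpace ℂ K] [CompleteSpace K]

theorem isClosed_separableOperators : IsClosed (separableOperators H K) := isClosed_closure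

theorem convex_separableOperators : Convex ℝ (separableOperators H K) :=
  (convex_convexHull ℝ _).closure

theorem tmul_mem_separableOperators {A : TraceClass H} {B : TraceClass K} (hA : A.op.IsPositive)
    (hB : B.op.IsPositive) : A.tmul B ∈ separableOperators H K :=
  subset_closure (subset_convexHull ℝ _ ⟨A, B, hA, hB, rfl⟩)

theorem zero_mem_separableOperators : (0 : TraceClass (HTensor H K)) ∈ separableOperators H K := by
  have h : (0 : TraceClass H).tmul (0 : TraceClass K) = 0 := by
    rw [← TraceClass.tmulL_apply, map_zero]
  rw [← h]
  exact tmul_mem_separableOperators ContinuousLinearMap.isPositive_zero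
    ContinuousLinearMap.isPositive_zero

theorem smul_mem_separableOperators {r : ℝ} (hr : 0 ≤ r) {τ : TraceClass (HTensor H K)}
    (hτ : τ ∈ separableOperators H K) : r • τ ∈ separableOperators H K := by
  refine map_mem_closure (continuous_const_smul r) hτ fun σ hσ => ?_
  have h := Set.smul_mem_smul_set (a := r) hσ
  rw [← convexHull_smul] at h
  refine convexHull_mono ?_ h
  rintro _ ⟨_, ⟨A, B, hA, hB, rfl⟩, rfl⟩
  refine ⟨(r : ℂ) • A, B, ?_, hB, ?_⟩
  · exact hA.smul_of_nonneg (Complex.zero_le_real.2 hr)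
  · change r • A.tmul B = _
    rw [← TraceClass.tmulL_apply, ← TraceClass.tmulL_apply, map_smul, smul_apply, Complex.coe_smul]

theorem add_mem_separableOperators {σ τ : TraceClass (HTensor H K)}
    (hσ : σ ∈ separableOperators H K) (hτ : τ ∈ separableOperators H K) :
    σ + τ ∈ separableOperators H K := by
  have h := smul_mem_separableOperators (r := 2) (by norm_num)
    (convex_separableOperators hσ hτ (a := 1 / 2) (b := 1 / 2) (by norm_num) (by norm_num)
      (by norm_num))
  rw [← smul_add, smul_smul] at h
  norm_num at h
  exact h

/-- The sum collapses to the single product `|ψ⟩⟨ψ| ⊗ B` with `B = ∑ s (f a) (f b) |y a⟩⟨y b|`, and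
positivity of the kernel makes `B` positive. -/
theorem sum_tmul_mem_separableOperators {ι κ : Type*} [Fintype κ] {T : ι → ι → TraceClass H}
    (hT : IsPositiveKernel fun i j => (T i j).op) {ψ : H} {s : ι → ι → ℂ}
    (hs : ∀ i j, T i j = s i j • TraceClass.rankOne ψ ψ) (f : κ → ι) (y : κ → K) :
    ∑ a, ∑ b, (T (f a) (f b)).tmul (TraceClass.rankOne (y a) (y b)) ∈ separableOperators H K := by
  rcases eq_or_ne ψ 0 with rfl | hψ
  · have h : ∀ i j, T i j = 0 := fun i j => TraceClass.ext (by simp [hs])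
    simp only [h, ← TraceClass.tmulL_apply, map_zero, zero_apply,
      Finset.sum_const_zero, zero_mem_separableOperators]
  let B : TraceClass K := ∑ a, ∑ b, s (f a) (f b) • TraceClass.rankOne (y a) (y b)
  have hB : ∑ a, ∑ b, (T (f a) (f b)).tmul (TraceClass.rankOne (y a) (y b)) =
      (TraceClass.rankOne ψ ψ).tmul B := by
    simp only [B, hs, ← TraceClass.tmulL_apply, map_sum, map_smul, smul_apply]
  rw [hB]
  refine tmul_mem_separableOperators ?_ (isPositive_of_inner_nonneg fun w => ?_)
  · exact InnerProductSpace.isPositive_rankOne_self ψ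
  · have h0 : (inner ℂ ψ ψ : ℂ) = ((‖ψ‖ ^ 2 : ℝ) : ℂ) := by
      rw [inner_self_eq_norm_sq_to_K]
      norm_cast
    -- Testing the kernel on these multiples of `ψ` gives `‖ψ‖⁴ ⟨w, B w⟩`.
    have h := hT.sum_nonneg f fun a => (inner ℂ (y a) w : ℂ) • ψ
    have h1 : ∀ a b, (inner ℂ ((inner ℂ (y a) w : ℂ) • ψ)
        ((T (f a) (f b)).op ((inner ℂ (y b) w : ℂ) • ψ)) : ℂ) =
        (‖ψ‖ ^ 2 * ‖ψ‖ ^ 2 : ℝ) *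
          TraceClass.matrixElt w w (s (f a) (f b) • TraceClass.rankOne (y a) (y b)) := by
      intro a b
      simp only [hs, TraceClass.matrixElt_apply, TraceClass.op_smul, TraceClass.op_rankOne,
        smul_apply, InnerProductSpace.rankOne_apply, inner_smul_left,
        inner_smul_right, inner_conj_symm, h0]
      push_cast
      ring
    simp only [h1, ← Finset.mul_sum, ← map_sum] at h
    have h2 := norm_ne_zero_iff.2 hψ
    have h3 : (0 : ℂ) ≤ (((‖ψ‖ ^ 2 * ‖ψ‖ ^ 2)⁻¹ : ℝ) : ℂ) := by
      rw [Complex.zero_le_real]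
      positivity
    have h4 := mul_nonneg h3 h
    rw [← mul_assoc, ← Complex.ofReal_mul, inv_mul_cancel₀ (by positivity), Complex.ofReal_one,
      one_mul] at h4
    exact h4

end Separable

/-! ### Entanglement-breaking operations from one-dimensional outputs -/

section EntanglementBreaking

variable {X : Type v} [MeasurableSpace X]
variable {H : Type u} [NormedAddCommGroup H] [InnerProductSpace ℂ H] [CompleteSpace H]

/-- The value of `Φ ⊗ Id` at a vector `∑ b i ⊗ y i` is the integral of pointwise separable
operators, so it lies in the closed separable cone. -/
theorem IsQuantumOperation.isEntanglementBreaking {Φ : TraceClass H →L[ℂ] TraceClass H}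
    (hΦ : IsQuantumOperation Φ) {ι : Type*} (b : HilbertBasis ι ℂ H) {μ : Measure X}
    [IsFiniteMeasure μ] {T : ι → ι → X → TraceClass H} (hTi : ∀ i j, Integrable (T i j) μ)
    (hTΦ : ∀ i j, ∫ x, T i j x ∂μ = Φ (TraceClass.rankOne (b i) (b j)))
    (hpos : ∀ᵐ x ∂μ, IsPositiveKernel fun i j => (T i j x).op)
    (hT : ∀ᵐ x ∂μ, ∃ (ψ : H) (s : ι → ι → ℂ), ∀ i j, T i j x = s i j • TraceClass.rankOne ψ ψ) :
    IsEntanglementBreaking Φ := by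
  refine ⟨hΦ, fun K _ _ _ _ => ?_⟩
  have hform : ∀ y : ι →₀ K, finsuppForm b Φ y y ∈ separableOperators H K := by
    intro y
    have hi : ∀ i j : y.support, Integrable
        (fun x => (T i j x).tmul (TraceClass.rankOne (y i) (y j))) μ := fun i j =>
      ((TraceClass.tmulL H K).flip (TraceClass.rankOne (y i) (y j))).integrable_comp (hTi i j)
    have h3 : finsuppForm b Φ y y = ∫ x, ∑ i : y.support, ∑ j : y.support,
        (T i j x).tmul (TraceClass.rankOne (y i) (y j)) ∂μ := by
      rw [integral_finsetSum _ fun i _ => integrable_finsetSum _ fun j _ => hi i j,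
        finsuppForm_apply, ← Finset.sum_coe_sort]
      refine Finset.sum_congr rfl fun i _ => ?_
      rw [integral_finsetSum _ fun j _ => hi i j, ← Finset.sum_coe_sort]
      refine Finset.sum_congr rfl fun j _ => ?_
      rw [← hTΦ]
      exact (((TraceClass.tmulL H K).flip (TraceClass.rankOne (y i) (y j))).integral_comp_comm
        (hTi i j)).symm
    rw [h3]
    refine integral_mem_of_convex_cone isClosed_separableOperators convex_separableOperators
      zero_mem_separableOperators (fun r hr s hs => smul_mem_separableOperators hr hs)
      (integrable_finsetSum _ fun i _ => integrable_finsetSum _ fun j _ => hi i j) ?_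
    filter_upwards [hpos, hT] with x hx ⟨ψ, s, hs⟩
    exact sum_tmul_mem_separableOperators hx hs _ _
  obtain ⟨Ψ, h1, h2⟩ := hΦ.completelyPositive.exists_isTensorId (K := K) b
    isClosed_separableOperators zero_mem_separableOperators
    (fun s hs t ht => add_mem_separableOperators hs ht) hform
  exact ⟨Ψ, h1, fun ω => h2 _ ω.isPositive⟩

end EntanglementBreaking

/-- By orthogonality the squared distance from `z` to a partial sum is `‖z‖² - ∑ ‖y n‖²`, which
tends to zero. This yields strong σ-additivity of projections. -/
theorem hasSum_of_hasSum_norm_sq {α E : Type*} [NormedAddCommGroup E] [InnerProductSpace ℂ E]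
    {y : α → E} {z : E} (h1 : Pairwise fun n m => inner ℂ (y n) (y m) = 0)
    (h2 : ∀ n, inner ℂ z (y n) = ((‖y n‖ ^ 2 : ℝ) : ℂ))
    (h3 : HasSum (fun n => ‖y n‖ ^ 2) (‖z‖ ^ 2)) : HasSum y z := by
  classical
  have h4 : ∀ s : Finset α, ‖z - ∑ n ∈ s, y n‖ ^ 2 = ‖z‖ ^ 2 - ∑ n ∈ s, ‖y n‖ ^ 2 := by
    intro s
    have h5 : (inner ℂ (∑ n ∈ s, y n) (∑ n ∈ s, y n) : ℂ) = ((∑ n ∈ s, ‖y n‖ ^ 2 : ℝ) : ℂ) := by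
      rw [sum_inner, Complex.ofReal_sum]
      refine Finset.sum_congr rfl fun n hn => ?_
      rw [inner_sum, Finset.sum_eq_single_of_mem n hn fun m _ hm => h1 hm.symm,
        inner_self_eq_norm_sq_to_K]
      norm_cast
    have h6 : (inner ℂ z (∑ n ∈ s, y n) : ℂ) = ((∑ n ∈ s, ‖y n‖ ^ 2 : ℝ) : ℂ) := by
      rw [inner_sum, Complex.ofReal_sum]
      exact Finset.sum_congr rfl fun n _ => h2 n
    have h7 : ‖∑ n ∈ s, y n‖ ^ 2 = ∑ n ∈ s, ‖y n‖ ^ 2 := by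
      rw [← inner_self_eq_norm_sq (𝕜 := ℂ), h5]
      exact Complex.ofReal_re _
    have h8 : RCLike.re ((∑ n ∈ s, ‖y n‖ ^ 2 : ℝ) : ℂ) = ∑ n ∈ s, ‖y n‖ ^ 2 :=
      Complex.ofReal_re _
    rw [norm_sub_sq (𝕜 := ℂ), h6, h7, h8]
    ring
  have h5 := (tendsto_const_nhds (x := ‖z‖ ^ 2)).sub h3
  simp only [sub_self, ← h4] at h5
  have h6 := h5.sqrt
  simp only [Real.sqrt_sq (norm_nonneg _), Real.sqrt_zero] at h6
  refine tendsto_iff_norm_sub_tendsto_zero.2 (h6.congr fun s => norm_sub_rev _ _)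

/-! ### Multiplication by indicators as a spectral measure of multiplicity one -/

section Multiplication

variable {X : Type*} [MeasurableSpace X] {ν : Measure X}

/-- The multiplication by the indicator function of a measurable set in `L²`. -/
noncomputable def indicatorL (ν : Measure X) {F : Set X} (hF : MeasurableSet F) :
    Lp ℂ 2 ν →L[ℂ] Lp ℂ 2 ν :=
  LinearMap.mkContinuous
    { toFun := fun f => ((Lp.memLp f).indicator hF).toLp
      map_add' := fun f g => by
        refine Lp.ext ?_
        filter_upwards [((Lp.memLp (f + g)).indicator hF).coeFn_toLp, Lp.coeFn_add f g,
          Lp.coeFn_add ((Lp.memLp f).indicator hF).toLp ((Lp.memLp g).indicator hF).toLp,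
          ((Lp.memLp f).indicator hF).coeFn_toLp, ((Lp.memLp g).indicator hF).coeFn_toLp]
          with x h1 h2 h3 h4 h5
        rw [h1, h3, Pi.add_apply, h4, h5]
        by_cases hx : x ∈ F
        · simp only [Set.indicator_of_mem hx, h2, Pi.add_apply]
        · simp [hx]
      map_smul' := fun c f => by
        refine Lp.ext ?_
        filter_upwards [((Lp.memLp (c • f)).indicator hF).coeFn_toLp, Lp.coeFn_smul c f,
          Lp.coeFn_smul c ((Lp.memLp f).indicator hF).toLp,
          ((Lp.memLp f).indicator hF).coeFn_toLp] with x h1 h2 h3 h4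
        rw [h1, RingHom.id_apply, h3, Pi.smul_apply, h4]
        by_cases hx : x ∈ F
        · simp only [Set.indicator_of_mem hx, h2, Pi.smul_apply]
        · simp [hx] } 1 fun f => by
    rw [one_mul]
    refine Lp.norm_le_norm_of_ae_le ?_
    filter_upwards [((Lp.memLp f).indicator hF).coeFn_toLp] with x hx
    refine (congrArg norm hx).trans_le ?_
    exact norm_indicator_le_norm_self _ _

theorem indicatorL_coeFn {F : Set X} (hF : MeasurableSet F) (f : Lp ℂ 2 ν) :
    indicatorL ν hF f =ᵐ[ν] F.indicator f := ((Lp.memLp f).indicator hF).coeFn_toLp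

theorem inner_indicatorL {F : Set X} (hF : MeasurableSet F) (f g : Lp ℂ 2 ν) :
    inner ℂ f (indicatorL ν hF g) = ∫ x in F, inner ℂ (f x) (g x) ∂ν := by
  rw [L2.inner_def, ← integral_indicator hF]
  refine integral_congr_ae ?_
  filter_upwards [indicatorL_coeFn hF g] with x hx
  rw [hx]
  by_cases h : x ∈ F <;> simp [h]

theorem indicatorL_indicatorL {F G : Set X} (hF : MeasurableSet F) (hG : MeasurableSet G)
    (f : Lp ℂ 2 ν) : indicatorL ν hF (indicatorL ν hG f) = indicatorL ν (hF.inter hG) f := by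
  refine Lp.ext ?_
  filter_upwards [indicatorL_coeFn hF (indicatorL ν hG f), indicatorL_coeFn hG f,
    indicatorL_coeFn (hF.inter hG) f] with x h1 h2 h3
  rw [h1, h3]
  by_cases hx : x ∈ F <;> by_cases hx' : x ∈ G <;> simp [hx, hx', h2]

theorem indicatorL_isSymmetric {F : Set X} (hF : MeasurableSet F) (f g : Lp ℂ 2 ν) :
    inner ℂ (indicatorL ν hF f) g = inner ℂ f (indicatorL ν hF g) := by
  rw [← inner_conj_symm, inner_indicatorL, inner_indicatorL, ← integral_conj]
  simp only [inner_conj_symm]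

theorem norm_indicatorL_sq {F : Set X} (hF : MeasurableSet F) (f : Lp ℂ 2 ν) :
    ‖indicatorL ν hF f‖ ^ 2 = ∫ x in F, ‖f x‖ ^ 2 ∂ν := by
  have h1 : (inner ℂ (indicatorL ν hF f) (indicatorL ν hF f) : ℂ) =
      ((∫ x in F, ‖f x‖ ^ 2 ∂ν : ℝ) : ℂ) := by
    rw [indicatorL_isSymmetric, indicatorL_indicatorL, inner_indicatorL, ← integral_complex_ofReal,
      Set.inter_self]
    refine integral_congr_ae (Filter.Eventually.of_forall fun x => ?_)
    change (inner ℂ (f x) (f x) : ℂ) = _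
    rw [inner_self_eq_norm_sq_to_K]
    norm_cast
  rw [← inner_self_eq_norm_sq (𝕜 := ℂ), h1]
  exact Complex.ofReal_re _

open Classical in
variable (ν) in
/-- The spectral measure of multiplications by indicators in `L²`. -/
noncomputable def indicatorSpectralMeasure : SpectralMeasure X (Lp ℂ 2 ν) where
  toFun F := if hF : MeasurableSet F then indicatorL ν hF else 0
  isStarProjection F hF := by
    rw [dif_pos hF]
    refine ⟨?_, ?_⟩
    · refine ContinuousLinearMap.ext fun f => ?_
      rw [mul_apply_eq_comp, indicatorL_indicatorL]
      congr 1
      simp only [Set.inter_self]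
    · exact ContinuousLinearMap.isSelfAdjoint_iff_isSymmetric.2 (indicatorL_isSymmetric hF)
  hasSum_iUnion F hF hd f := by
    simp only [hF, MeasurableSet.iUnion hF, dif_pos]
    refine hasSum_of_hasSum_norm_sq (fun n m hnm => ?_) (fun n => ?_) ?_
    · beta_reduce
      rw [indicatorL_isSymmetric, indicatorL_indicatorL, inner_indicatorL,
        Set.disjoint_iff_inter_eq_empty.1 (hd hnm), setIntegral_empty]
    · rw [indicatorL_isSymmetric, indicatorL_indicatorL, norm_indicatorL_sq, inner_indicatorL,
        Set.inter_eq_right.2 (Set.subset_iUnion F n), ← integral_complex_ofReal]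
      refine integral_congr_ae (Filter.Eventually.of_forall fun x => ?_)
      change (inner ℂ (f x) (f x) : ℂ) = _
      rw [inner_self_eq_norm_sq_to_K]
      norm_cast
    · simp only [norm_indicatorL_sq]
      exact hasSum_integral_iUnion hF hd (Lp.memLp f).norm.integrable_sq.integrableOn
  univ_eq_one := by
    rw [dif_pos MeasurableSet.univ]
    refine ContinuousLinearMap.ext fun f => Lp.ext ?_
    filter_upwards [indicatorL_coeFn MeasurableSet.univ f] with x hx
    rw [hx, Set.indicator_univ]
    rfl

theorem indicatorSpectralMeasure_apply {F : Set X} (hF : MeasurableSet F) :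
    (indicatorSpectralMeasure ν).toFun F = indicatorL ν hF := dif_pos hF

theorem hasMultiplicityOne_indicatorSpectralMeasure [IsFiniteMeasure ν] :
    (indicatorSpectralMeasure ν).HasMultiplicityOne := by
  -- The constant function `1` is cyclic, since `P(s)ξ` is the indicator of `s`; it is square
  -- integrable because `ν` is finite.
  let ξ : Lp ℂ 2 ν := indicatorConstLp 2 MeasurableSet.univ (measure_ne_top ν _) 1
  refine ⟨ξ, ?_⟩
  set N := Submodule.span ℂ {y | ∃ F, MeasurableSet F ∧
    y = (indicatorSpectralMeasure ν).toFun F ξ} with hN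
  intro f
  change f ∈ N.topologicalClosure
  induction f using Lp.induction with
  | hp_ne_top => simp
  | isClosed => exact N.isClosed_topologicalClosure
  | add hf hg _ h1 h2 => exact Submodule.add_mem _ h1 h2
  | @indicatorConst c s hs hμs =>
    refine N.le_topologicalClosure ?_
    have h : ((Lp.simpleFunc.indicatorConst 2 hs hμs.ne c : Lp.simpleFunc ℂ 2 ν) : Lp ℂ 2 ν) =
        c • (indicatorSpectralMeasure ν).toFun s ξ := by
      rw [Lp.simpleFunc.coe_indicatorConst, indicatorSpectralMeasure_apply hs]
      refine Lp.ext ?_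
      filter_upwards [indicatorConstLp_coeFn (p := 2) (hs := hs) (hμs := hμs.ne) (c := c),
        Lp.coeFn_smul c (indicatorL ν hs ξ), indicatorL_coeFn hs ξ,
        indicatorConstLp_coeFn (p := 2) (hs := MeasurableSet.univ) (hμs := measure_ne_top ν _)
          (c := (1 : ℂ))] with x h1 h2 h3 h4
      rw [h1, h2, Pi.smul_apply, h3]
      by_cases hx : x ∈ s
      · simp only [hx, Set.indicator_of_mem, ξ]
        rw [h4]
        simp
      · simp [hx]
    rw [h]
    exact N.smul_mem _ (Submodule.subset_span ⟨s, hs, rfl⟩)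

end Multiplication

/-- Basis vectors are at distance `√2`, so their balls of radius `1/2` are disjoint open sets. -/
theorem countable_of_hilbertBasis {H ι : Type*} [NormedAddCommGroup H] [InnerProductSpace ℂ H]
    [TopologicalSpace.SeparableSpace H] (b : HilbertBasis ι ℂ H) : Countable ι := by
  refine Pairwise.countable_of_isOpen_disjoint (s := fun i => Metric.ball (b i) (1 / 2))
    (fun i j hij => ?_) (fun _ => Metric.isOpen_ball)
    fun i => ⟨b i, Metric.mem_ball_self (by norm_num)⟩
  refine Metric.ball_disjoint_ball ?_
  have h1 : ‖b i - b j‖ ^ 2 = 2 := by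
    rw [norm_sub_sq (𝕜 := ℂ), b.orthonormal.2 hij, b.orthonormal.1, b.orthonormal.1]
    norm_num
  rw [dist_eq_norm]
  nlinarith [norm_nonneg (b i - b j)]

/-! ### Irreducible instruments are efficient -/

section IrreducibleEfficient

variable {X : Type v} [MeasurableSpace X]
variable {H : Type u} [NormedAddCommGroup H] [InnerProductSpace ℂ H] [CompleteSpace H]

/-- If `T i j = |w i⟩⟨w j|`, then `T j i (b k) = ⟨w i, b k⟩ w j`, so one column of the kernel,
divided by the root of a diagonal entry, recovers every `w j` up to a common phase. The column is
the first admissible one in an enumeration, which makes the choice measurable. -/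
theorem exists_measurable_gram [TopologicalSpace.SeparableSpace H] {ι : Type*} [Countable ι]
    (b : HilbertBasis ι ℂ H) {T : ι → ι → X → TraceClass H}
    (hT : ∀ i j, StronglyMeasurable (T i j)) :
    ∃ v : ι → X → H, (∀ i, StronglyMeasurable (v i)) ∧
      ∀ x, (∃ w : ι → H, ∀ i j, T i j x = TraceClass.rankOne (w i) (w j)) →
        ∀ i j, T i j x = TraceClass.rankOne (v i x) (v j x) := by
  classical
  rcases isEmpty_or_nonempty ι with hι | hι
  · exact ⟨fun i => isEmptyElim i, fun i => isEmptyElim i, fun x _ i => isEmptyElim i⟩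
  borelize H
  obtain ⟨q, hq⟩ := exists_surjective_nat (ι × ι)
  let C : ℕ → X → ℝ := fun n x =>
    (TraceClass.matrixElt (b (q n).2) (b (q n).2) (T (q n).1 (q n).1 x)).re
  have hC : ∀ n, Measurable (C n) := fun n => Complex.measurable_re.comp
    ((TraceClass.matrixElt _ _).continuous.comp_stronglyMeasurable (hT _ _)).measurable
  -- The second alternative keeps the search for a least `n` total; it corresponds to all `w i`
  -- being zero.
  let p : ℕ → X → Prop := fun n x => C n x ≠ 0 ∨ ∀ m, C m x = 0
  have hp : ∀ x, ∃ n, p n x := fun x => by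
    by_cases h : ∃ n, C n x ≠ 0
    · exact ⟨h.choose, Or.inl h.choose_spec⟩
    · exact ⟨0, Or.inr (by simpa using h)⟩
  have hpm : ∀ n, MeasurableSet {x | p n x} := fun n => by
    have h1 : MeasurableSet {x | C n x = 0} := hC n (measurableSet_singleton 0)
    have h2 : MeasurableSet {x | ∀ m, C m x = 0} := by
      rw [Set.ofPred_forall]
      exact MeasurableSet.iInter fun m => hC m (measurableSet_singleton 0)
    exact h1.compl.union h2
  let f : ι → ℕ → X → H := fun j n x =>
    ((√(C n x))⁻¹ : ℂ) • (T j (q n).1 x).op (b (q n).2)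
  have hf : ∀ j n, Measurable (f j n) := fun j n => by
    have h1 : StronglyMeasurable fun x => (T j (q n).1 x).op (b (q n).2) :=
      ((TraceClass.opL H).flip (b (q n).2)).continuous.comp_stronglyMeasurable (hT _ _)
    exact (Complex.measurable_ofReal.comp (hC n).sqrt).inv.smul h1.measurable
  refine ⟨fun j x => f j (Nat.find (hp x)) x, fun j =>
    (Measurable.find (hf j) hpm hp).stronglyMeasurable, fun x ⟨w, hw⟩ => ?_⟩
  set n := Nat.find (hp x) with hn
  have hCw : ∀ n, C n x = ‖(inner ℂ (w (q n).1) (b (q n).2) : ℂ)‖ ^ 2 := by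
    intro n
    simp only [C, hw, TraceClass.matrixElt_apply, TraceClass.op_rankOne,
      InnerProductSpace.rankOne_apply, inner_smul_right]
    rw [← inner_conj_symm (b (q n).2), Complex.mul_conj, Complex.ofReal_re,
      Complex.normSq_eq_norm_sq]
  have hfw : ∀ j, f j n x = ((‖(inner ℂ (w (q n).1) (b (q n).2) : ℂ)‖ : ℂ)⁻¹ *
      inner ℂ (w (q n).1) (b (q n).2)) • w j := by
    intro j
    simp only [f, hw, TraceClass.op_rankOne, InnerProductSpace.rankOne_apply, smul_smul]
    rw [hCw, Real.sqrt_sq (norm_nonneg _)]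
  intro i j
  change T i j x = TraceClass.rankOne (f i n x) (f j n x)
  rw [hw, hfw, hfw]
  rcases Nat.find_spec (hp x) with h | h
  · have h1 : ‖(inner ℂ (w (q n).1) (b (q n).2) : ℂ)‖ ≠ 0 := fun h0 => h (by
      rw [← hn, hCw, h0]
      norm_num)
    set c : ℂ := (‖(inner ℂ (w (q n).1) (b (q n).2) : ℂ)‖ : ℂ)⁻¹ *
      inner ℂ (w (q n).1) (b (q n).2) with hc
    -- The common phase `c` cancels between ket and bra.
    have h2 : c * starRingEnd ℂ c = 1 := by
      rw [Complex.mul_conj, Complex.normSq_eq_norm_sq, hc, norm_mul, norm_inv, Complex.norm_real,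
        norm_norm, inv_mul_cancel₀ h1]
      norm_num
    refine TraceClass.ext ?_
    rw [TraceClass.op_rankOne, TraceClass.op_rankOne, map_smulₛₗ, map_smul, smul_apply, smul_smul,
      mul_comm, h2, one_smul]
  · have h1 : ∀ i, w i = 0 := by
      intro i
      refine b.repr.map_eq_zero_iff.1 (lp.ext (funext fun k => ?_))
      obtain ⟨m, hm⟩ := hq (i, k)
      have h2 := h m
      rw [hCw, hm] at h2
      rw [b.repr_apply_apply, ← inner_conj_symm, norm_eq_zero.1 (pow_eq_zero_iff two_ne_zero |>.1 h2)]
      simp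
    simp [h1]

namespace Instrument

/-- The only place where the hypothesis on entanglement-breaking values acts: it removes the second
case of the dichotomy. -/
theorem exists_vector_densities [TopologicalSpace.SeparableSpace H] {M : Instrument X H}
    (hM : ∀ F, MeasurableSet F → IsEntanglementBreaking (M.toFun F) → M.toFun F = 0)
    (hirr : M.IsIrreducible) {ι : Type*} [Countable ι] (b : HilbertBasis ι ℂ H) :
    ∃ (ν : Measure X) (v : ι → X → H), IsFiniteMeasure ν ∧ (∀ i, MemLp (v i) 2 ν) ∧
      ∀ (A : H →L[ℂ] H) (i j F), MeasurableSet F → ∫ x in F, inner ℂ (v i x) (A (v j x)) ∂ν =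
        (TraceClass.mulLeft A (M.toFun F (TraceClass.rankOne (b j) (b i)))).trace := by
  obtain ⟨ν, T, hfin, hν, hTm, hTi, hTF, hT1, hT2⟩ := exists_matrix_densities hirr b
  obtain ⟨v, hvm, hv⟩ := exists_measurable_gram b hTm
  have hpos := M.ae_isPositiveKernel b hTi hTF
  set X₁ : Set X := {x | ∀ i j, T i j x = TraceClass.rankOne (v i x) (v j x)} with hX₁
  have hX₁m : MeasurableSet X₁ := by
    simp only [hX₁, Set.ofPred_forall]
    exact MeasurableSet.iInter fun i => MeasurableSet.iInter fun j =>
      (hTm i j).measurableSet_eq_fun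
        (TraceClass.continuous_rankOne.comp_stronglyMeasurable ((hvm i).prodMk (hvm j)))
  have hdich : ∀ᵐ x ∂ν, x ∈ X₁ ∨
      ∃ (ψ : H) (s : ι → ι → ℂ), ∀ i j, T i j x = s i j • TraceClass.rankOne ψ ψ := by
    filter_upwards [hpos, ae_all_iff.2 hT1, ae_all_iff.2 fun i => ae_all_iff.2 (hT2 i)]
      with x h h1 h2
    rcases h.dichotomy
      (fun i => (h1 i).imp fun u hu => by rw [hu, TraceClass.op_rankOne])
      (fun i j => (h2 i j).imp fun u hu => by
        rw [← TraceClass.op_rankOne, ← hu]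
        rfl) with ⟨w, hw⟩ | ⟨ψ, s, hs⟩
    · exact Or.inl (hv x ⟨w, fun i j => TraceClass.ext (hw i j)⟩)
    · exact Or.inr ⟨ψ, s, fun i j => TraceClass.ext (hs i j)⟩
  -- Off `X₁` the outputs are multiples of a single projector, so `M(X₁ᶜ)` is entanglement-breaking,
  -- hence zero, and `ν` vanishes with it.
  have h0 : ν X₁ᶜ = 0 := by
    refine hν _ hX₁m.compl (hM _ hX₁m.compl ?_)
    refine (M.isQuantumOperation _ hX₁m.compl).isEntanglementBreaking b
      (μ := ν.restrict X₁ᶜ) (fun i j => (hTi i j).integrableOn)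
      (fun i j => hTF i j _ hX₁m.compl) (ae_restrict_of_ae hpos) ?_
    rw [ae_restrict_iff' hX₁m.compl]
    filter_upwards [hdich] with x hx hx1
    exact hx.resolve_left hx1
  have hae : ∀ᵐ x ∂ν, ∀ i j, T i j x = TraceClass.rankOne (v i x) (v j x) := h0
  refine ⟨ν, v, hfin, fun i => ?_, fun A i j F hF => ?_⟩
  · rw [memLp_two_iff_integrable_sq_norm (hvm i).aestronglyMeasurable]
    refine (TraceClass.trace.integrable_comp (hTi i i)).re.congr ?_
    filter_upwards [hae] with x hx
    rw [hx, TraceClass.trace_rankOne]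
    exact inner_self_eq_norm_sq (𝕜 := ℂ) _
  · rw [← hTF j i F hF]
    refine Eq.trans ?_ ((TraceClass.trace ∘L TraceClass.mulLeftL A).integral_comp_comm
      (hTi j i).integrableOn)
    refine integral_congr_ae (ae_restrict_of_ae ?_)
    filter_upwards [hae] with x hx
    rw [hx]
    exact (TraceClass.trace_mulLeft_rankOne _ _ _).symm

theorem IsIrreducible.isEfficient [TopologicalSpace.SeparableSpace H] {M : Instrument X H}
    (hirr : M.IsIrreducible)
    (hM : ∀ F, MeasurableSet F → IsEntanglementBreaking (M.toFun F) → M.toFun F = 0) :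
    M.IsEfficient := by
  let b := basis H
  have := countable_of_hilbertBasis b
  obtain ⟨ν, v, hfin, hv, hvF⟩ := exists_vector_densities hM hirr b
  obtain ⟨J, hJ⟩ := exists_isometry_vectorL2 (H := H) (LinearIsometry.id (R := ℂ) (E := Lp ℂ 2 ν))
  have hJs : Function.Surjective J := surjective_of_vecMulL hJ
  -- The vector `z i` in `H ⊗ L²(ν)` represents the function `v i` and will be `V (b i)`.
  choose z hz using fun i => hJs (hv i).toLp
  have hinner : ∀ (A : H →L[ℂ] H) (i j F) (hF : MeasurableSet F),
      inner ℂ (z i) (opTensor A ((indicatorSpectralMeasure ν).toFun F) (z j)) =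
        (TraceClass.mulLeft A (M.toFun F (TraceClass.rankOne (b j) (b i)))).trace := by
    intro A i j F hF
    rw [inner_opTensor_eq_setIntegral hJ (fun k k' => by
      rw [indicatorSpectralMeasure_apply hF]
      exact inner_indicatorL hF k k') A, ← hvF A i j F hF, hz, hz]
    refine integral_congr_ae (ae_restrict_of_ae ?_)
    filter_upwards [(hv i).coeFn_toLp, (hv j).coeFn_toLp] with x h1 h2
    rw [h1, h2]
  have h1 : opTensor (1 : H →L[ℂ] H) (1 : Lp ℂ 2 ν →L[ℂ] Lp ℂ 2 ν) = 1 :=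
    htensor_ext fun x k => by simp
  -- Trace preservation gives `⟨z i, z j⟩ = Tr M(X)[|b j⟩⟨b i|] = ⟨b i, b j⟩`.
  obtain ⟨V, hV⟩ := exists_isometry_of_inner_eq (u := b) (w := z)
    (Submodule.dense_iff_topologicalClosure_eq_top.2 b.dense_span) fun i j => by
      have h2 := hinner 1 i j Set.univ MeasurableSet.univ
      rw [(indicatorSpectralMeasure ν).univ_eq_one, h1] at h2
      refine h2.trans ?_
      rw [← TraceClass.trace_rankOne (b j), ← M.trace_univ (TraceClass.rankOne (b j) (b i))]
      congr 1
  refine ⟨Lp ℂ 2 ν, inferInstance, inferInstance, inferInstance, V, indicatorSpectralMeasure ν,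
    hasMultiplicityOne_indicatorSpectralMeasure, fun F hF A T => ?_⟩
  -- Both sides of the duality relation are bounded functionals of `T`, so it suffices to compare
  -- them on `|b i⟩⟨b j|`.
  have h2 := TraceClass.ext_of_basis b (f := TraceClass.trace ∘L TraceClass.mulLeftL
    (ContinuousLinearMap.adjoint V.toContinuousLinearMap ∘L
      opTensor A ((indicatorSpectralMeasure ν).toFun F) ∘L V.toContinuousLinearMap))
    (g := TraceClass.trace ∘L TraceClass.mulLeftL A ∘L M.toFun F) fun i j => by
      change (TraceClass.mulLeft _ _).trace = (TraceClass.mulLeft _ _).trace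
      rw [TraceClass.trace_mulLeft_rankOne, ContinuousLinearMap.comp_apply,
        ContinuousLinearMap.adjoint_inner_right]
      refine Eq.trans ?_ (hinner A j i F hF)
      rw [← hV, ← hV]
      rfl
  exact congrArg (fun L => L T) h2

end Instrument

end IrreducibleEfficient

end QuantumInstrument

theorem mainTheorem10 {H : Type*} [NormedAddCommGroup H] [InnerProductSpace ℂ H]
    [CompleteSpace H] [TopologicalSpace.SeparableSpace H] {X : Type*} [MeasurableSpace X]
    (M : QuantumInstrument.Instrument X H)
    (hM : ∀ F : Set X, MeasurableSet F →
      QuantumInstrument.IsEntanglementBreaking (M.toFun F) → M.toFun F = 0) :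
    M.IsEfficient ↔ M.IsIrreducible :=
  ⟨fun h => h.isIrreducible, fun h => h.isEfficient hM⟩
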